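/- **Setting.** Fix integers $2\le s_1<\dots<s_N$ and put $s:=\gcd(s_1,\dots,s_N)$. For $\zeta\in\mathbb C^N$ let $F(y,x;\zeta):=y-1-\sum_{n=1}^N\zeta_n x^{s_n}y^{s_n}$, let $U(\cdot;\zeta)$ be the unique analytic germ at $x=0$ with $U(0;\zeta)=1$ and $F(U(x;\zeta),x;\zeta)=0$, let $\rho_*(\zeta)\in(0,\infty]$ be the radius of the largest disk $|x|<\rho_*(\zeta)$ on which it is analytic, and write $U(x;\zeta)^p=\sum_{m\ge0}R_p(m;\zeta)x^{ms}$ for $p\ge1$. *Dominance.* A point $x_*$ with $|x_*|=\rho_*(\zeta)$ is *dominant* for $\zeta$ if the points of $|x|=\rho_*(\zeta)$ across which $U(\cdot;\zeta)$ has no analytic continuation are exactly $e^{2\pi ij/s}x_*$, $0\le j<s$. Its *branch value* is $\lambda=\lim U(x;\zeta)$ as $x\to x_*$, $|x|<\rho_*(\zeta)$. It is *simple* if $\lambda$ exists and is finite and $F=\partial_yF=0\ne\partial_y^2F$ at $(\lambda,x_*;\zeta)$. Let $\mathcal C$ be the set of $\zeta$ with $\rho_*(\zeta)=1$ that have a dominant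 point; $\zeta_c\in\mathcal C$ is a *simple critical point* if it has a simple dominant point. *Trajectory.* A Laplacian-growth reduction on $[0,T_c)$, $T_c>0$, consists of real-analytic functions $r>0$ and $a_1,\dots,a_N$ (complex) such that the maps $f(w;T)=r(T)w+\sum_n a_n(T)w^{1-s_n}$ are univalent on $|w|>1$ and $\operatorname{Re}\bigl(\overline{w\,\partial_wf}\;\partial_Tf\bigr)=1$ on $|w|=1$. Its reduced trajectory is $\zeta_n(T)=a_n(T)/r(T)$. *Uniform square-root continuation along $T\uparrow T_c$.* There are constants $\delta,\eta_0,C_0,c_0>0$, $M<\infty$ and $\phi\in(0,\pi/2)$ and, for each $T\in(T_c-\delta,T_c)$, a dominant point $x_*=x_*(T)$ of $\zeta(T)$ with branch value $\lambda=\lambda(T)$, numbers $\kappa(T),c(T),d(T)$ and a function $\widehat U(\cdot;T)$, such that, with $z_*:=x_*^s$, $\rho:=(1+\rho_*(\zeta(T)))/2$ and $\Omega:=\{\,|z|<|z_*|+\eta_0/2,\ z\ne z_*,\ |\arg(z/z_*-1)|>\phi\,\}$ (all depending on $T$): (U1) $\widehat U$ is holomorphic on $\Omega$, continuous on $\overline\Omega$,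 $\widehat U(x^s;T)=U(x;\zeta(T))$ near $x=0$, $\{|z|\le\rho^s\}\subset\Omega$, and $|\widehat U|\le M$ on $\partial\Omega$; (U2) for $z\in\Omega$ with $|\delta_z|<\eta_0$, where $\delta_z:=1-z/z_*$, $$\bigl|\widehat U(z;T)-\lambda-s^{-1/2}\kappa\,\delta_z^{1/2}-c\,\delta_z-d\,\delta_z^{3/2}\bigr|\le C_0|\delta_z|^2$$ (principal branches), and $|\lambda|,|\kappa|\ge c_0$, $|\lambda|+|\kappa|+|c|+|d|\le C_0$. *Blocks.* Call $\alpha$ *admissible* if there are $M_0,L_0$ with $\alpha>\max\{M_0,L_0\}$ such that, for all $T<T_c$ close to $T_c$, $|U(x;\zeta(T))|\le M_0$ on $|x|=(1+\rho_*(\zeta(T)))/2$ and every branch value at a dominant point of $\zeta(T)$ has modulus at most $L_0$. For $1\le q\le s$, $\beta>0$ put $p_j:=q+js$, $w_j:=p_j^{3/2+\beta}\alpha^{p_j}$ and $v^{(p_k)}_j:=\frac{p_j}{\sqrt{p_k}}R_{p_k}(j-k;\zeta)$ for $j\ge k$, $v^{(p_k)}_j:=0$ for $j<k$. Let $\widetilde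 V^{(q)}(\zeta)$ be the bounded operator on $\ell^2(\mathbb N_0)$, if it exists, with $\widetilde V^{(q)}(\zeta)e_k=v^{(p_k)}/w_k$ for all $k$, and $\widetilde G^{(q)}:=\widetilde V^{(q)*}\widetilde V^{(q)}$, $\widetilde H^{(q)}:=\widetilde V^{(q)}\widetilde V^{(q)*}$ (the renormalized Gram and Hessian blocks). For a bounded self-adjoint $A$ let $\mu_k(A):=\inf_{\dim L=k-1}\sup_{u\perp L,\|u\|=1}\langle u,Au\rangle$, $k\ge1$. **Theorem.** Let $\zeta(T)$ be the reduced trajectory of a Laplacian-growth reduction on $[0,T_c)$, and assume that $\zeta$ extends to be real-analytic on $(T_c-\delta_0,T_c]$ for some $\delta_0>0$. Suppose that $\zeta(T_c)=\zeta_c\in\mathcal C$ is a simple critical point, that the (left) derivative satisfies $\frac{d}{dT}\rho_*(\zeta(T))\big|_{T=T_c}\ne0$, that for all $T<T_c$ close to $T_c$ one has $\rho_*(\zeta(T))>1$ and $\zeta(T)$ has a simple dominant point, and that the uniform square-root continuation condition holds along $T\uparrow T_c$. Then all sufficiently large $\alpha$ are admissible. Moreover there are a simple dominant point $x_{*,c}$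 of $\zeta_c$ with branch value $\lambda_c$ and a number $\kappa_c$ with $U(x;\zeta_c)=\lambda_c+\kappa_c\sqrt{1-x/x_{*,c}}+O(1-x/x_{*,c})$ as $x\to x_{*,c}$, $|x|<1$, such that for every $\beta>0$, every admissible $\alpha$ and every $q\in\{1,\dots,s\}$ the following holds. With $$A^{(c)}_p:=-\frac{s^{-1/2}}{2\sqrt\pi}\,p\,\kappa_c\lambda_c^{p-1},\qquad \widetilde d^{(q)}_c(j):=e^{-ij\arg(x_{*,c}^s)}\frac{s}{\sqrt{p_j}}\,\frac{\overline{A^{(c)}_{p_j}}}{w_j}$$ one has $\widetilde d^{(q)}_c\in\ell^2(\mathbb N_0)$ and $\Gamma^{(q)}:=\|\widetilde d^{(q)}_c\|^2>0$, and there is $\delta>0$ such that for $T\in(T_c-\delta,T_c)$ the operator $\widetilde V^{(q)}(\zeta(T))$ exists, the levels $\mu_k^{(q)}(T):=\mu_k(\widetilde G^{(q)}(\zeta(T)))$ satisfy $\mu_k^{(q)}(T)=\mu_k(\widetilde H^{(q)}(\zeta(T)))$ for all $k\ge1$, and $$\mu^{(q)}_1(T)=\Gamma^{(q)}\log\frac1{T_c-T}+O(1)\to\infty\quad(T\uparrow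 T_c),\qquad \sup_{T_c-\delta<T<T_c}\mu_k^{(q)}(T)<\infty\quad\text{for every }k\ge2 .$$ -/

import Mathlib

open Set Filter Topology Asymptotics
open scoped ENNReal ContDiff

noncomputable section

/-- The exponents `2 ≤ s₁ < ⋯ < s_N` of a polynomial leaf
`f(w) = r w + ∑ₙ aₙ w ^ (1 - sₙ)` of exterior conformal maps. -/
structure PolynomialLeaf (N : ℕ) where
  exponent : Fin N → ℕ
  strictMono : StrictMono exponent
  two_le : ∀ n, 2 ≤ exponent n

namespace PolynomialLeaf

/-- The symmetry index `s = gcd(s₁, …, s_N)`. -/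
def symIndex {N : ℕ} (S : PolynomialLeaf N) : ℕ := Finset.univ.gcd S.exponent

/-! ### Laplacian growth on a leaf -/

/-- The map `f(w) = r w + ∑ₙ aₙ w ^ (1 - sₙ)`. -/
def leafMap {N : ℕ} (S : PolynomialLeaf N) (r : ℝ) (a : Fin N → ℂ) (w : ℂ) : ℂ :=
  (r : ℂ) * w + ∑ n, a n * w ^ (1 - (S.exponent n : ℤ))

/-- A Laplacian-growth reduction on the time interval `I`: real-analytic coefficients `r > 0`, `a`
such that the maps are univalent on `|w| > 1` and solve the Polubarinova–Galin equation
`Re (conj (w ∂_w f) ∂_T f) = 1` on `|w| = 1`. -/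
structure IsLaplacianGrowth {N : ℕ} (S : PolynomialLeaf N)
    (r : ℝ → ℝ) (a : ℝ → Fin N → ℂ) (I : Set ℝ) : Prop where
  radius_pos : ∀ T ∈ I, 0 < r T
  analytic_radius : AnalyticOn ℝ r I
  analytic_coeff : AnalyticOn ℝ a I
  univalent : ∀ T ∈ I, InjOn (S.leafMap (r T) (a T)) {w : ℂ | 1 < ‖w‖}
  polubarinova_galin : ∀ T ∈ I, ∀ w : ℂ, ‖w‖ = 1 →
    ((starRingEnd ℂ) (w * deriv (S.leafMap (r T) (a T)) w) *
      derivWithin (fun t => S.leafMap (r t) (a t) w) I T).re = 1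

/-! ### The inverse-map equation and its Taylor branch -/

/-- `F(y, x; ζ) = y - 1 - ∑ₙ ζₙ x ^ sₙ y ^ sₙ`. -/
def invF {N : ℕ} (S : PolynomialLeaf N) (ζ : Fin N → ℂ) (y x : ℂ) : ℂ :=
  y - 1 - ∑ n, ζ n * x ^ S.exponent n * y ^ S.exponent n

/-- `U` is analytic on the open set `D ∋ 0` and continues the germ at `0` with `U(0) = 1` that
solves `F(U(x), x; ζ) = 0`. -/
def IsTaylorBranchOn {N : ℕ} (S : PolynomialLeaf N) (ζ : Fin N → ℂ) (U : ℂ → ℂ) (D : Set ℂ) :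
    Prop :=
  DifferentiableOn ℂ U D ∧ U 0 = 1 ∧ ∀ᶠ x in 𝓝 (0 : ℂ), S.invF ζ (U x) x = 0

/-- The radius of analyticity `ρ_*(ζ)` of the Taylor branch (it is `∞` for `ζ = 0`). -/
def rhoStar {N : ℕ} (S : PolynomialLeaf N) (ζ : Fin N → ℂ) : ℝ≥0∞ :=
  sSup {ρ : ℝ≥0∞ | 0 < ρ ∧ ∃ U : ℂ → ℂ, S.IsTaylorBranchOn ζ U {x : ℂ | ‖x‖ₑ < ρ}}

/-- The open disk `|x| < ρ_*(ζ)`. -/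
def analyticDisk {N : ℕ} (S : PolynomialLeaf N) (ζ : Fin N → ℂ) : Set ℂ :=
  {x : ℂ | ‖x‖ₑ < S.rhoStar ζ}

theorem isOpen_eball (ρ : ℝ≥0∞) : IsOpen {x : ℂ | ‖x‖ₑ < ρ} :=
  isOpen_lt continuous_enorm continuous_const

theorem convex_eball (ρ : ℝ≥0∞) : Convex ℝ {x : ℂ | ‖x‖ₑ < ρ} := by
  rcases eq_or_ne ρ ⊤ with rfl | hρ
  · have : {x : ℂ | ‖x‖ₑ < ⊤} = univ := by ext x; simp
    rw [this]; exact convex_univ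
  · have : {x : ℂ | ‖x‖ₑ < ρ} = Metric.ball 0 ρ.toReal := by
      ext x
      simp only [mem_ofPred_eq, mem_ball_zero_iff]
      rw [← toReal_enorm, ENNReal.toReal_lt_toReal (by simp) hρ]
    rw [this]; exact convex_ball _ _

theorem invF_eq {N : ℕ} (S : PolynomialLeaf N) (ζ : Fin N → ℂ) (y x : ℂ) :
    S.invF ζ y x = y - (1 + ∑ n, ζ n * (x * y) ^ S.exponent n) := by
  simp only [invF, mul_pow, mul_assoc]; ring

theorem contDiff_phi {N : ℕ} (S : PolynomialLeaf N) (ζ : Fin N → ℂ) :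
    ContDiff ℂ 1 (fun t : ℂ => 1 + ∑ n, ζ n * t ^ S.exponent n) := by fun_prop

theorem phi_zero {N : ℕ} (S : PolynomialLeaf N) (ζ : Fin N → ℂ) :
    (1 : ℂ) + ∑ n, ζ n * (0 : ℂ) ^ S.exponent n = 1 := by
  have : ∀ n, ζ n * (0 : ℂ) ^ S.exponent n = 0 := fun n => by
    have := S.two_le n
    rw [zero_pow (by omega), mul_zero]
  simp [this]

/-- The germ at `0` is unique. -/
theorem germ_unique {N : ℕ} (S : PolynomialLeaf N) (ζ : Fin N → ℂ) (U V : ℂ → ℂ)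
    (hU : ContinuousAt U 0) (hV : ContinuousAt V 0)
    (hUF : ∀ᶠ x in 𝓝 (0 : ℂ), S.invF ζ (U x) x = 0)
    (hVF : ∀ᶠ x in 𝓝 (0 : ℂ), S.invF ζ (V x) x = 0) : U =ᶠ[𝓝 0] V := by
  obtain ⟨K, t, ht, hK⟩ := ((S.contDiff_phi ζ).contDiffAt (x := 0)).exists_lipschitzOnWith
  have h1 : ∀ W : ℂ → ℂ, ContinuousAt W 0 → ∀ᶠ x in 𝓝 (0 : ℂ), x * W x ∈ t := fun W hW => by
    have : Tendsto (fun x => x * W x) (𝓝 0) (𝓝 (0 * W 0)) := tendsto_id.mul hW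
    rw [zero_mul] at this
    exact this ht
  have h2 : ∀ᶠ x in 𝓝 (0 : ℂ), (K : ℝ) * ‖x‖ < 1 := by
    have : Tendsto (fun x : ℂ => (K : ℝ) * ‖x‖) (𝓝 0) (𝓝 ((K : ℝ) * ‖(0 : ℂ)‖)) :=
      tendsto_const_nhds.mul tendsto_id.norm
    refine this.eventually_lt_const (by simp)
  filter_upwards [h1 U hU, h1 V hV, h2, hUF, hVF] with x hx1 hx2 hx3 hx4 hx5
  rw [invF_eq, sub_eq_zero] at hx4 hx5
  have h := hK.dist_le_mul _ hx1 _ hx2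
  simp only [← hx4, ← hx5] at h
  rw [dist_eq_norm, dist_eq_norm, ← mul_sub, norm_mul, ← mul_assoc] at h
  by_contra hne
  have hpos : 0 < ‖U x - V x‖ := norm_pos_iff.2 (sub_ne_zero.2 hne)
  nlinarith

/-- The germ at `0` exists. -/
theorem germ_exists {N : ℕ} (S : PolynomialLeaf N) (ζ : Fin N → ℂ) :
    ∃ U : ℂ → ℂ, (∀ᶠ x in 𝓝 (0 : ℂ), DifferentiableAt ℂ U x) ∧ U 0 = 1 ∧
      ∀ᶠ x in 𝓝 (0 : ℂ), S.invF ζ (U x) x = 0 := by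
  set Φ : ℂ → ℂ := fun t => 1 + ∑ n, ζ n * t ^ S.exponent n with hΦ
  have hΦ0 : Φ 0 = 1 := S.phi_zero ζ
  have hΦc : ContDiff ℂ 1 Φ := S.contDiff_phi ζ
  set h : ℂ → ℂ := fun t => t / Φ t with hh
  have hhc : ContDiffAt ℂ 1 h 0 := contDiffAt_id.div hΦc.contDiffAt (by rw [hΦ0]; exact one_ne_zero)
  have hd : HasDerivAt h 1 0 := by
    have := (hasDerivAt_id (0 : ℂ)).div (hΦc.differentiable one_ne_zero 0).hasDerivAt
      (by rw [hΦ0]; exact one_ne_zero)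
    have h1 : ((1 : ℂ) * Φ 0 - id (0 : ℂ) * deriv Φ 0) / Φ 0 ^ 2 = 1 := by simp [hΦ0]
    rw [h1] at this
    exact this
  have hfd : HasFDerivAt h
      ((ContinuousLinearEquiv.unitsEquivAut ℂ (1 : ℂˣ)) : ℂ →L[ℂ] ℂ) 0 := by
    have h1 : ((ContinuousLinearEquiv.unitsEquivAut ℂ (1 : ℂˣ)) : ℂ →L[ℂ] ℂ) =
        ContinuousLinearMap.toSpanSingleton ℂ (1 : ℂ) := by
      ext; simp
    rw [h1]
    exact hd.hasFDerivAt
  have h00 : h 0 = 0 := by simp [hh]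
  set g := hhc.localInverse hfd one_ne_zero with hg
  have hgc : ContDiffAt ℂ 1 g (h 0) := hhc.to_localInverse hfd one_ne_zero
  have hst := hhc.hasStrictFDerivAt' hfd one_ne_zero
  have hg0 : g 0 = 0 := by
    have := hhc.localInverse_apply_image hfd one_ne_zero
    rwa [h00] at this
  have hright : ∀ᶠ x in 𝓝 (0 : ℂ), h (g x) = x := by
    have := hst.eventually_right_inverse
    rw [h00] at this
    exact this
  rw [h00] at hgc
  have hgd : ∀ᶠ x in 𝓝 (0 : ℂ), DifferentiableAt ℂ g x := by
    filter_upwards [hgc.eventually (by simp)] with x hx using hx.differentiableAt one_ne_zero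
  have hne : ∀ᶠ x in 𝓝 (0 : ℂ), Φ (g x) ≠ 0 := by
    have hc : ContinuousAt (fun x => Φ (g x)) 0 :=
      (hΦc.continuous.continuousAt).comp hgc.continuousAt
    refine hc.eventually_ne ?_
    simp [hg0, hΦ0]
  refine ⟨fun x => Φ (g x), ?_, by simp only [hg0, hΦ0], ?_⟩
  · filter_upwards [hgd] with x hx
    exact ((hΦc.differentiable one_ne_zero) _).comp x hx
  · filter_upwards [hright, hne] with x hx hx'
    have : x * Φ (g x) = g x := by
      have h3 : g x / Φ (g x) = x := hx
      rw [div_eq_iff hx'] at h3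
      exact h3.symm
    rw [invF_eq, this, sub_self]

theorem rhoStar_pos {N : ℕ} (S : PolynomialLeaf N) (ζ : Fin N → ℂ) : 0 < S.rhoStar ζ := by
  obtain ⟨U, hU, h1, hF⟩ := S.germ_exists ζ
  obtain ⟨ε, hε, hb⟩ := Metric.eventually_nhds_iff_ball.1 hU
  refine lt_of_lt_of_le (ENNReal.ofReal_pos.2 hε) (le_sSup ⟨ENNReal.ofReal_pos.2 hε, U, ?_, h1, hF⟩)
  intro x hx
  refine (hb x ?_).differentiableWithinAt
  rw [mem_ofPred_eq, ← ofReal_norm, ENNReal.ofReal_lt_ofReal_iff hε] at hx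
  simpa using hx

/-- The Taylor branch is analytic on the whole disk `|x| < ρ_*(ζ)`. -/
theorem exists_taylorBranch {N : ℕ} (S : PolynomialLeaf N) (ζ : Fin N → ℂ) :
    ∃ U : ℂ → ℂ, S.IsTaylorBranchOn ζ U (S.analyticDisk ζ) := by
  classical
  have hex : ∀ x : ℂ, ∃ W : (ℂ → ℂ) × ℝ≥0∞, x ∈ S.analyticDisk ζ →
      ‖x‖ₑ < W.2 ∧ S.IsTaylorBranchOn ζ W.1 {x : ℂ | ‖x‖ₑ < W.2} := by
    intro x
    by_cases hx : x ∈ S.analyticDisk ζ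
    · obtain ⟨ρ, ⟨-, U, hU⟩, hlt⟩ := lt_sSup_iff.1 (show ‖x‖ₑ < sSup _ from hx)
      exact ⟨(U, ρ), fun _ => ⟨hlt, hU⟩⟩
    · exact ⟨(0, 0), fun h => absurd h hx⟩
  choose W hW using hex
  have agree : ∀ x ∈ S.analyticDisk ζ, ∀ y ∈ S.analyticDisk ζ, ‖y‖ₑ < (W x).2 →
      (W y).1 y = (W x).1 y := by
    intro x hx y hy hyx
    obtain ⟨hx1, hx2, -, hx4⟩ := hW x hx
    obtain ⟨hy1, hy2, -, hy4⟩ := hW y hy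
    set D : Set ℂ := {z : ℂ | ‖z‖ₑ < min (W x).2 (W y).2} with hD
    have hDo : IsOpen D := isOpen_eball _
    have hyD : y ∈ D := lt_min hyx hy1
    have h0D : (0 : ℂ) ∈ D := by
      have : ‖(0 : ℂ)‖ₑ ≤ ‖y‖ₑ := by simp
      exact lt_of_le_of_lt this hyD
    have hdx : DifferentiableOn ℂ (W x).1 D :=
      hx2.mono fun z hz => lt_of_lt_of_le (show ‖z‖ₑ < _ from hz) (min_le_left _ _)
    have hdy : DifferentiableOn ℂ (W y).1 D :=
      hy2.mono fun z hz => lt_of_lt_of_le (show ‖z‖ₑ < _ from hz) (min_le_right _ _)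
    have hc : ∀ V : ℂ → ℂ, DifferentiableOn ℂ V D → ContinuousAt V 0 := fun V hV =>
      (hV.differentiableAt (hDo.mem_nhds h0D)).continuousAt
    have hev := S.germ_unique ζ _ _ (hc _ hdy) (hc _ hdx) hy4 hx4
    exact (hdy.analyticOnNhd hDo).eqOn_of_preconnected_of_eventuallyEq (hdx.analyticOnNhd hDo)
      (convex_eball _).isPreconnected h0D hev hyD
  have h0 : (0 : ℂ) ∈ S.analyticDisk ζ := by
    show ‖(0 : ℂ)‖ₑ < _
    simpa using S.rhoStar_pos ζ
  have hDo : IsOpen (S.analyticDisk ζ) := isOpen_eball _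
  have hloc : ∀ x ∈ S.analyticDisk ζ, (fun y => (W y).1 y) =ᶠ[𝓝 x] (W x).1 := by
    intro x hx
    filter_upwards [hDo.mem_nhds hx, (isOpen_eball (W x).2).mem_nhds (hW x hx).1] with y hy hy'
    exact agree x hx y hy hy'
  refine ⟨fun y => (W y).1 y, ?_, (hW 0 h0).2.2.1, ?_⟩
  · intro x hx
    have hd := (hW x hx).2.1.differentiableAt ((isOpen_eball (W x).2).mem_nhds (hW x hx).1)
    exact (hd.congr_of_eventuallyEq (hloc x hx)).differentiableWithinAt
  · filter_upwards [hloc 0 h0, (hW 0 h0).2.2.2] with x hx hx'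
    rw [hx]; exact hx'

/-- The Taylor branch `U(·; ζ)` on `|x| < ρ_*(ζ)`. -/
def taylorBranch {N : ℕ} (S : PolynomialLeaf N) (ζ : Fin N → ℂ) : ℂ → ℂ :=
  Classical.choose (S.exists_taylorBranch ζ)

theorem taylorBranch_spec {N : ℕ} (S : PolynomialLeaf N) (ζ : Fin N → ℂ) :
    S.IsTaylorBranchOn ζ (S.taylorBranch ζ) (S.analyticDisk ζ) :=
  Classical.choose_spec (S.exists_taylorBranch ζ)

/-- The coefficients `R_p(m; ζ) = [x ^ (m s)] U(x; ζ) ^ p`. -/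
def raney {N : ℕ} (S : PolynomialLeaf N) (ζ : Fin N → ℂ) (p m : ℕ) : ℂ :=
  iteratedDeriv (m * S.symIndex) (fun x => S.taylorBranch ζ x ^ p) 0 /
    (Nat.factorial (m * S.symIndex) : ℂ)

/-! ### Dominant orbits and the critical locus -/

/-- A point of the circle `|x| = ρ_*(ζ)` across which the Taylor branch has no analytic
continuation. -/
def IsBoundarySingularity {N : ℕ} (S : PolynomialLeaf N) (ζ : Fin N → ℂ) (x : ℂ) : Prop :=
  ‖x‖ₑ = S.rhoStar ζ ∧
    ¬ ∃ g : ℂ → ℂ, AnalyticAt ℂ g x ∧ g =ᶠ[𝓝[S.analyticDisk ζ] x] S.taylorBranch ζ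

/-- The singular points on `|x| = ρ_*(ζ)` are exactly the points `e ^ (2πij/s) x`: the parameter
lies in the dominant regime, with representative `x`. -/
def IsDominantPoint {N : ℕ} (S : PolynomialLeaf N) (ζ : Fin N → ℂ) (x : ℂ) : Prop :=
  {y : ℂ | S.IsBoundarySingularity ζ y} =
    {y : ℂ | ∃ j : ℕ, j < S.symIndex ∧
      y = Complex.exp (2 * Real.pi * Complex.I * j / S.symIndex) * x} ∧
  ‖x‖ₑ = S.rhoStar ζ

/-- `lam` is the finite value of the Taylor branch at the boundary point `x`. -/
def IsBranchValue {N : ℕ} (S : PolynomialLeaf N) (ζ : Fin N → ℂ) (x lam : ℂ) : Prop :=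
  Tendsto (S.taylorBranch ζ) (𝓝[S.analyticDisk ζ] x) (𝓝 lam)

/-- `x` represents a unique dominant `s`-orbit of simple branch points, with branch value `lam`. -/
def IsSimpleDominantPoint {N : ℕ} (S : PolynomialLeaf N) (ζ : Fin N → ℂ) (x lam : ℂ) : Prop :=
  S.IsDominantPoint ζ x ∧ S.IsBranchValue ζ x lam ∧
    S.invF ζ lam x = 0 ∧
    deriv (fun y => S.invF ζ y x) lam = 0 ∧
    iteratedDeriv 2 (fun y => S.invF ζ y x) lam ≠ 0

/-- The analytic critical locus `𝒞`. -/
def criticalLocus {N : ℕ} (S : PolynomialLeaf N) : Set (Fin N → ℂ) :=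
  {ζ | S.rhoStar ζ = 1 ∧ ∃ x : ℂ, S.IsDominantPoint ζ x}

/-- A simple critical point. -/
def IsSimpleCriticalPoint {N : ℕ} (S : PolynomialLeaf N) (ζ : Fin N → ℂ) : Prop :=
  ζ ∈ S.criticalLocus ∧ ∃ x lam : ℂ, S.IsSimpleDominantPoint ζ x lam

/-- The expansion `U(y) = lam + κ √(1 - y/x) + O(1 - y/x)` of the Taylor branch at the boundary
point `x` (principal square root; `Re (1 - y/x) > 0` on the disk). -/
def HasSqrtCoefficient {N : ℕ} (S : PolynomialLeaf N) (ζ : Fin N → ℂ) (x lam κ : ℂ) : Prop :=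
  (fun y => S.taylorBranch ζ y - lam - κ * (1 - y / x) ^ (1 / 2 : ℂ))
    =O[𝓝[S.analyticDisk ζ] x] (fun y => 1 - y / x)

/-! ### The uniform continuation hypothesis -/

/-- The `Δ`-domain at `ξ ≠ 0` of opening `φ` and thickness `η`: the disk `|z| < |ξ| + η` without the
closed sector of half-angle `φ` with apex `ξ` that points away from the origin. -/
def deltaDomain (ξ : ℂ) (φ η : ℝ) : Set ℂ :=
  {z : ℂ | ‖z‖ < ‖ξ‖ + η ∧ z ≠ ξ ∧ φ < |Complex.arg (z / ξ - 1)|}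

/-- The indented disk `Ω = {|z| < |ξ| + η/2} ∩ Δ(ξ, φ)`. -/
def indentedDisk (ξ : ℂ) (φ η : ℝ) : Set ℂ :=
  Metric.ball 0 (‖ξ‖ + η / 2) ∩ deltaDomain ξ φ η

/-- The midpoint radius `(1 + ρ_*(ζ)) / 2`. -/
def midRadius {N : ℕ} (S : PolynomialLeaf N) (ζ : Fin N → ℂ) : ℝ :=
  (1 + (S.rhoStar ζ).toReal) / 2

/-- The uniform square-root continuation condition along the left-hand approach `T ↑ T_c`.
Here `xs T` is a dominant point, `xs T ^ s` the corresponding point in the variable `z = x ^ s`,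
and `V T` is the Taylor sheet in the variable `z`, continued to the indented disk and continuous
up to its boundary. All constants are independent of `T`. -/
def UniformContinuation {N : ℕ} (S : PolynomialLeaf N) (ζ : ℝ → Fin N → ℂ) (Tc : ℝ) : Prop :=
  ∃ (δ φ η₀ M C₀ c₀ : ℝ) (xs lam κ c d : ℝ → ℂ) (V : ℝ → ℂ → ℂ),
    0 < δ ∧ 0 < φ ∧ φ < Real.pi / 2 ∧ 0 < η₀ ∧ 0 < C₀ ∧ 0 < c₀ ∧
    ∀ T ∈ Ioo (Tc - δ) Tc,
      S.IsDominantPoint (ζ T) (xs T) ∧ S.IsBranchValue (ζ T) (xs T) (lam T) ∧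
      DiffContOnCl ℂ (V T) (indentedDisk (xs T ^ S.symIndex) φ η₀) ∧
      (∀ᶠ x in 𝓝 (0 : ℂ), V T (x ^ S.symIndex) = S.taylorBranch (ζ T) x) ∧
      Metric.closedBall 0 (S.midRadius (ζ T) ^ S.symIndex) ⊆
        indentedDisk (xs T ^ S.symIndex) φ η₀ ∧
      (∀ z ∈ frontier (indentedDisk (xs T ^ S.symIndex) φ η₀), ‖V T z‖ ≤ M) ∧
      c₀ ≤ ‖lam T‖ ∧ c₀ ≤ ‖κ T‖ ∧ ‖lam T‖ + ‖κ T‖ + ‖c T‖ + ‖d T‖ ≤ C₀ ∧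
      ∀ z ∈ indentedDisk (xs T ^ S.symIndex) φ η₀, ‖1 - z / xs T ^ S.symIndex‖ < η₀ →
        ‖V T z - (lam T
            + ((Real.sqrt S.symIndex)⁻¹ : ℂ) * κ T * (1 - z / xs T ^ S.symIndex) ^ (1 / 2 : ℂ)
            + c T * (1 - z / xs T ^ S.symIndex)
            + d T * (1 - z / xs T ^ S.symIndex) ^ (3 / 2 : ℂ))‖
          ≤ C₀ * ‖1 - z / xs T ^ S.symIndex‖ ^ 2

/-! ### The weighted blocks -/

/-- `p_j = q + j s`. -/
def blockIndex {N : ℕ} (S : PolynomialLeaf N) (q j : ℕ) : ℕ := q + j * S.symIndex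

/-- The Gram vectors `v^{(p_k)}_j = (p_j / √p_k) R_{p_k}(j - k; ζ)` for `j ≥ k`, and `0` otherwise;
note `(p_j - p_k) / s = j - k`. -/
def gramVector {N : ℕ} (S : PolynomialLeaf N) (ζ : Fin N → ℂ) (q k j : ℕ) : ℂ :=
  if k ≤ j then
    (S.blockIndex q j : ℂ) / (Real.sqrt (S.blockIndex q k) : ℂ) *
      S.raney ζ (S.blockIndex q k) (j - k)
  else 0

/-- The weights `w_j = p_j ^ (3/2 + β) α ^ p_j`. -/
def weight {N : ℕ} (S : PolynomialLeaf N) (α β : ℝ) (q j : ℕ) : ℝ :=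
  (S.blockIndex q j : ℝ) ^ (3 / 2 + β) * α ^ S.blockIndex q j

/-- `α > max {M₀, L₀}`, where `M₀` bounds the Taylor branch on the midpoint circles and `L₀` bounds
the dominant branch values, for all `T < T_c` close to `T_c`. -/
def IsAdmissibleWeight {N : ℕ} (S : PolynomialLeaf N) (ζ : ℝ → Fin N → ℂ) (Tc α : ℝ) : Prop :=
  ∃ M₀ L₀ : ℝ, max M₀ L₀ < α ∧ ∀ᶠ T in 𝓝[<] Tc,
    (∀ x : ℂ, ‖x‖ = S.midRadius (ζ T) → ‖S.taylorBranch (ζ T) x‖ ≤ M₀) ∧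
    (∀ x lam : ℂ, S.IsDominantPoint (ζ T) x → S.IsBranchValue (ζ T) x lam → ‖lam‖ ≤ L₀)

end PolynomialLeaf

/-- The Hilbert space `ℓ²(ℕ₀)`. -/
abbrev EllTwo : Type := lp (fun _ : ℕ => ℂ) 2

namespace PolynomialLeaf

/-- `V` is a bounded extension to `ℓ²` of the renormalized synthesis map `V^{(q)}(ζ) 𝒲⁻¹`, which is
given on the unit vectors by `e_k ↦ v^{(p_k)} / w_k`. Such an extension is unique. -/
def IsRenormalizedSynthesis {N : ℕ} (S : PolynomialLeaf N) (α β : ℝ) (q : ℕ) (ζ : Fin N → ℂ)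
    (V : EllTwo →L[ℂ] EllTwo) : Prop :=
  ∀ k j : ℕ, (V (lp.single 2 k (1 : ℂ))) j = S.gramVector ζ q k j / (S.weight α β q k : ℂ)

open Classical in
/-- The renormalized synthesis operator (with value `0` if there is no bounded extension). -/
def renormalizedSynthesis {N : ℕ} (S : PolynomialLeaf N) (α β : ℝ) (q : ℕ) (ζ : Fin N → ℂ) :
    EllTwo →L[ℂ] EllTwo :=
  if h : ∃ V : EllTwo →L[ℂ] EllTwo, S.IsRenormalizedSynthesis α β q ζ V then Classical.choose h
  else 0

/-- The renormalized Gram block `Ṽ* Ṽ`. -/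
def renormalizedGram {N : ℕ} (S : PolynomialLeaf N) (α β : ℝ) (q : ℕ) (ζ : Fin N → ℂ) :
    EllTwo →L[ℂ] EllTwo :=
  (ContinuousLinearMap.adjoint (S.renormalizedSynthesis α β q ζ)).comp
    (S.renormalizedSynthesis α β q ζ)

/-- The renormalized Hessian block `Ṽ Ṽ*`. -/
def renormalizedHessian {N : ℕ} (S : PolynomialLeaf N) (α β : ℝ) (q : ℕ) (ζ : Fin N → ℂ) :
    EllTwo →L[ℂ] EllTwo :=
  (S.renormalizedSynthesis α β q ζ).comp
    (ContinuousLinearMap.adjoint (S.renormalizedSynthesis α β q ζ))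

end PolynomialLeaf

/-- The Courant–Fischer levels
`μ_k(A) = inf_{dim L = k - 1} sup_{u ⊥ L, ‖u‖ = 1} ⟨u, A u⟩`, `k ≥ 1`, of a bounded self-adjoint
operator. -/
def variationalLevel {E : Type*} [NormedAddCommGroup E] [InnerProductSpace ℂ E]
    (A : E →L[ℂ] E) (k : ℕ) : ℝ :=
  ⨅ L : {L : Submodule ℂ E // FiniteDimensional ℂ L ∧ Module.finrank ℂ L = k - 1},
    ⨆ u : {u : E // u ∈ (L : Submodule ℂ E)ᗮ ∧ ‖u‖ = 1}, (inner ℂ (u : E) (A u)).re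

namespace PolynomialLeaf

/-- The critical amplitudes `A_p = - s^{-1/2} / (2 √π) · p κ lam^{p-1}`. -/
def criticalAmplitude {N : ℕ} (S : PolynomialLeaf N) (lam κ : ℂ) (p : ℕ) : ℂ :=
  -(((Real.sqrt S.symIndex)⁻¹ / (2 * Real.sqrt Real.pi) : ℝ) : ℂ) * p * κ * lam ^ (p - 1)

/-- The critical spike profile `d(j) = e^{-ijφ} (s / √p_j) conj (A_{p_j}) / w_j`, where
`φ = arg (x ^ s)`. -/
def criticalSpike {N : ℕ} (S : PolynomialLeaf N) (α β : ℝ) (q : ℕ) (x lam κ : ℂ) (j : ℕ) : ℂ :=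
  Complex.exp (-(Complex.I * j * Complex.arg (x ^ S.symIndex))) *
    ((S.symIndex : ℂ) / (Real.sqrt (S.blockIndex q j) : ℂ)) *
    (starRingEnd ℂ) (S.criticalAmplitude lam κ (S.blockIndex q j)) / (S.weight α β q j : ℂ)

end PolynomialLeaf

end

/-! Put `ξ = x_* ^ s`. Near the singular orbit `U` is `lam + κ √(1 - x / x_*)` plus a term of first
order, so singularity analysis gives `R_p(m) ≈ -(s^{-1/2} / (2√π)) p κ lam^{p-1} m^{-3/2} ξ^{-m}`.
After multiplication by `p_j ~ s j` the entry `(j, k)` of the synthesis operator factors to leading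
order: it equals `b_j conj(d_k) + O(m_k / (j+1))` with `b_j = ξ^{-j} (j+1)^{-1/2}` and `∑ m_k < ∞`.
Thus `V = B + ⟨d, ·⟩ b` with `B` bounded uniformly in `T`
(`HasStolzContinuation.norm_gramVector_div_sub_le`, `exists_spike_decomposition`).

The only diverging quantity is `‖b‖² = ∑ |ξ|^{-2j} / (j+1) = -log(1 - r) / r`, `r = |ξ|^{-2}`. Since
`ρ_*` reaches `1` with nonzero slope, this is `log(1 / (T_c - T)) + O(1)` (`isBigO_log_sub`). The
pairing of `b` with the range of `B` stays bounded because `∑ (j+1)^{-3/2} < ∞`, so cross terms do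
not feel the growth of `‖b‖`. Testing on `d` gives `μ_1 = ‖d‖² ‖b‖² + O(1)`. On `d^⊥` one has `V =
B`, which bounds every further level (`variationalLevel_rankOne_perturbation`). The levels of `V V*`
and `V* V` agree for any bounded `V` on an infinite-dimensional space
(`variationalLevel_comp_adjoint_eq`).

The spike `d` depends on `T`, and replacing `‖d‖²` by its limit costs only `O(1)` against the
logarithm if the error is `O(T_c - T)`. This needs `lam` and `|κ|` to converge at a linear rate.
They solve algebraic equations in `σ = (x lam)^s` whose relevant zero is simple, so they inherit the
rate of `ζ` (`isBigO_branch_data`). That limits exist follows from compactness: any cluster point of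
the branch data yields a square-root singularity of the critical branch, which must lie on its only
singular orbit (`exists_critical_limit`).

All coefficient estimates must be uniform in `T` and lose at most `A^p` with `A < α`. The continued
branch is studied on disks of radius `c |1 - u|` about points `u` of the unit disk. Shrinking `c`
lets the bound on the midpoint circle and the bound on the branch value propagate to these disks
(`IsStolzSqrt.exists_narrow_bound`, `IsStolzSqrt.exists_coeff_bound`). -/

/-! ### Variational levels of `V* V` -/

section VariationalLevel

variable {E : Type*} [NormedAddCommGroup E] [InnerProductSpace ℂ E]

theorem re_inner_adjoint_comp_self [CompleteSpace E] (V : E →L[ℂ] E) (u : E) :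
    (inner ℂ u (((ContinuousLinearMap.adjoint V).comp V) u)).re = ‖V u‖ ^ 2 := by
  rw [ContinuousLinearMap.comp_apply, ContinuousLinearMap.adjoint_inner_right]
  exact inner_self_eq_norm_sq (𝕜 := ℂ) (V u)

/-- The levels use subspaces of dimension exactly `k - 1`, whereas images and spans may be smaller.
In infinite dimension they can be padded. -/
theorem exists_finrank_eq_of_finrank_le (hE : ¬ FiniteDimensional ℂ E) (M : Submodule ℂ E)
    [FiniteDimensional ℂ M] {n : ℕ} (hn : Module.finrank ℂ M ≤ n) :
    ∃ L : Submodule ℂ E, M ≤ L ∧ FiniteDimensional ℂ L ∧ Module.finrank ℂ L = n := by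
  induction n, hn using Nat.le_induction with
  | base => exact ⟨M, le_rfl, inferInstance, rfl⟩
  | succ n hn ih =>
    obtain ⟨L, hML, hL, hLn⟩ := ih
    have hne : ∃ x, x ∉ L := by
      by_contra! h
      have : L = ⊤ := by ext x; simp [h x]
      subst this
      exact hE (Module.Finite.equiv (Submodule.topEquiv (R := ℂ) (M := E)))
    obtain ⟨x, hx⟩ := hne
    refine ⟨L ⊔ Submodule.span ℂ {x}, hML.trans le_sup_left, inferInstance, ?_⟩
    have hx0 : x ≠ 0 := fun h => hx (h ▸ L.zero_mem)
    have h1 := Submodule.finrank_sup_add_finrank_inf_eq L (Submodule.span ℂ {x})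
    have h2 : L ⊓ Submodule.span ℂ {x} = ⊥ := by
      rw [Submodule.eq_bot_iff]
      rintro y ⟨hy1, hy2⟩
      obtain ⟨c, rfl⟩ := Submodule.mem_span_singleton.1 hy2
      by_cases hc : c = 0
      · simp [hc]
      · exact absurd ((L.smul_mem_iff hc).1 hy1) hx
    rw [h2, finrank_bot, finrank_span_singleton hx0, hLn] at h1
    omega

theorem bddAbove_range_re_inner (V : E →L[ℂ] E) (L : Submodule ℂ E) :
    BddAbove (range fun u : {u : E // u ∈ Lᗮ ∧ ‖u‖ = 1} => ‖V u‖ ^ 2) := by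
  refine ⟨‖V‖ ^ 2, ?_⟩
  rintro _ ⟨u, rfl⟩
  have := V.le_opNorm u
  rw [u.2.2, mul_one] at this
  show ‖V u‖ ^ 2 ≤ _
  gcongr

variable [CompleteSpace E]

theorem variationalLevel_adjoint_comp_self (V : E →L[ℂ] E) (k : ℕ) :
    variationalLevel ((ContinuousLinearMap.adjoint V).comp V) k =
      ⨅ L : {L : Submodule ℂ E // FiniteDimensional ℂ L ∧ Module.finrank ℂ L = k - 1},
        ⨆ u : {u : E // u ∈ (L : Submodule ℂ E)ᗮ ∧ ‖u‖ = 1}, ‖V u‖ ^ 2 := by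
  simp only [variationalLevel, re_inner_adjoint_comp_self]

theorem variationalLevel_comp_adjoint_self (V : E →L[ℂ] E) (k : ℕ) :
    variationalLevel (V.comp (ContinuousLinearMap.adjoint V)) k =
      variationalLevel ((ContinuousLinearMap.adjoint (ContinuousLinearMap.adjoint V)).comp
        (ContinuousLinearMap.adjoint V)) k := by
  rw [ContinuousLinearMap.adjoint_adjoint]

/-- A subspace `L` with `‖V u‖² ≤ B` for all unit vectors `u ⊥ L` bounds the level from above. -/
theorem variationalLevel_le_of_bound (V : E →L[ℂ] E) {k : ℕ} (L : Submodule ℂ E)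
    (h1 : FiniteDimensional ℂ L) (h2 : Module.finrank ℂ L = k - 1) {B : ℝ} (hB : 0 ≤ B)
    (h : ∀ u ∈ Lᗮ, ‖u‖ = 1 → ‖V u‖ ^ 2 ≤ B) :
    variationalLevel ((ContinuousLinearMap.adjoint V).comp V) k ≤ B := by
  rw [variationalLevel_adjoint_comp_self]
  refine ciInf_le_of_le ⟨0, ?_⟩ ⟨L, h1, h2⟩ (Real.iSup_le (fun u => h u u.2.1 u.2.2) hB)
  rintro _ ⟨M, rfl⟩
  exact Real.iSup_nonneg fun u => by positivity

/-- If `L` competes for `V* V`, a subspace containing `V L` competes for `V V*`: for a unit vector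
`u ⊥ V L` the vector `w = V* u` is orthogonal to `L`, and `‖w‖² = ⟨V w, u⟩ ≤ ‖V w‖`. Hence `‖w‖⁴ ≤ S
‖w‖²`, so `‖w‖² ≤ S`. Applying this to `V*` as well gives equality of the levels. -/
theorem variationalLevel_adjoint_le (hE : ¬ FiniteDimensional ℂ E) (V : E →L[ℂ] E) (k : ℕ) :
    variationalLevel ((ContinuousLinearMap.adjoint (ContinuousLinearMap.adjoint V)).comp
        (ContinuousLinearMap.adjoint V)) k ≤
      variationalLevel ((ContinuousLinearMap.adjoint V).comp V) k := by
  rw [variationalLevel_adjoint_comp_self V k]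
  obtain ⟨L₀, -, hL₀, hL₀n⟩ :=
    exists_finrank_eq_of_finrank_le hE (⊥ : Submodule ℂ E) (n := k - 1) (by simp)
  have : Nonempty {L : Submodule ℂ E // FiniteDimensional ℂ L ∧ Module.finrank ℂ L = k - 1} :=
    ⟨⟨L₀, hL₀, hL₀n⟩⟩
  refine le_ciInf fun ⟨L, hL1, hL2⟩ => ?_
  set S := ⨆ u : {u : E // u ∈ Lᗮ ∧ ‖u‖ = 1}, ‖V u‖ ^ 2 with hS
  have hS0 : 0 ≤ S := Real.iSup_nonneg fun u => by positivity
  have hle : ∀ u ∈ Lᗮ, ‖V u‖ ^ 2 ≤ S * ‖u‖ ^ 2 := by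
    intro u hu
    by_cases hu0 : u = 0
    · simp [hu0]
    have hn : ‖u‖ ≠ 0 := norm_ne_zero_iff.2 hu0
    have h1 := le_ciSup (bddAbove_range_re_inner V L)
      ⟨((‖u‖⁻¹ : ℝ) : ℂ) • u, Lᗮ.smul_mem _ hu, by
        rw [norm_smul, Complex.norm_real, norm_inv, norm_norm, inv_mul_cancel₀ hn]⟩
    simp only [map_smul, norm_smul, Complex.norm_real, norm_inv, norm_norm] at h1
    rw [← hS] at h1
    calc ‖V u‖ ^ 2 = (‖u‖⁻¹ * ‖V u‖) ^ 2 * ‖u‖ ^ 2 := by field_simp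
      _ ≤ S * ‖u‖ ^ 2 := by gcongr
  obtain ⟨L', hL', hL'1, hL'2⟩ := exists_finrank_eq_of_finrank_le hE (L.map (V : E →ₗ[ℂ] E))
    (n := k - 1) (hL2 ▸ Submodule.finrank_map_le _ _)
  refine variationalLevel_le_of_bound _ L' hL'1 hL'2 hS0 fun u hu hu1 => ?_
  set w := ContinuousLinearMap.adjoint V u with hw
  have hwL : w ∈ Lᗮ := by
    rw [Submodule.mem_orthogonal]
    intro l hl
    rw [hw, ContinuousLinearMap.adjoint_inner_right]
    exact (Submodule.mem_orthogonal _ _).1 hu _ (hL' (Submodule.mem_map_of_mem hl))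
  have h1 : ‖w‖ ^ 2 ≤ ‖V w‖ := by
    have h2 : inner ℂ w w = inner ℂ (V w) u := by
      conv_lhs => rw [hw]
      rw [ContinuousLinearMap.adjoint_inner_right]
    have h3 : ‖inner ℂ w w‖ = ‖w‖ ^ 2 := by rw [inner_self_eq_norm_sq_to_K]; simp
    rw [← h3, h2]
    simpa [hu1] using norm_inner_le_norm (𝕜 := ℂ) (V w) u
  have h2 := hle w hwL
  have h3 : (‖w‖ ^ 2) ^ 2 ≤ S * ‖w‖ ^ 2 := le_trans (by gcongr) h2
  by_contra! hcon
  nlinarith [hS0.trans_lt hcon]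

theorem variationalLevel_comp_adjoint_eq (hE : ¬ FiniteDimensional ℂ E) (V : E →L[ℂ] E) (k : ℕ) :
    variationalLevel (V.comp (ContinuousLinearMap.adjoint V)) k =
      variationalLevel ((ContinuousLinearMap.adjoint V).comp V) k := by
  rw [variationalLevel_comp_adjoint_self]
  refine le_antisymm (variationalLevel_adjoint_le hE V k) ?_
  have := variationalLevel_adjoint_le hE (ContinuousLinearMap.adjoint V) k
  simpa only [ContinuousLinearMap.adjoint_adjoint] using this

theorem variationalLevel_one_le (V : E →L[ℂ] E) {B : ℝ} (hB : 0 ≤ B)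
    (h : ∀ u, ‖u‖ = 1 → ‖V u‖ ^ 2 ≤ B) :
    variationalLevel ((ContinuousLinearMap.adjoint V).comp V) 1 ≤ B :=
  variationalLevel_le_of_bound V ⊥ inferInstance (by simp) hB fun u _ hu => h u hu

theorem le_variationalLevel_one (V : E →L[ℂ] E) (u : E) (hu : ‖u‖ = 1) :
    ‖V u‖ ^ 2 ≤ variationalLevel ((ContinuousLinearMap.adjoint V).comp V) 1 := by
  rw [variationalLevel_adjoint_comp_self]
  have : Nonempty {L : Submodule ℂ E // FiniteDimensional ℂ L ∧ Module.finrank ℂ L = 1 - 1} :=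
    ⟨⟨⊥, inferInstance, by simp⟩⟩
  refine le_ciInf fun ⟨L, hL1, hL2⟩ => ?_
  have hL : L = ⊥ := Submodule.finrank_eq_zero.1 (by simpa using hL2)
  subst hL
  exact le_ciSup (bddAbove_range_re_inner V ⊥) ⟨u, by simp, hu⟩

/-- The levels of `V* V` for `V = B + ⟨d, ·⟩ b`: a spike of height `‖d‖² ‖b‖²` over a bounded
background. -/
theorem variationalLevel_rankOne_perturbation (hE : ¬ FiniteDimensional ℂ E)
    (V B : E →L[ℂ] E) (b d : E) {K : ℝ} (hV : ∀ u, V u = B u + inner ℂ d u • b)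
    (hB : ‖B‖ ≤ K) (hbB : ∀ u, ‖inner ℂ b (B u)‖ ≤ K * ‖u‖) (hd : ‖d‖ ≤ K) (hd0 : d ≠ 0) :
    |variationalLevel ((ContinuousLinearMap.adjoint V).comp V) 1 - ‖d‖ ^ 2 * ‖b‖ ^ 2| ≤ 3 * K ^ 2 ∧
    ∀ k, 2 ≤ k → variationalLevel ((ContinuousLinearMap.adjoint V).comp V) k ≤ K ^ 2 := by
  have hK : 0 ≤ K := (norm_nonneg _).trans hd
  have hBu : ∀ u, ‖u‖ = 1 → ‖B u‖ ≤ K := fun u hu => by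
    have := B.le_of_opNorm_le hB u
    rwa [hu, mul_one] at this
  have hsq : ∀ u, ‖V u‖ ^ 2 = ‖B u‖ ^ 2 + 2 * (inner ℂ (B u) (inner ℂ d u • b)).re +
      ‖inner ℂ d u‖ ^ 2 * ‖b‖ ^ 2 := fun u => by
    rw [hV, @norm_add_sq ℂ, norm_smul, mul_pow]; rfl
  -- The estimate goes through `⟨b, B u⟩` rather than `‖b‖ ‖B u‖`, because `‖b‖` is the quantity
  -- that blows up.
  have hcross : ∀ u, ‖u‖ = 1 → |(inner ℂ (B u) (inner ℂ d u • b)).re| ≤ K * K := fun u hu => by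
    refine (Complex.abs_re_le_norm _).trans ?_
    rw [inner_smul_right, norm_mul]
    have h1 := norm_inner_le_norm (𝕜 := ℂ) d u
    have h2 := hbB u
    rw [norm_inner_symm] at h2
    rw [hu, mul_one] at h1 h2
    exact mul_le_mul (h1.trans hd) h2 (norm_nonneg _) hK
  refine ⟨abs_le.2 ⟨?_, ?_⟩, fun k hk => ?_⟩
  -- The normalized vector `d` realizes the full spike, up to the cross term.
  · have hdn : ‖d‖ ≠ 0 := norm_ne_zero_iff.2 hd0
    have hu : ‖((‖d‖⁻¹ : ℝ) : ℂ) • d‖ = 1 := by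
      rw [norm_smul, Complex.norm_real, norm_inv, norm_norm, inv_mul_cancel₀ hdn]
    have h1 := le_variationalLevel_one V _ hu
    rw [hsq] at h1
    have h2 := (abs_le.1 (hcross _ hu)).1
    have h3 : ‖inner ℂ d (((‖d‖⁻¹ : ℝ) : ℂ) • d)‖ = ‖d‖ := by
      rw [inner_smul_right, norm_mul, inner_self_eq_norm_sq_to_K, Complex.norm_real, norm_inv,
        norm_norm]
      simp only [norm_pow, RCLike.norm_ofReal, abs_norm]
      rw [sq, ← mul_assoc, inv_mul_cancel₀ hdn, one_mul]
    rw [h3] at h1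
    nlinarith [sq_nonneg ‖B (((‖d‖⁻¹ : ℝ) : ℂ) • d)‖]
  · rw [sub_le_iff_le_add]
    refine variationalLevel_one_le V (by positivity) fun u hu => ?_
    rw [hsq]
    have h1 := norm_inner_le_norm (𝕜 := ℂ) d u
    rw [hu, mul_one] at h1
    have h2 := (abs_le.1 (hcross _ hu)).2
    have h3 : ‖inner ℂ d u‖ ^ 2 * ‖b‖ ^ 2 ≤ ‖d‖ ^ 2 * ‖b‖ ^ 2 := by gcongr
    have h4 : ‖B u‖ ^ 2 ≤ K ^ 2 := by gcongr; exact hBu u hu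
    nlinarith
  -- One dimension of `L` is spent on `d`. On its orthogonal complement the rank-one part vanishes.
  · obtain ⟨L, hL, hL1, hL2⟩ := exists_finrank_eq_of_finrank_le hE (Submodule.span ℂ {d})
      (n := k - 1) (by rw [finrank_span_singleton hd0]; omega)
    refine variationalLevel_le_of_bound V L hL1 hL2 (by positivity) fun u hu hu1 => ?_
    have h0 : inner ℂ d u = 0 :=
      (Submodule.mem_orthogonal _ _).1 hu d (hL (Submodule.mem_span_singleton_self d))
    rw [hV, h0, zero_smul, add_zero]
    gcongr
    exact hBu u hu1

end VariationalLevel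

/-! ### Operators on `ℓ²` given by columns -/

theorem not_finiteDimensional_ellTwo : ¬ FiniteDimensional ℂ EllTwo := by
  intro h
  have hli : LinearIndependent ℂ (fun i : ℕ => (lp.single 2 i (1 : ℂ) : EllTwo)) := by
    refine LinearIndependent.of_comp
      (LinearMap.pi fun j : ℕ => ((lp.evalCLM ℂ (fun _ : ℕ => ℂ) 2 j : EllTwo →L[ℂ] ℂ) : EllTwo →ₗ[ℂ] ℂ)) ?_
    have : (⇑(LinearMap.pi fun j : ℕ => ((lp.evalCLM ℂ (fun _ : ℕ => ℂ) 2 j : EllTwo →L[ℂ] ℂ) : EllTwo →ₗ[ℂ] ℂ)) ∘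
        fun i : ℕ => (lp.single 2 i (1 : ℂ) : EllTwo)) = fun i => Pi.single i (1 : ℂ) := by
      ext i j
      simp [lp.evalCLM, lp.single_apply]
    rw [this]
    exact Pi.linearIndependent_single_one ℕ ℂ
  exact not_finite_iff_infinite.2 inferInstance hli.finite

theorem ellTwo_norm_sq (f : EllTwo) : ‖f‖ ^ 2 = ∑' i, ‖f i‖ ^ 2 := by
  have := lp.norm_rpow_eq_tsum (p := 2) (by norm_num) f
  simpa using this

/-- Finitely supported sequences are dense. This makes the arbitrary choice in
`renormalizedSynthesis` harmless. -/
theorem ellTwo_clm_ext {V W : EllTwo →L[ℂ] EllTwo}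
    (h : ∀ k j : ℕ, (V (lp.single 2 k (1 : ℂ))) j = (W (lp.single 2 k (1 : ℂ))) j) : V = W := by
  have h1 : ∀ (k : ℕ) (c : ℂ), V (lp.single 2 k c) = W (lp.single 2 k c) := fun k c => by
    have h2 : (lp.single 2 k c : EllTwo) = c • lp.single 2 k (1 : ℂ) := by
      rw [← lp.single_smul]; simp
    rw [h2, map_smul, map_smul]
    congr 1
    exact lp.ext (funext fun j => h k j)
  ext1 f
  have hs := lp.hasSum_single (p := 2) (by norm_num) f
  have hV := hs.mapL V
  have hW := hs.mapL W
  simp only [h1] at hV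
  exact hV.unique hW

theorem norm_ellTwo_apply_le (f : EllTwo) (i : ℕ) : ‖f i‖ ≤ ‖f‖ := lp.norm_apply_le_norm (by norm_num) f i

/-- A matrix with columns in `ℓ²` of summable norms defines a bounded operator. -/
theorem exists_clm_of_columns (col : ℕ → EllTwo) (m : ℕ → ℝ) (hm : Summable m)
    (hcol : ∀ k, ‖col k‖ ≤ m k) :
    ∃ B : EllTwo →L[ℂ] EllTwo, (∀ k, B (lp.single 2 k (1 : ℂ)) = col k) ∧ ‖B‖ ≤ ∑' k, m k ∧
      ∀ (b : EllTwo) (u : EllTwo) (n : ℕ → ℝ), Summable n → (∀ k, ‖inner ℂ b (col k)‖ ≤ n k) →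
        ‖inner ℂ b (B u)‖ ≤ (∑' k, n k) * ‖u‖ := by
  set ev : ℕ → (EllTwo →L[ℂ] ℂ) := fun k => lp.evalCLM ℂ (fun _ : ℕ => ℂ) 2 k with hev
  have hevn : ∀ k (u : EllTwo), ev k u = u k := fun k u => rfl
  have hev1 : ∀ k, ‖ev k‖ ≤ 1 := fun k =>
    ContinuousLinearMap.opNorm_le_bound _ zero_le_one fun u => by
      rw [one_mul, hevn]; exact norm_ellTwo_apply_le u k
  have hterm : ∀ k, ‖(ev k).smulRight (col k)‖ ≤ m k := fun k => by
    rw [ContinuousLinearMap.norm_smulRight_apply]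
    calc ‖ev k‖ * ‖col k‖ ≤ 1 * ‖col k‖ := by gcongr; exact hev1 k
      _ ≤ m k := by rw [one_mul]; exact hcol k
  -- The operator is an absolutely convergent sum, in operator norm, of the rank-one maps sending
  -- `u` to `u k • col k`.
  have hsum : Summable fun k => (ev k).smulRight (col k) := Summable.of_norm_bounded hm hterm
  have happly : ∀ u, HasSum (fun k => u k • col k) ((∑' k, (ev k).smulRight (col k)) u) := fun u =>
    hsum.hasSum.mapL (ContinuousLinearMap.apply ℂ EllTwo u)
  refine ⟨∑' k, (ev k).smulRight (col k), fun k => ?_, tsum_of_norm_bounded hm.hasSum hterm,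
    fun b u n hn hbn => ?_⟩
  · refine (happly _).unique ?_
    have := hasSum_ite_eq k (col k)
    convert this using 2 with j
    by_cases hj : j = k
    · subst hj; simp
    · simp [hj, lp.single_apply]
  · have h1 : HasSum (fun k => inner ℂ b (u k • col k)) _ := (happly u).mapL (innerSL ℂ b)
    have h2 := tsum_of_norm_bounded (f := fun k => inner ℂ b (u k • col k))
      (hn.mul_right ‖u‖).hasSum fun k => by
        rw [inner_smul_right, norm_mul, mul_comm]
        exact mul_le_mul (hbn k) (norm_ellTwo_apply_le u k) (norm_nonneg _)
          ((norm_nonneg _).trans (hbn k))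
    rw [h1.tsum_eq, tsum_mul_right] at h2
    exact h2

/-! ### Taylor coefficients -/

/-- The Taylor coefficient of `f` at the origin. -/
noncomputable def taylorCoeff (f : ℂ → ℂ) (n : ℕ) : ℂ := iteratedDeriv n f 0 / (n.factorial : ℂ)

theorem HasFPowerSeriesAt.taylorCoeff_eq {f : ℂ → ℂ} {p : FormalMultilinearSeries ℂ ℂ ℂ}
    (h : HasFPowerSeriesAt f p 0) (n : ℕ) : taylorCoeff f n = p.coeff n := by
  obtain ⟨r, hr⟩ := h
  have h1 := hr.factorial_smul 1 n
  rw [iteratedFDeriv_apply_eq_iteratedDeriv_mul_prod] at h1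
  simp only [Finset.prod_const_one, one_smul] at h1
  rw [taylorCoeff, ← h1, FormalMultilinearSeries.coeff, nsmul_eq_mul,
    mul_div_cancel_left₀ _ (Nat.cast_ne_zero.2 n.factorial_ne_zero)]
  rfl

theorem AnalyticAt.hasFPowerSeriesAt_taylorCoeff {f : ℂ → ℂ} (h : AnalyticAt ℂ f 0) :
    HasFPowerSeriesAt f (FormalMultilinearSeries.ofScalars ℂ (taylorCoeff f)) 0 :=
  h.hasFPowerSeriesAt

theorem taylorCoeff_add {f g : ℂ → ℂ} (hf : AnalyticAt ℂ f 0) (hg : AnalyticAt ℂ g 0) (n : ℕ) :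
    taylorCoeff (fun z => f z + g z) n = taylorCoeff f n + taylorCoeff g n := by
  have := (hf.hasFPowerSeriesAt_taylorCoeff.add hg.hasFPowerSeriesAt_taylorCoeff).taylorCoeff_eq n
  have h2 := hf.hasFPowerSeriesAt_taylorCoeff.taylorCoeff_eq n
  have h3 := hg.hasFPowerSeriesAt_taylorCoeff.taylorCoeff_eq n
  rw [h2, h3]
  exact this

theorem taylorCoeff_const_mul {f : ℂ → ℂ} (hf : AnalyticAt ℂ f 0) (c : ℂ) (n : ℕ) :
    taylorCoeff (fun z => c * f z) n = c * taylorCoeff f n := by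
  have := (hf.hasFPowerSeriesAt_taylorCoeff.const_smul (c := c)).taylorCoeff_eq n
  rw [hf.hasFPowerSeriesAt_taylorCoeff.taylorCoeff_eq n]
  exact this

theorem taylorCoeff_const (c : ℂ) (n : ℕ) :
    taylorCoeff (fun _ => c) n = if n = 0 then c else 0 := by
  rcases n with _ | n
  · simp [taylorCoeff]
  · simp [taylorCoeff, iteratedDeriv_const]

theorem taylorCoeff_comp_mul {f : ℂ → ℂ} (hf : AnalyticAt ℂ f 0) (c : ℂ) (n : ℕ) :
    taylorCoeff (fun z => f (c * z)) n = c ^ n * taylorCoeff f n := by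
  have h0 : HasFPowerSeriesAt f (FormalMultilinearSeries.ofScalars ℂ (taylorCoeff f))
      ((c • (1 : ℂ →L[ℂ] ℂ)) 0) := by
    simpa using hf.hasFPowerSeriesAt_taylorCoeff
  have := HasFPowerSeriesAt.taylorCoeff_eq (h0.compContinuousLinearMap) n
  have h1 : (fun z => f (c * z)) = f ∘ ⇑(c • (1 : ℂ →L[ℂ] ℂ)) := by ext z; simp
  rw [h1, this]
  have h2 : (⇑(c • (1 : ℂ →L[ℂ] ℂ)) ∘ (1 : Fin n → ℂ)) = fun _ => c := by ext i; simp
  rw [FormalMultilinearSeries.coeff, FormalMultilinearSeries.compContinuousLinearMap_apply, h2,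
    FormalMultilinearSeries.apply_eq_pow_smul_coeff,
    FormalMultilinearSeries.coeff_ofScalars, smul_eq_mul]

/-- If `f(x) = g(x ^ s)`, the coefficient of `x ^ (m s)` of `f` is the `m`-th coefficient of `g`. -/
theorem taylorCoeff_comp_pow {f g : ℂ → ℂ} (hg : AnalyticAt ℂ g 0) {s : ℕ}
    (hs : 0 < s) (h : ∀ᶠ x in 𝓝 (0 : ℂ), f x = g (x ^ s)) (m : ℕ) :
    taylorCoeff f (m * s) = taylorCoeff g m := by
  classical
  set b : ℕ → ℂ := fun n => if s ∣ n then taylorCoeff g (n / s) else 0 with hb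
  have hinj : Function.Injective fun m : ℕ => m * s := fun a c hac =>
    Nat.eq_of_mul_eq_mul_right hs hac
  have hg1 := hasFPowerSeriesAt_iff.1 hg.hasFPowerSeriesAt_taylorCoeff
  have ht : Tendsto (fun x : ℂ => x ^ s) (𝓝 0) (𝓝 0) := by
    have : Continuous fun x : ℂ => x ^ s := by fun_prop
    simpa [zero_pow hs.ne'] using this.tendsto 0
  have hps : HasFPowerSeriesAt f (FormalMultilinearSeries.ofScalars ℂ b) 0 := by
    rw [hasFPowerSeriesAt_iff]
    filter_upwards [ht.eventually hg1, h] with x hx hx2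
    rw [zero_add] at hx ⊢
    rw [hx2]
    refine (hinj.hasSum_iff ?_).1 ?_
    · intro n hn
      have : ¬ s ∣ n := fun ⟨c, hc⟩ => hn ⟨c, by rw [hc]; exact mul_comm _ _⟩
      simp [hb, this]
    · convert hx using 2 with n
      have h3 : b (n * s) = taylorCoeff g n := by simp [hb, Nat.mul_div_cancel _ hs]
      simp only [FormalMultilinearSeries.coeff_ofScalars, smul_eq_mul, Function.comp_apply, h3]
      rw [← pow_mul, mul_comm n s]
  rw [hps.taylorCoeff_eq, FormalMultilinearSeries.coeff_ofScalars]
  simp [hb, Nat.mul_div_cancel _ hs]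

/-! ### Coefficients of `√(1 - u)` -/

theorem analyticAt_sqrt_one_sub : AnalyticAt ℂ (fun u : ℂ => (1 - u) ^ (1 / 2 : ℂ)) 0 := by
  refine AnalyticAt.cpow (by fun_prop) (by fun_prop) ?_
  simp

theorem taylorCoeff_sqrt_one_sub_eq (n : ℕ) :
    taylorCoeff (fun u : ℂ => (1 - u) ^ (1 / 2 : ℂ)) n = (-1) ^ n * Ring.choose (1 / 2 : ℂ) n := by
  have h := Complex.one_add_cpow_hasFPowerSeriesAt_zero (a := 1 / 2)
  have h1 := taylorCoeff_comp_mul h.analyticAt (-1) n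
  rw [h.taylorCoeff_eq, binomialSeries, FormalMultilinearSeries.coeff_ofScalars] at h1
  simp only [neg_one_mul, ← sub_eq_add_neg] at h1
  exact h1

theorem ringChoose_succ (a : ℂ) (n : ℕ) :
    ((n : ℂ) + 1) * Ring.choose a (n + 1) = (a - n) * Ring.choose a n := by
  have h1 := Ring.descPochhammer_eq_factorial_smul_choose a (n + 1)
  have h0 := Ring.descPochhammer_eq_factorial_smul_choose a n
  rw [descPochhammer_succ_right, Polynomial.smeval_mul, h0] at h1
  simp only [Polynomial.smeval_sub, Polynomial.smeval_X, Polynomial.smeval_natCast, pow_one,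
    nsmul_eq_mul, Nat.factorial_succ, Nat.cast_mul, Nat.cast_succ, pow_zero, mul_one] at h1
  have hf : (n.factorial : ℂ) ≠ 0 := Nat.cast_ne_zero.2 n.factorial_ne_zero
  apply mul_left_cancel₀ hf
  linear_combination -h1

/-- The normalized central binomial coefficient `4⁻ⁿ (2n choose n)`. -/
noncomputable def wallisCoeff : ℕ → ℝ
  | 0 => 1
  | n + 1 => wallisCoeff n * ((2 * n + 1) / (2 * n + 2))

theorem wallisCoeff_pos (n : ℕ) : 0 < wallisCoeff n := by
  induction n with
  | zero => simp [wallisCoeff]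
  | succ n ih => rw [wallisCoeff]; positivity

/-- Both factors have rational successive ratios, so induction suffices. Bounds on the Wallis
product thereby become bounds on central binomial coefficients. -/
theorem wallisCoeff_sq (n : ℕ) : wallisCoeff n ^ 2 * (2 * n + 1) * Real.Wallis.W n = 1 := by
  induction n with
  | zero => simp [wallisCoeff, Real.Wallis.W]
  | succ n ih =>
    rw [wallisCoeff, Real.Wallis.W_succ]
    push_cast
    have h1 : (2 * ((n : ℝ) + 1) + 1) = 2 * n + 3 := by ring
    rw [h1]
    have h2 : (wallisCoeff n * ((2 * (n : ℝ) + 1) / (2 * n + 2))) ^ 2 * (2 * n + 3) *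
        (Real.Wallis.W n * ((2 * n + 2) / (2 * n + 1) * ((2 * n + 2) / (2 * n + 3)))) =
        wallisCoeff n ^ 2 * (2 * n + 1) * Real.Wallis.W n := by field_simp
    rw [h2, ih]

/-- The recursion `(n + 1) C(a, n+1) = (a - n) C(a, n)` at `a = 1/2` telescopes into the central
binomial coefficient; the factor `2n - 1` is `-1` at `n = 0`. -/
theorem taylorCoeff_sqrt_one_sub (n : ℕ) :
    taylorCoeff (fun u : ℂ => (1 - u) ^ (1 / 2 : ℂ)) n =
      ((-(wallisCoeff n / (2 * n - 1)) : ℝ) : ℂ) := by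
  rw [taylorCoeff_sqrt_one_sub_eq]
  induction n with
  | zero => simp [wallisCoeff]
  | succ n ih =>
    have h1 := ringChoose_succ (1 / 2) n
    have hn : ((n : ℂ) + 1) ≠ 0 := by exact_mod_cast n.succ_ne_zero
    have h2 : (2 * (n : ℝ) - 1) ≠ 0 := by
      intro h
      have h3 : (2 * (n : ℤ) - 1 : ℤ) = 0 := by exact_mod_cast h
      omega
    have h2c : (2 * (n : ℂ) - 1) ≠ 0 := by exact_mod_cast h2
    have h4 : (2 * (n : ℂ) + 1) ≠ 0 := by exact_mod_cast (by positivity : (2 * (n : ℝ) + 1) ≠ 0)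
    have h3 : (-1 : ℂ) ^ (n + 1) * Ring.choose (1 / 2 : ℂ) (n + 1) =
        ((n : ℂ) - 1 / 2) / (n + 1) * ((-1) ^ n * Ring.choose (1 / 2 : ℂ) n) := by
      rw [pow_succ]
      field_simp
      linear_combination (-2) * h1
    rw [h3, ih, wallisCoeff]
    push_cast
    have h5 : (2 * ((n : ℂ) + 1) - 1) = 2 * n + 1 := by ring
    rw [h5]
    have h6 : ((n : ℂ) - 1 / 2) = (2 * n - 1) / 2 := by ring
    have h7 : (2 * (n : ℂ) + 2) = 2 * (n + 1) := by ring
    rw [h6, h7]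
    generalize (n : ℂ) + 1 = y at *
    field_simp

/-- With `x = n + 1` and `y = 1 / √(π x)`, Wallis bounds give `0 ≤ c² - y² ≤ 2 / x²`, and dividing
by `c + y ≥ y ≥ 1 / (2x)` gives `c - y ≤ 4 / x`. Replacing `1 / (2x - 3)` by `1 / (2x)` costs `3 /
x²`. The shift to `n + 1` keeps the main term finite at `n = 0`. -/
theorem norm_taylorCoeff_sqrt_one_sub_add_le (n : ℕ) :
    ‖taylorCoeff (fun u : ℂ => (1 - u) ^ (1 / 2 : ℂ)) n +
      ((1 / (2 * √Real.pi * ((n + 1) * √(n + 1))) : ℝ) : ℂ)‖ ≤ 11 / (n + 1 : ℝ) ^ 2 := by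
  rw [taylorCoeff_sqrt_one_sub, ← Complex.ofReal_add, Complex.norm_real, Real.norm_eq_abs]
  set x : ℝ := n + 1 with hx
  have hx1 : 1 ≤ x := by rw [hx]; linarith [(n.cast_nonneg : (0 : ℝ) ≤ n)]
  have hx0 : 0 < x := by linarith
  have hn : (n : ℝ) = x - 1 := by rw [hx]; ring
  set c := wallisCoeff n with hc
  have hc0 : 0 < c := wallisCoeff_pos n
  have hpi := Real.pi_pos
  have hpi3 := Real.pi_gt_three
  have hW := Real.Wallis.W_le n
  have hW' := Real.Wallis.le_W n
  have hWp := Real.Wallis.W_pos n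
  have hcW := wallisCoeff_sq n
  rw [← hc] at hcW
  rw [hn] at hcW hW' ⊢
  have e1 : 2 * (x - 1) + 1 = 2 * x - 1 := by ring
  have e2 : 2 * (x - 1) + 2 = 2 * x := by ring
  have e3 : 2 * (x - 1) - 1 = 2 * x - 3 := by ring
  rw [e1] at hcW
  rw [e1, e2] at hW'
  rw [e3]
  set W := Real.Wallis.W n
  have h2x : 0 < 2 * x - 1 := by linarith
  set y : ℝ := 1 / (√Real.pi * √x) with hy
  have hy0 : 0 < y := by positivity
  have hy2 : y ^ 2 * (Real.pi * x) = 1 := by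
    rw [hy, div_pow, mul_pow, Real.sq_sqrt hpi.le, Real.sq_sqrt hx0.le]; field_simp
  have hclow : y ^ 2 ≤ c ^ 2 := by
    have h1 : (2 * x - 1) * W ≤ Real.pi * x := by nlinarith
    have h2 : 0 < (2 * x - 1) * W := by positivity
    by_contra! hcon
    nlinarith
  have hcup : (c ^ 2 - y ^ 2) * x ^ 2 ≤ 2 := by
    have h1 : (2 * x - 1) * Real.pi ≤ 4 * x * W := by
      rw [div_mul_eq_mul_div, div_le_iff₀ (by positivity)] at hW'
      linarith
    have h3 : c ^ 2 * ((2 * x - 1) ^ 2 * Real.pi) ≤ 4 * x := by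
      calc c ^ 2 * ((2 * x - 1) ^ 2 * Real.pi) = c ^ 2 * (2 * x - 1) * ((2 * x - 1) * Real.pi) := by ring
        _ ≤ c ^ 2 * (2 * x - 1) * (4 * x * W) := by gcongr
        _ = 4 * x * (c ^ 2 * (2 * x - 1) * W) := by ring
        _ = 4 * x := by rw [hcW, mul_one]
    have h4 : (c ^ 2 - y ^ 2) * (x * ((2 * x - 1) ^ 2 * Real.pi)) ≤ 4 * x - 1 := by
      nlinarith [mul_le_mul_of_nonneg_left h3 hx0.le]
    have h5 : x ^ 2 ≤ (2 * x - 1) ^ 2 := by nlinarith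
    have h6 : 0 ≤ c ^ 2 - y ^ 2 := by linarith
    have h7 : (c ^ 2 - y ^ 2) * x ^ 2 * (x * Real.pi) ≤ 4 * x - 1 :=
      le_trans (by
        have := mul_le_mul_of_nonneg_left h5 (mul_nonneg h6 (by positivity : 0 ≤ x * Real.pi))
        nlinarith) h4
    by_contra! hcon
    have : 2 * (x * Real.pi) < (c ^ 2 - y ^ 2) * x ^ 2 * (x * Real.pi) := by gcongr
    nlinarith
  have hcy : y ≤ c := by nlinarith
  have hdiff : (c - y) * x ≤ 4 := by
    by_contra! hcon
    have h1 : x * y ≥ 1 / 2 := by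
      by_contra! h
      have h2 : (x * y) ^ 2 < (1 / 2) ^ 2 := by
        have : 0 < x * y := by positivity
        nlinarith
      have h3 : Real.pi ≤ 4 := Real.pi_le_four
      have : (x * y) ^ 2 * Real.pi = x := by linear_combination x * hy2
      nlinarith
    have h2 : (c ^ 2 - y ^ 2) * x ^ 2 = ((c - y) * x) * ((c + y) * x) := by ring
    nlinarith
  have hinv : |1 / (2 * x - 3) - 1 / (2 * x)| ≤ 3 / x ^ 2 ∧ |1 / (2 * x - 3)| ≤ 2 / x := by
    -- At `n = 0` the number `2x - 3` is `-1`, hence the absolute value and the separate case.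
    have hcase : |2 * x - 3| ≥ x / 2 := by
      rcases Nat.eq_zero_or_pos n with h | h
      · have : x = 1 := by rw [hx, h]; simp
        rw [this]; norm_num
      · have : (1 : ℝ) ≤ n := by exact_mod_cast h
        have : 2 ≤ x := by rw [hx]; linarith
        rw [abs_of_pos (by linarith)]; linarith
    have hne : 2 * x - 3 ≠ 0 := by
      intro h; rw [h, abs_zero] at hcase; linarith
    have h2 : |1 / (2 * x - 3)| ≤ 2 / x := by
      rw [abs_div, abs_one, div_le_div_iff₀ (by linarith) hx0]; linarith
    refine ⟨?_, h2⟩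
    have : 1 / (2 * x - 3) - 1 / (2 * x) = 1 / (2 * x - 3) * (3 / (2 * x)) := by
      field_simp; ring
    rw [this, abs_mul, abs_of_pos (by positivity : 0 < 3 / (2 * x))]
    calc |1 / (2 * x - 3)| * (3 / (2 * x)) ≤ 2 / x * (3 / (2 * x)) := by gcongr
      _ = 3 / x ^ 2 := by field_simp
  have hy1 : y ≤ 1 := by
    have : 1 ≤ Real.pi * x := by nlinarith
    nlinarith
  have hsplit : -(c / (2 * x - 3)) + 1 / (2 * √Real.pi * (x * √x)) =
      -((c - y) * (1 / (2 * x - 3)) + y * (1 / (2 * x - 3) - 1 / (2 * x))) := by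
    have : 1 / (2 * √Real.pi * (x * √x)) = y * (1 / (2 * x)) := by
      rw [hy]; field_simp
    rw [this]; ring
  rw [hsplit, abs_neg]
  refine (abs_add_le _ _).trans ?_
  rw [abs_mul, abs_mul, abs_of_nonneg (sub_nonneg.2 hcy), abs_of_pos hy0]
  calc (c - y) * |1 / (2 * x - 3)| + y * |1 / (2 * x - 3) - 1 / (2 * x)|
      ≤ (4 / x) * (2 / x) + 1 * (3 / x ^ 2) := by
        gcongr
        · rw [le_div_iff₀ hx0]; exact hdiff
        · exact hinv.2
        · exact hinv.1
    _ = 11 / x ^ 2 := by field_simp; norm_num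

/-! ### Coefficient bounds by singularity analysis -/

/-- This is the Poisson integral of the constant `1` at the point `r`, since `|w - r| = |1 - r w|`
for `|w| = 1`. -/
theorem integral_inv_norm_one_sub_sq {r : ℝ} (hr0 : 0 ≤ r) (hr1 : r < 1) :
    ∫ θ in (0 : ℝ)..2 * Real.pi, (‖1 - circleMap 0 r θ‖ ^ 2)⁻¹ = 2 * Real.pi / (1 - r ^ 2) := by
  have hw : (r : ℂ) ∈ Metric.ball (0 : ℂ) 1 := by simp [abs_of_nonneg hr0, hr1]
  have h := DiffContOnCl.circleAverage_poissonKernel_smul (f := fun _ => (1 : ℂ)) (c := 0) (R := 1)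
    (w := (r : ℂ)) diffContOnCl_const hw
  have hnorm : ∀ θ : ℝ, ‖circleMap 0 1 θ - (r : ℂ)‖ = ‖1 - circleMap 0 r θ‖ := fun θ => by
    have h1 : (1 : ℂ) - circleMap 0 r θ =
        circleMap 0 1 θ * (starRingEnd ℂ) (circleMap 0 1 θ - (r : ℂ)) := by
      have h2 : circleMap 0 1 θ * (starRingEnd ℂ) (circleMap 0 1 θ) = 1 := by
        rw [Complex.mul_conj, Complex.normSq_eq_norm_sq]; simp
      rw [map_sub, mul_sub, h2, Complex.conj_ofReal]
      simp [circleMap, mul_comm]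
    rw [h1, norm_mul, RCLike.norm_conj]; simp
  have hr2 : (0 : ℝ) < 1 - r ^ 2 := by nlinarith
  rw [Real.circleAverage_def] at h
  have h2 : ∀ θ : ℝ, ((poissonKernel 0 (r : ℂ) • fun _ => (1 : ℂ)) (circleMap 0 1 θ)) =
      (((1 - r ^ 2) * (‖1 - circleMap 0 r θ‖ ^ 2)⁻¹ : ℝ) : ℂ) := fun θ => by
    simp only [Pi.smul_apply', poissonKernel_def, sub_zero, hnorm]
    simp [abs_of_nonneg hr0, div_eq_mul_inv]
  simp only [h2] at h
  rw [intervalIntegral.integral_ofReal, intervalIntegral.integral_const_mul] at h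
  have h3 : (2 * Real.pi)⁻¹ * ((1 - r ^ 2) *
      ∫ θ in (0 : ℝ)..2 * Real.pi, (‖1 - circleMap 0 r θ‖ ^ 2)⁻¹) = 1 := by
    have h4 := congrArg Complex.re h
    simpa [← Complex.ofReal_pow] using h4
  field_simp at h3 ⊢
  linarith

/-- Growth `|1 - z|^{-2}` on the circle of radius `r` has mean `1 / (1 - r²)` only, so Cauchy's
formula loses one power of `1 - r` instead of two. -/
theorem norm_taylorCoeff_le_of_poisson {g : ℂ → ℂ} {r K : ℝ} (hr0 : 0 < r) (hr1 : r < 1)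
    (hg : DifferentiableOn ℂ g (Metric.closedBall 0 r))
    (hK : ∀ z, ‖z‖ = r → ‖g z‖ ≤ K * (‖1 - z‖ ^ 2)⁻¹) (n : ℕ) :
    ‖taylorCoeff g n‖ * r ^ n ≤ K / (1 - r ^ 2) := by
  have h := hg.circleIntegral_one_div_sub_center_pow_smul hr0 n
  have hn0 : (n.factorial : ℂ) ≠ 0 := Nat.cast_ne_zero.2 n.factorial_ne_zero
  have h1 : ‖∮ z in C(0, r), (1 / (z - 0) ^ (n + 1)) • g z‖ ≤
      ∫ θ in (0 : ℝ)..2 * Real.pi, (r ^ n)⁻¹ * K * (‖1 - circleMap 0 r θ‖ ^ 2)⁻¹ := by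
    refine intervalIntegral.norm_integral_le_of_norm_le (by positivity)
      (Eventually.of_forall fun θ _ => ?_) ?_
    · have hz : ‖circleMap 0 r θ‖ = r := by simp [abs_of_pos hr0]
      simp only [sub_zero, norm_smul, norm_div, norm_pow, norm_one, deriv_circleMap, norm_mul, hz,
        Complex.norm_I, mul_one]
      have := hK _ hz
      calc r * (1 / r ^ (n + 1) * ‖g (circleMap 0 r θ)‖) = (r ^ n)⁻¹ * ‖g (circleMap 0 r θ)‖ := by
            rw [pow_succ]; field_simp
        _ ≤ (r ^ n)⁻¹ * (K * (‖1 - circleMap 0 r θ‖ ^ 2)⁻¹) := by gcongr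
        _ = _ := by ring
    · refine Continuous.intervalIntegrable ?_ _ _
      refine continuous_const.mul (Continuous.inv₀ (by fun_prop) fun θ => ?_)
      have : (1 : ℂ) - circleMap 0 r θ ≠ 0 := fun h0 => by
        have h1 : ‖circleMap 0 r θ‖ = r := by simp [abs_of_pos hr0]
        rw [← sub_eq_zero.1 h0] at h1
        simp at h1; linarith
      positivity
  rw [h, intervalIntegral.integral_const_mul, integral_inv_norm_one_sub_sq hr0.le hr1, smul_eq_mul,
    div_mul_eq_mul_div, mul_div_assoc, norm_mul] at h1
  change _ * ‖taylorCoeff g n‖ ≤ _ at h1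
  have h2 : ‖(2 * Real.pi * Complex.I : ℂ)‖ = 2 * Real.pi := by
    simp [abs_of_pos Real.pi_pos]
  rw [h2] at h1
  have hrn : 0 < r ^ n := by positivity
  have hpi := Real.pi_pos
  have hr2 : (0 : ℝ) < 1 - r ^ 2 := by nlinarith
  rw [le_div_iff₀ hr2]
  have h3 : (r ^ n)⁻¹ * K * (2 * Real.pi / (1 - r ^ 2)) = 2 * Real.pi * (K / (r ^ n * (1 - r ^ 2))) := by
    field_simp
  rw [h3, mul_le_mul_iff_right₀ (by positivity), le_div_iff₀ (by positivity)] at h1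
  linarith

/-- At the radius `1 - 1/(n+2)` the factor `r^n` in Cauchy's formula is bounded below, by `(1 +
1/(n+1))^n ≤ e < 3`. -/
theorem inv_pow_le_three (n : ℕ) : (1 / 3 : ℝ) ≤ (((n : ℝ) + 1) / (n + 2)) ^ n := by
  have h1 : (1 : ℝ) + 1 / (n + 1) ≤ Real.exp (1 / (n + 1)) := by
    linarith [Real.add_one_le_exp (1 / ((n : ℝ) + 1))]
  have h2 : ((n : ℝ) + 1) / (n + 2) = ((1 : ℝ) + 1 / (n + 1))⁻¹ := by field_simp; ring
  have h3 : ((1 : ℝ) + 1 / (n + 1)) ^ n ≤ 3 := by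
    calc ((1 : ℝ) + 1 / (n + 1)) ^ n ≤ (Real.exp (1 / (n + 1))) ^ n := by gcongr
      _ = Real.exp (n * (1 / (n + 1))) := (Real.exp_nat_mul _ _).symm
      _ ≤ Real.exp 1 := by
        apply Real.exp_le_exp.2
        rw [mul_one_div, div_le_one (by positivity)]; linarith
      _ ≤ 3 := by linarith [Real.exp_one_lt_d9]
  rw [h2, inv_pow, one_div]
  gcongr

/-- A function of size `O(|1 - u|)` on Stolz neighbourhoods of the unit disk has coefficients
`O(n⁻²)`. -/
theorem norm_taylorCoeff_le_of_linear_bound {f : ℂ → ℂ} {c K : ℝ} (hc0 : 0 < c) (hc1 : c < 1)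
    (hf : ∀ u : ℂ, ‖u‖ < 1 → DifferentiableOn ℂ f (Metric.closedBall u (c * ‖1 - u‖)) ∧
      ∀ v ∈ Metric.closedBall u (c * ‖1 - u‖), ‖f v‖ ≤ K * ‖1 - u‖) (m : ℕ) :
    ‖taylorCoeff f m‖ ≤ 108 * c⁻¹ ^ 3 * K / (m + 1 : ℝ) ^ 2 := by
  have hne : ∀ u : ℂ, ‖u‖ < 1 → 0 < ‖1 - u‖ := fun u hu => norm_pos_iff.2 fun h => by
    rw [← sub_eq_zero.1 h] at hu; simp at hu
  have hK : 0 ≤ K := by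
    have := (norm_nonneg _).trans ((hf 0 (by simp)).2 0 (by simp [hc0.le]))
    simpa using this
  have hcau : ∀ (k : ℕ) (u : ℂ), ‖u‖ < 1 →
      ‖iteratedDeriv k f u‖ ≤ k.factorial * (K * ‖1 - u‖) / (c * ‖1 - u‖) ^ k := fun k u hu => by
    have h1 := hne u hu
    refine Complex.norm_iteratedDeriv_le_of_forall_mem_sphere_norm_le k (by positivity)
      (DifferentiableOn.diffContOnCl_ball (hf u hu).1 subset_rfl) fun z hz => (hf u hu).2 z (Metric.sphere_subset_closedBall hz)
  have hcinv : 1 ≤ c⁻¹ := (one_le_inv₀ hc0).2 hc1.le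
  -- The main argument differentiates three times, so the first three coefficients are estimated
  -- directly at the origin.
  by_cases hm : m < 3
  · have h1 := hcau m 0 (by simp)
    simp only [sub_zero, norm_one, mul_one] at h1
    have h2 : ‖taylorCoeff f m‖ ≤ c⁻¹ ^ 3 * K := by
      rw [taylorCoeff, norm_div, Complex.norm_natCast]
      calc _ ≤ m.factorial * K / c ^ m / m.factorial := by gcongr
        _ = c⁻¹ ^ m * K := by
          have : (m.factorial : ℝ) ≠ 0 := Nat.cast_ne_zero.2 m.factorial_ne_zero
          rw [inv_pow]; field_simp
        _ ≤ c⁻¹ ^ 3 * K := by gcongr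
    refine h2.trans ?_
    rw [le_div_iff₀ (by positivity)]
    have h3 : (m + 1 : ℝ) ^ 2 ≤ 108 := by
      have : (m : ℝ) ≤ 3 := by exact_mod_cast hm.le
      nlinarith [(m.cast_nonneg : (0 : ℝ) ≤ m)]
    have h4 : 0 ≤ c⁻¹ ^ 3 * K := by positivity
    nlinarith
  · obtain ⟨n, rfl⟩ : ∃ n, m = n + 3 := ⟨m - 3, by omega⟩
    -- Cauchy's estimate on the disks turns `f = O(|1-u|)` into `f''' = O(|1-u|^{-2})`, the growth
    -- with integrable Poisson mean. With `1 - r = 1/(n+2)` the `n`-th coefficient of `f'''` is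
    -- `O(n)`, and division by `(n+1)(n+2)(n+3)` leaves `O(n^{-2})`.
    set r : ℝ := ((n : ℝ) + 1) / (n + 2) with hr
    have hr0 : 0 < r := by positivity
    have hr1 : r < 1 := by rw [hr, div_lt_one (by positivity)]; linarith
    have hdf : DifferentiableOn ℂ f (Metric.ball 0 1) := fun u hu => by
      have hu' : ‖u‖ < 1 := by simpa using hu
      have h1 := hne u hu'
      exact ((hf u hu').1.differentiableAt (Metric.closedBall_mem_nhds u
        (by positivity))).differentiableWithinAt
    have han := hdf.analyticOnNhd Metric.isOpen_ball
    have h3d : DifferentiableOn ℂ (iteratedDeriv 3 f) (Metric.closedBall 0 r) := fun u hu => by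
      have hu' : u ∈ Metric.ball (0 : ℂ) 1 := Metric.closedBall_subset_ball hr1 hu
      exact (iteratedDeriv_eq_iterate (f := f) (n := 3) ▸ (han.iterated_deriv 3) u hu').differentiableAt.differentiableWithinAt
    have h1 := norm_taylorCoeff_le_of_poisson (K := 6 * c⁻¹ ^ 3 * K) hr0 hr1 h3d (fun z hz => by
      have hz1 : ‖z‖ < 1 := by rw [hz]; exact hr1
      have h2 := hne z hz1
      refine (hcau 3 z hz1).trans (le_of_eq ?_)
      simp only [Nat.factorial]
      field_simp
      push_cast
      ring) n
    have h4 : taylorCoeff (iteratedDeriv 3 f) n =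
        ((n + 1 : ℝ) * (n + 2) * (n + 3) : ℝ) * taylorCoeff f (n + 3) := by
      have h5 : iteratedDeriv n (iteratedDeriv 3 f) = iteratedDeriv (n + 3) f := by
        simp only [iteratedDeriv_eq_iterate, ← Function.iterate_add_apply]
      have hn0 : (n.factorial : ℂ) ≠ 0 := Nat.cast_ne_zero.2 n.factorial_ne_zero
      have e1 : ((n : ℂ) + 1) ≠ 0 := by exact_mod_cast (by positivity : (n : ℝ) + 1 ≠ 0)
      have e2 : ((n : ℂ) + 2) ≠ 0 := by exact_mod_cast (by positivity : (n : ℝ) + 2 ≠ 0)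
      have e3 : ((n : ℂ) + 3) ≠ 0 := by exact_mod_cast (by positivity : (n : ℝ) + 3 ≠ 0)
      have e4 : ((n : ℂ) + 2 + 1) ≠ 0 := by rwa [add_assoc, two_add_one_eq_three]
      have e5 : ((n : ℂ) + 1 + 1) ≠ 0 := by rwa [add_assoc, one_add_one_eq_two]
      rw [taylorCoeff, taylorCoeff, h5]
      simp only [Nat.factorial_succ, Nat.cast_mul, Nat.cast_add, Nat.cast_one]
      push_cast
      field_simp
      ring
    rw [h4, norm_mul, Complex.norm_real, Real.norm_of_nonneg (by positivity)] at h1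
    have h6 : 1 / (1 - r ^ 2) ≤ n + 2 := by
      have h7 : 1 - r = 1 / (n + 2) := by rw [hr]; field_simp; ring
      have h8 : 1 / ((n : ℝ) + 2) ≤ 1 - r ^ 2 := by nlinarith
      rw [div_le_iff₀ (by nlinarith)]
      rw [div_le_iff₀ (by positivity)] at h8
      linarith
    have h7 := inv_pow_le_three n
    rw [← hr] at h7
    set X := ‖taylorCoeff f (n + 3)‖ with hX
    have hX0 : 0 ≤ X := norm_nonneg _
    have hL : 0 ≤ c⁻¹ ^ 3 * K := by positivity
    have h8 : ((n : ℝ) + 1) * (n + 2) * (n + 3) * X * (1 / 3) ≤ 6 * c⁻¹ ^ 3 * K * (n + 2) := by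
      calc ((n : ℝ) + 1) * (n + 2) * (n + 3) * X * (1 / 3)
          ≤ ((n : ℝ) + 1) * (n + 2) * (n + 3) * X * r ^ n := by gcongr
        _ ≤ 6 * c⁻¹ ^ 3 * K / (1 - r ^ 2) := h1
        _ = 6 * c⁻¹ ^ 3 * K * (1 / (1 - r ^ 2)) := by ring
        _ ≤ _ := by gcongr
    have h9 : ((n : ℝ) + 1) * (n + 3) * X ≤ 18 * (c⁻¹ ^ 3 * K) := by
      have : (0 : ℝ) < n + 2 := by positivity
      by_contra! hcon
      nlinarith
    push_cast
    -- The constant `108` is `3! · 3 · 6`: from the third derivative, from `r^n ≥ 1/3`, and from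
    -- `(n+4)² ≤ 6 (n+1)(n+3)`.
    rw [le_div_iff₀ (by positivity)]
    have h10 : ((n : ℝ) + 3 + 1) ^ 2 ≤ 6 * ((n + 1) * (n + 3)) := by
      nlinarith [(n.cast_nonneg : (0 : ℝ) ≤ n)]
    calc X * ((n : ℝ) + 3 + 1) ^ 2 ≤ X * (6 * ((n + 1) * (n + 3))) := by gcongr
      _ = 6 * (((n : ℝ) + 1) * (n + 3) * X) := by ring
      _ ≤ 6 * (18 * (c⁻¹ ^ 3 * K)) := by gcongr
      _ = _ := by ring

/-! ### Functions with a square-root singularity on Stolz neighbourhoods of the unit disk -/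

theorem cpow_half_sq (z : ℂ) : (z ^ (1 / 2 : ℂ)) ^ 2 = z := by
  have := Complex.cpow_nat_inv_pow z (n := 2) two_ne_zero
  simp_all

theorem norm_cpow_half_sq (z : ℂ) : ‖z ^ (1 / 2 : ℂ)‖ ^ 2 = ‖z‖ := by
  rw [← norm_pow, cpow_half_sq]

theorem norm_cpow_half (z : ℂ) : ‖z ^ (1 / 2 : ℂ)‖ = √‖z‖ := by
  rw [← norm_cpow_half_sq z, Real.sqrt_sq (norm_nonneg _)]

theorem norm_one_sub_pos {u : ℂ} (hu : ‖u‖ < 1) : 0 < ‖1 - u‖ := norm_pos_iff.2 fun h => by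
  rw [← sub_eq_zero.1 h] at hu; simp at hu

theorem re_one_sub_pos {u : ℂ} (hu : ‖u‖ < 1) : 0 < (1 - u).re := by
  have := (Complex.re_le_norm u).trans_lt hu
  simpa using this

/-- Since `Re u < 1`, `Re (v - 1) < c |1 - u|`, while `|v - 1| ≥ (1 - c) |1 - u|`. So the cosine of
the argument of `v - 1` is below `c / (1 - c) ≤ cos φ`: small disks avoid the excluded sector. -/
theorem ne_one_and_lt_abs_arg_of_stolz {u v : ℂ} {c φ : ℝ} (hφ0 : 0 ≤ φ) (hφ : φ < Real.pi / 2)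
    (hu : ‖u‖ < 1) (hc0 : 0 ≤ c) (hc : c ≤ Real.cos φ / 4) (hv : ‖v - u‖ ≤ c * ‖1 - u‖) :
    v ≠ 1 ∧ φ < |Complex.arg (v - 1)| := by
  have hcos : 0 < Real.cos φ := Real.cos_pos_of_mem_Ioo ⟨by linarith [Real.pi_pos], hφ⟩
  have hcos1 := Real.cos_le_one φ
  have h0 := norm_one_sub_pos hu
  have hn : (1 - c) * ‖1 - u‖ ≤ ‖v - 1‖ := by
    have : ‖1 - u‖ ≤ ‖v - u‖ + ‖v - 1‖ := by
      calc ‖1 - u‖ = ‖(v - u) - (v - 1)‖ := by congr 1; ring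
        _ ≤ _ := norm_sub_le _ _
    linarith
  have hpos : 0 < ‖v - 1‖ := lt_of_lt_of_le (by nlinarith) hn
  have hne : v - 1 ≠ 0 := norm_pos_iff.1 hpos
  refine ⟨sub_ne_zero.1 hne, ?_⟩
  by_contra! hle
  have h1 : Real.cos φ ≤ Real.cos |Complex.arg (v - 1)| :=
    Real.cos_le_cos_of_nonneg_of_le_pi (abs_nonneg _) (by linarith [Real.pi_pos]) hle
  rw [Real.cos_abs, Complex.cos_arg hne, le_div_iff₀ hpos] at h1
  have h2 : (v - 1).re < c * ‖1 - u‖ := by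
    have h3 := Complex.re_le_norm (v - u)
    have h4 := re_one_sub_pos hu
    simp only [Complex.sub_re, Complex.one_re] at h3 h4 ⊢
    linarith
  have h3 : c ≤ Real.cos φ * (1 - c) := by nlinarith
  have h4 := mul_le_mul_of_nonneg_left hn hcos.le
  have h5 := mul_le_mul_of_nonneg_right h3 h0.le
  linarith

/-- This is the case `φ = 0` of the sector estimate. It makes the principal square root of `1 - v`
holomorphic on the disks. -/
theorem one_sub_mem_slitPlane_of_stolz {u v : ℂ} {c : ℝ} (hu : ‖u‖ < 1) (hc0 : 0 ≤ c)
    (hc : c ≤ 1 / 4) (hv : ‖v - u‖ ≤ c * ‖1 - u‖) : 1 - v ∈ Complex.slitPlane := by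
  have h := ne_one_and_lt_abs_arg_of_stolz (φ := 0) le_rfl (by positivity) hu hc0 (by simpa using hc) hv
  rw [Complex.mem_slitPlane_iff]
  by_contra! hcon
  have h1 : Complex.arg (v - 1) = 0 := by
    rw [Complex.arg_eq_zero_iff]
    simp only [Complex.sub_re, Complex.one_re, Complex.sub_im, Complex.one_im] at hcon ⊢
    exact ⟨by linarith [hcon.1], by linarith [hcon.2]⟩
  rw [h1] at h
  simp at h

/-- `W` is bounded by `M` on the Stolz neighbourhoods of the unit disk of aperture `c`, where it has
the expansion `W = lam + k √(1 - v) + O(1 - v)` near `1`. -/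
structure IsStolzSqrt (W : ℂ → ℂ) (lam k : ℂ) (c ε M C : ℝ) : Prop where
  differentiableOn : ∀ u : ℂ, ‖u‖ < 1 → DifferentiableOn ℂ W (Metric.closedBall u (c * ‖1 - u‖))
  norm_le : ∀ u : ℂ, ‖u‖ < 1 → ∀ v ∈ Metric.closedBall u (c * ‖1 - u‖), ‖W v‖ ≤ M
  expansion : ∀ u : ℂ, ‖u‖ < 1 → ∀ v ∈ Metric.closedBall u (c * ‖1 - u‖), ‖1 - v‖ < ε →
    ‖W v - lam - k * (1 - v) ^ (1 / 2 : ℂ)‖ ≤ C * ‖1 - v‖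
  norm_lam_le : ‖lam‖ ≤ C
  norm_k_le : ‖k‖ ≤ C

theorem norm_le_of_mem_stolz {u v : ℂ} {c : ℝ} (hu : ‖u‖ < 1) (hc : 0 ≤ c)
    (hv : v ∈ Metric.closedBall u (c * ‖1 - u‖)) : ‖v‖ ≤ 1 + 2 * c := by
  have h1 : ‖1 - u‖ ≤ 2 := by
    have := norm_sub_le (1 : ℂ) u
    rw [norm_one] at this; linarith
  rw [mem_closedBall_iff_norm] at hv
  have h2 : ‖v‖ ≤ ‖u‖ + ‖v - u‖ := norm_le_norm_add_norm_sub' v u |>.trans (by simp)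
  nlinarith

theorem norm_one_sub_le_of_mem_stolz {u v : ℂ} {c : ℝ}
    (hv : v ∈ Metric.closedBall u (c * ‖1 - u‖)) : ‖1 - v‖ ≤ (1 + c) * ‖1 - u‖ := by
  rw [mem_closedBall_iff_norm] at hv
  have : ‖1 - v‖ ≤ ‖1 - u‖ + ‖v - u‖ := by
    calc ‖1 - v‖ = ‖(1 - u) - (v - u)‖ := by congr 1; ring
      _ ≤ _ := norm_sub_le _ _
  linarith

namespace IsStolzSqrt

theorem bound_near {W : ℂ → ℂ} {lam k : ℂ} {c ε M C : ℝ} (h : IsStolzSqrt W lam k c ε M C)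
    {u v : ℂ} (hu : ‖u‖ < 1) (hv : v ∈ Metric.closedBall u (c * ‖1 - u‖)) (hε : ‖1 - v‖ < ε) :
    ‖W v - lam‖ ≤ C * (√‖1 - v‖ + ‖1 - v‖) := by
  have h1 := h.expansion u hu v hv hε
  have h2 : ‖W v - lam‖ ≤ ‖W v - lam - k * (1 - v) ^ (1 / 2 : ℂ)‖ + ‖k * (1 - v) ^ (1 / 2 : ℂ)‖ := by
    simpa using norm_add_le (W v - lam - k * (1 - v) ^ (1 / 2 : ℂ)) (k * (1 - v) ^ (1 / 2 : ℂ))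
  rw [norm_mul, norm_cpow_half] at h2
  have h3 : ‖k‖ * √‖1 - v‖ ≤ C * √‖1 - v‖ := by gcongr; exact h.norm_k_le
  linarith

/-- A bound on a slightly smaller disk and at the singular value propagates to narrow Stolz
neighbourhoods. -/
theorem exists_narrow_bound {c ε M C M₀ L₀ A : ℝ} (hc0 : 0 < c) (hε : 0 < ε) (hM : 0 ≤ M)
    (hC : 0 < C) (hMA : M₀ < A) (hLA : L₀ < A) :
    ∃ c' δ : ℝ, 0 < c' ∧ c' ≤ c ∧ 0 < δ ∧ δ < 1 ∧
      ∀ (W : ℂ → ℂ) (lam k : ℂ) (θ : ℝ), IsStolzSqrt W lam k c ε M C → 1 - δ ≤ θ → ‖lam‖ ≤ L₀ →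
        (∀ u, ‖u‖ ≤ θ → ‖W u‖ ≤ M₀) →
        ∀ u, ‖u‖ < 1 → ∀ v ∈ Metric.closedBall u (c' * ‖1 - u‖), ‖W v‖ ≤ A := by
  set g := min (A - M₀) (A - L₀) with hg
  have hg0 : 0 < g := lt_min (by linarith) (by linarith)
  -- Within `ε'` of `1`, the square-root expansion keeps `W` within the gap `g` of `lam`.
  set ε' := min (min ε 1) ((g / (2 * C)) ^ 2) with hε'
  have hε'0 : 0 < ε' := by positivity
  have hε'1 : ε' ≤ ε := (min_le_left _ _).trans (min_le_left _ _)
  have hε'2 : ε' ≤ 1 := (min_le_left _ _).trans (min_le_right _ _)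
  have hε'3 : √ε' ≤ g / (2 * C) := Real.sqrt_le_iff.2 ⟨by positivity, min_le_right _ _⟩
  set R := c * (ε' / 2) with hR
  have hR0 : 0 < R := by positivity
  -- The bounds on `t` keep the contracted point `v0` at distance `ε' / 2` from `1`, put `v` in the
  -- ball of radius `R` about `v0`, make the Schwarz increment at most `g`, keep the contraction
  -- factor nonnegative, and keep the new aperture `t / 4` below `c`.
  set t := min (min (ε' / 2) (R / 2)) (min (g * R / (2 * M + 1)) (min 1 c)) with ht
  have ht0 : 0 < t := by positivity
  have ht1 : t ≤ ε' / 2 := (min_le_left _ _).trans (min_le_left _ _)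
  have ht2 : t ≤ R / 2 := (min_le_left _ _).trans (min_le_right _ _)
  have ht3 : t ≤ g * R / (2 * M + 1) := (min_le_right _ _).trans (min_le_left _ _)
  have ht4 : t ≤ 1 := (min_le_right _ _).trans ((min_le_right _ _).trans (min_le_left _ _))
  have ht5 : t ≤ c := (min_le_right _ _).trans ((min_le_right _ _).trans (min_le_right _ _))
  refine ⟨t / 4, t / 2, by positivity, by linarith, by positivity, by linarith, ?_⟩
  intro W lam k θ h hθ hlam hW u hu v hv
  have hvc : v ∈ Metric.closedBall u (c * ‖1 - u‖) :=
    Metric.closedBall_subset_closedBall (by gcongr; linarith) hv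
  by_cases hnear : ‖1 - v‖ < ε'
  · have h1 := h.bound_near hu hvc (hnear.trans_le hε'1)
    have h2 : √‖1 - v‖ ≤ √ε' := Real.sqrt_le_sqrt hnear.le
    have h3 : ‖1 - v‖ ≤ √ε' := by
      have h4 : ε' ≤ √ε' := by
        have := Real.sq_sqrt hε'0.le
        have h5 : √ε' ≤ 1 := Real.sqrt_le_one.2 hε'2
        nlinarith [Real.sqrt_nonneg ε']
      linarith
    have h4 : C * (√‖1 - v‖ + ‖1 - v‖) ≤ g := by
      calc C * (√‖1 - v‖ + ‖1 - v‖) ≤ C * (g / (2 * C) + g / (2 * C)) := by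
            gcongr <;> linarith
        _ = g := by field_simp; norm_num
    have h5 : ‖W v‖ ≤ ‖lam‖ + ‖W v - lam‖ := by simpa using norm_add_le lam (W v - lam)
    linarith [min_le_right (A - M₀) (A - L₀)]
  · rw [not_lt] at hnear
    -- Contraction by this factor carries `|v| ≤ 1 + t/2` into `|v0| ≤ 1 - t/2`, where the bound
    -- `M₀` is available, and moves `v` by at most `t`.
    set θ' : ℝ := (1 - t / 2) / (1 + t / 2) with hθ'
    have hθ'0 : 0 ≤ θ' := div_nonneg (by linarith) (by linarith)
    have hθ'1 : θ' * (1 + t / 2) = 1 - t / 2 := by rw [hθ']; field_simp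
    have hvn := norm_le_of_mem_stolz hu (by positivity) hv
    have hvn' : ‖v‖ ≤ 1 + t / 2 := by linarith
    set v0 : ℂ := (θ' : ℂ) * v with hv0
    have hθ'2 : θ' ≤ 1 := by rw [hθ', div_le_one (by linarith)]; linarith
    have hv0n : ‖v0‖ ≤ 1 - t / 2 := by
      rw [hv0, norm_mul, Complex.norm_real, Real.norm_of_nonneg hθ'0]
      nlinarith
    have hvv0 : ‖v - v0‖ ≤ t := by
      have : v - v0 = ((1 - θ' : ℝ) : ℂ) * v := by rw [hv0]; push_cast; ring
      rw [this, norm_mul, Complex.norm_real, Real.norm_of_nonneg (by linarith)]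
      nlinarith
    have hv01 : ‖v0‖ < 1 := by linarith
    have h1v0 : ε' / 2 ≤ ‖1 - v0‖ := by
      have : ‖1 - v‖ ≤ ‖1 - v0‖ + ‖v - v0‖ := by
        calc ‖1 - v‖ = ‖(1 - v0) - (v - v0)‖ := by congr 1; ring
          _ ≤ _ := norm_sub_le _ _
      linarith
    have hsub : Metric.ball v0 R ⊆ Metric.closedBall v0 (c * ‖1 - v0‖) :=
      Metric.ball_subset_closedBall.trans (Metric.closedBall_subset_closedBall (by rw [hR]; gcongr))
    have hWv0 := hW v0 (by linarith)
    have hmaps : MapsTo W (Metric.ball v0 R) (Metric.closedBall (W v0) (2 * M + 1)) := fun z hz => by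
      rw [mem_closedBall_iff_norm]
      have h1 := h.norm_le v0 hv01 z (hsub hz)
      have h2 := h.norm_le v0 hv01 v0 (hsub (Metric.mem_ball_self hR0))
      linarith [norm_sub_le (W z) (W v0)]
    have hvR : v ∈ Metric.ball v0 R := by rw [mem_ball_iff_norm]; linarith
    -- The Schwarz lemma on the ball of radius `R` about `v0` controls `W v - W v0` using only the
    -- crude bound `M`.
    have h3 := Complex.dist_le_div_mul_dist_of_mapsTo_ball
      ((h.differentiableOn v0 hv01).mono hsub) hmaps hvR
    rw [dist_eq_norm, dist_eq_norm] at h3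
    have h4 : (2 * M + 1) / R * ‖v - v0‖ ≤ g := by
      rw [div_mul_eq_mul_div, div_le_iff₀ hR0]
      rw [le_div_iff₀ (by linarith)] at ht3
      nlinarith
    have h5 : ‖W v‖ ≤ ‖W v0‖ + ‖W v - W v0‖ := by simpa using norm_add_le (W v0) (W v - W v0)
    linarith [min_le_left (A - M₀) (A - L₀)]

end IsStolzSqrt

/-- The remainder `E_p` obeys `E_{p+1} = a E_p + p b^{p-1} (a - b)²`. The factor `A²` stands on the
left to avoid the exponent `p - 2`. -/
theorem norm_pow_sub_linear_le {a b : ℂ} {A : ℝ} (ha : ‖a‖ ≤ A) (hb : ‖b‖ ≤ A) (p : ℕ) :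
    ‖a ^ p - b ^ p - p * b ^ (p - 1) * (a - b)‖ * A ^ 2 ≤ (p : ℝ) ^ 2 * A ^ p * ‖a - b‖ ^ 2 := by
  have hA : 0 ≤ A := (norm_nonneg _).trans ha
  induction p with
  | zero => simp
  | succ p ih =>
    have hE : a ^ (p + 1) - b ^ (p + 1) - ((p + 1 : ℕ) : ℂ) * b ^ (p + 1 - 1) * (a - b) =
        a * (a ^ p - b ^ p - p * b ^ (p - 1) * (a - b)) + p * b ^ (p - 1) * (a - b) ^ 2 := by
      rcases p with _ | p
      · simp
      · simp only [Nat.add_sub_cancel]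
        push_cast
        ring
    rw [hE]
    have h2 : ‖(p : ℂ) * b ^ (p - 1) * (a - b) ^ 2‖ * A ^ 2 ≤ p * A ^ (p + 1) * ‖a - b‖ ^ 2 := by
      rcases p with _ | p
      · simp
      · rw [norm_mul, norm_mul, norm_pow, norm_pow, Complex.norm_natCast]
        simp only [Nat.add_sub_cancel]
        calc ((p + 1 : ℕ) : ℝ) * ‖b‖ ^ p * ‖a - b‖ ^ 2 * A ^ 2
            ≤ ((p + 1 : ℕ) : ℝ) * A ^ p * ‖a - b‖ ^ 2 * A ^ 2 := by gcongr
          _ = _ := by ring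
    calc _ ≤ (‖a * (a ^ p - b ^ p - p * b ^ (p - 1) * (a - b))‖ +
          ‖(p : ℂ) * b ^ (p - 1) * (a - b) ^ 2‖) * A ^ 2 := by gcongr; exact norm_add_le _ _
      _ = ‖a‖ * (‖a ^ p - b ^ p - p * b ^ (p - 1) * (a - b)‖ * A ^ 2) +
          ‖(p : ℂ) * b ^ (p - 1) * (a - b) ^ 2‖ * A ^ 2 := by rw [norm_mul]; ring
      _ ≤ A * ((p : ℝ) ^ 2 * A ^ p * ‖a - b‖ ^ 2) + p * A ^ (p + 1) * ‖a - b‖ ^ 2 := by gcongr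
      _ = (((p : ℝ) ^ 2 + p) * (A ^ (p + 1) * ‖a - b‖ ^ 2)) := by ring
      _ ≤ ((((p + 1 : ℕ) : ℝ)) ^ 2 * (A ^ (p + 1) * ‖a - b‖ ^ 2)) := by
        gcongr
        push_cast
        nlinarith [(p.cast_nonneg : (0 : ℝ) ≤ p)]
      _ = _ := by ring

/-- All errors are measured in the common unit `(p+1)² A^p`, which avoids the truncated exponent `p
- 1`. -/
theorem natCast_mul_norm_pow_pred_le {b : ℂ} {A : ℝ} (hA : 0 < A) (hb : ‖b‖ ≤ A) (p : ℕ) :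
    ‖(p : ℂ) * b ^ (p - 1)‖ ≤ A⁻¹ * ((p + 1 : ℝ) ^ 2 * A ^ p) := by
  rcases p with _ | p
  · simp; positivity
  · rw [norm_mul, Complex.norm_natCast, norm_pow]
    simp only [Nat.add_sub_cancel]
    push_cast
    calc ((p : ℝ) + 1) * ‖b‖ ^ p ≤ ((p : ℝ) + 1 + 1) ^ 2 * A ^ p := by
          gcongr
          nlinarith [(p.cast_nonneg : (0 : ℝ) ≤ p)]
      _ = _ := by rw [pow_succ A p]; field_simp

namespace IsStolzSqrt

/-- Uniform coefficient asymptotics of the powers of `W`. -/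
theorem exists_coeff_bound {c ε M C A c' : ℝ} (hε : 0 < ε)
    (hC : 0 < C) (hA : 0 < A) (hc'0 : 0 < c') (hc'c : c' ≤ c) (hc' : c' ≤ 1 / 4) :
    ∃ K : ℝ, 0 < K ∧ ∀ (W : ℂ → ℂ) (lam k : ℂ), IsStolzSqrt W lam k c ε M C → ‖lam‖ ≤ A →
      (∀ u, ‖u‖ < 1 → ∀ v ∈ Metric.closedBall u (c' * ‖1 - u‖), ‖W v‖ ≤ A) →
      ∀ p m : ℕ, ‖taylorCoeff (fun u => W u ^ p) m +
        p * lam ^ (p - 1) * k * ((1 / (2 * √Real.pi * ((m + 1) * √(m + 1))) : ℝ) : ℂ)‖ ≤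
        K * ((p + 1 : ℝ) ^ 2 * A ^ p) / (m + 1 : ℝ) ^ 2 := by
  -- The first summand comes from the quadratic remainder of the power map, where `√δ + δ ≤ 3 √δ`
  -- for `δ ≤ 4` explains the `9`. The second comes from the error of the expansion of `W`, and the
  -- last from the trivial bound where `|1 - v| ≥ ε`.
  set C1 : ℝ := 9 * C ^ 2 * (A ^ 2)⁻¹ + C * A⁻¹ + (2 + 2 * (C * A⁻¹)) * ε⁻¹ with hC1
  have hC10 : 0 < C1 := by positivity
  refine ⟨108 * c'⁻¹ ^ 3 * (2 * C1) + 1 + 11 * (C * A⁻¹), by positivity, ?_⟩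
  intro W lam k h hlam hWA p m
  set P : ℝ := (p + 1 : ℝ) ^ 2 * A ^ p with hP
  have hP0 : 0 < P := by positivity
  have hp0 : (0 : ℝ) ≤ p := p.cast_nonneg
  have hPA : A ^ p ≤ P := by
    rw [hP]; have : (1 : ℝ) ≤ (p + 1 : ℝ) ^ 2 := by nlinarith
    nlinarith [pow_pos hA p]
  set q : ℂ := (p : ℂ) * lam ^ (p - 1) with hq
  have hqn : ‖q‖ ≤ A⁻¹ * P := natCast_mul_norm_pow_pred_le hA hlam p
  -- Once the constant and the square-root term of `W^p` are removed, the remainder is `O(|1 - v|)`,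
  -- hence has coefficients `O(m^{-2})`. The constant contributes only at `m = 0`.
  set f : ℂ → ℂ := fun u => W u ^ p - lam ^ p - q * k * (1 - u) ^ (1 / 2 : ℂ) with hf
  have hfb : ∀ u : ℂ, ‖u‖ < 1 → DifferentiableOn ℂ f (Metric.closedBall u (c' * ‖1 - u‖)) ∧
      ∀ v ∈ Metric.closedBall u (c' * ‖1 - u‖), ‖f v‖ ≤ (2 * C1 * P) * ‖1 - u‖ := by
    intro u hu
    have hsub : Metric.closedBall u (c' * ‖1 - u‖) ⊆ Metric.closedBall u (c * ‖1 - u‖) :=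
      Metric.closedBall_subset_closedBall (by gcongr)
    refine ⟨?_, fun v hv => ?_⟩
    · refine ((((h.differentiableOn u hu).mono hsub).pow p).sub_const _).sub
        (DifferentiableOn.const_mul (DifferentiableOn.cpow_const (by fun_prop) fun v hv => ?_) _)
      exact one_sub_mem_slitPlane_of_stolz hu hc'0.le hc' (mem_closedBall_iff_norm.1 hv)
    · have h1v := norm_one_sub_le_of_mem_stolz hv
      have hu2 : ‖1 - u‖ ≤ 2 := by
        have := norm_sub_le (1 : ℂ) u
        rw [norm_one] at this; linarith
      have hu0 := norm_nonneg (1 - u)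
      have hv4 : ‖1 - v‖ ≤ 4 := by nlinarith
      have hv2 : ‖1 - v‖ ≤ 2 * ‖1 - u‖ := by nlinarith
      have hsq2 : √‖1 - v‖ ≤ 2 := Real.sqrt_le_iff.2 ⟨by norm_num, by linarith⟩
      have hsqq := Real.sq_sqrt (norm_nonneg (1 - v))
      have hs0 := Real.sqrt_nonneg ‖1 - v‖
      suffices hmain : ‖f v‖ ≤ C1 * P * ‖1 - v‖ by
        calc ‖f v‖ ≤ C1 * P * ‖1 - v‖ := hmain
          _ ≤ C1 * P * (2 * ‖1 - u‖) := by gcongr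
          _ = _ := by ring
      have hWv := hWA u hu v hv
      by_cases hnear : ‖1 - v‖ < ε
      · have hD := h.bound_near hu (hsub hv) hnear
        have hex := h.expansion u hu v (hsub hv) hnear
        have hlin := norm_pow_sub_linear_le hWv hlam p
        rw [← hq] at hlin
        have hD2 : ‖W v - lam‖ ^ 2 ≤ 9 * C ^ 2 * ‖1 - v‖ := by
          have h1 : √‖1 - v‖ + ‖1 - v‖ ≤ 3 * √‖1 - v‖ := by nlinarith
          calc ‖W v - lam‖ ^ 2 ≤ (C * (3 * √‖1 - v‖)) ^ 2 := by
                gcongr; exact hD.trans (by gcongr)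
            _ = 9 * C ^ 2 * (√‖1 - v‖ ^ 2) := by ring
            _ = _ := by rw [hsqq]
        have h1 : ‖W v ^ p - lam ^ p - q * (W v - lam)‖ ≤ 9 * C ^ 2 * (A ^ 2)⁻¹ * P * ‖1 - v‖ := by
          rw [← le_div_iff₀ (by positivity)] at hlin
          refine hlin.trans ?_
          calc (p : ℝ) ^ 2 * A ^ p * ‖W v - lam‖ ^ 2 / A ^ 2
              ≤ P * (9 * C ^ 2 * ‖1 - v‖) / A ^ 2 := by
                rw [hP]; gcongr; linarith
            _ = _ := by field_simp
        have h2 : ‖q * (W v - lam - k * (1 - v) ^ (1 / 2 : ℂ))‖ ≤ C * A⁻¹ * P * ‖1 - v‖ := by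
          rw [norm_mul]
          calc _ ≤ (A⁻¹ * P) * (C * ‖1 - v‖) := by gcongr
            _ = _ := by ring
        have h3 : f v = (W v ^ p - lam ^ p - q * (W v - lam)) +
            q * (W v - lam - k * (1 - v) ^ (1 / 2 : ℂ)) := by rw [hf]; ring
        rw [h3]
        refine (norm_add_le _ _).trans ?_
        have h4 : 0 ≤ (2 + 2 * (C * A⁻¹)) * ε⁻¹ * P * ‖1 - v‖ := by positivity
        calc _ ≤ 9 * C ^ 2 * (A ^ 2)⁻¹ * P * ‖1 - v‖ + C * A⁻¹ * P * ‖1 - v‖ := add_le_add h1 h2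
          _ ≤ _ := by rw [hC1]; linarith
      · rw [not_lt] at hnear
        have h1 : ‖f v‖ ≤ (2 + 2 * (C * A⁻¹)) * P := by
          have e1 : ‖W v ^ p‖ ≤ P := by
            rw [norm_pow]; exact le_trans (by gcongr) hPA
          have e2 : ‖lam ^ p‖ ≤ P := by
            rw [norm_pow]; exact le_trans (by gcongr) hPA
          have e3 : ‖q * k * (1 - v) ^ (1 / 2 : ℂ)‖ ≤ (A⁻¹ * P) * C * 2 := by
            rw [norm_mul, norm_mul, norm_cpow_half]
            gcongr
            exact h.norm_k_le
          have e4 : ‖f v‖ ≤ ‖W v ^ p‖ + ‖lam ^ p‖ + ‖q * k * (1 - v) ^ (1 / 2 : ℂ)‖ :=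
            (norm_sub_le _ _).trans (by gcongr; exact norm_sub_le _ _)
          linarith
        have h2 : 1 ≤ ε⁻¹ * ‖1 - v‖ := by
          rw [inv_mul_eq_div, le_div_iff₀ hε]; linarith
        have h3 : (2 + 2 * (C * A⁻¹)) * P ≤ (2 + 2 * (C * A⁻¹)) * P * (ε⁻¹ * ‖1 - v‖) :=
          le_mul_of_one_le_right (by positivity) h2
        have h4 : 0 ≤ (9 * C ^ 2 * (A ^ 2)⁻¹ + C * A⁻¹) * P * ‖1 - v‖ := by positivity
        rw [hC1]
        linarith
  have hcoef := norm_taylorCoeff_le_of_linear_bound hc'0 (by linarith) hfb m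
  have hW0 : AnalyticAt ℂ W 0 := by
    have h0 : ‖(0 : ℂ)‖ < 1 := by simp
    refine (h.differentiableOn 0 h0).analyticAt (Metric.closedBall_mem_nhds _ ?_)
    simp only [sub_zero, norm_one, mul_one]
    linarith
  have hWp : AnalyticAt ℂ (fun u => W u ^ p) 0 := hW0.pow p
  have hfan : AnalyticAt ℂ f 0 := (hWp.sub analyticAt_const).sub
    (analyticAt_const.mul analyticAt_sqrt_one_sub)
  have hsplit : taylorCoeff (fun u => W u ^ p) m = taylorCoeff f m +
      ((if m = 0 then lam ^ p else 0) +
        q * k * taylorCoeff (fun u : ℂ => (1 - u) ^ (1 / 2 : ℂ)) m) := by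
    have h1 : (fun u => W u ^ p) =
        fun u => f u + (lam ^ p + q * k * (1 - u) ^ (1 / 2 : ℂ)) := by
      ext u; rw [hf]; ring
    conv_lhs => rw [h1]
    have a1 : AnalyticAt ℂ (fun u : ℂ => q * k * (1 - u) ^ (1 / 2 : ℂ)) 0 :=
      analyticAt_const.mul analyticAt_sqrt_one_sub
    have a2 : AnalyticAt ℂ (fun u : ℂ => lam ^ p + q * k * (1 - u) ^ (1 / 2 : ℂ)) 0 :=
      analyticAt_const.add a1
    rw [taylorCoeff_add hfan a2, taylorCoeff_add analyticAt_const a1,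
      taylorCoeff_const_mul analyticAt_sqrt_one_sub, taylorCoeff_const]
  set X : ℂ := ((1 / (2 * √Real.pi * ((m + 1) * √(m + 1))) : ℝ) : ℂ) with hX
  have hsqrt := norm_taylorCoeff_sqrt_one_sub_add_le m
  rw [← hX] at hsqrt
  have hrew : taylorCoeff (fun u => W u ^ p) m + q * k * X = taylorCoeff f m +
      (if m = 0 then lam ^ p else 0) +
        q * k * (taylorCoeff (fun u : ℂ => (1 - u) ^ (1 / 2 : ℂ)) m + X) := by
    rw [hsplit]; ring
  rw [hrew]
  have hm2 : (0 : ℝ) < (m + 1 : ℝ) ^ 2 := by positivity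
  have t1 : ‖(if m = 0 then lam ^ p else 0 : ℂ)‖ ≤ P / (m + 1 : ℝ) ^ 2 := by
    split_ifs with hm
    · rw [hm, norm_pow]; simp only [Nat.cast_zero, zero_add, one_pow, div_one]
      exact le_trans (by gcongr) hPA
    · simp; positivity
  have t2 : ‖q * k * (taylorCoeff (fun u : ℂ => (1 - u) ^ (1 / 2 : ℂ)) m + X)‖ ≤
      (A⁻¹ * P) * C * (11 / (m + 1 : ℝ) ^ 2) := by
    rw [norm_mul, norm_mul]
    gcongr
    exact h.norm_k_le
  refine (norm_add_le _ _).trans ((add_le_add ((norm_add_le _ _).trans (add_le_add hcoef t1)) t2).trans (le_of_eq ?_))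
  field_simp

end IsStolzSqrt

/-! ### The Taylor branch as a function on Stolz neighbourhoods -/

namespace PolynomialLeaf

/-- The gcd vanishes only for the empty family of exponents, when the branch is the constant `1` and
the radius is infinite. -/
theorem symIndex_pos {N : ℕ} (S : PolynomialLeaf N) {ζ : Fin N → ℂ} (h : S.rhoStar ζ ≠ ⊤) :
    0 < S.symIndex := by
  rw [Nat.pos_iff_ne_zero]
  intro h0
  rw [symIndex, Finset.gcd_eq_zero_iff] at h0
  have hN : IsEmpty (Fin N) := ⟨fun n => by
    have h1 := S.two_le n
    have h2 := h0 n (Finset.mem_univ n)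
    omega⟩
  refine h (top_le_iff.1 (le_sSup ⟨ENNReal.zero_lt_top, fun _ => 1, differentiableOn_const _, rfl, ?_⟩))
  exact Eventually.of_forall fun x => by simp [invF]

theorem symIndex_dvd {N : ℕ} (S : PolynomialLeaf N) (n : Fin N) : S.symIndex ∣ S.exponent n :=
  Finset.gcd_dvd (Finset.mem_univ n)

theorem mem_analyticDisk_iff {N : ℕ} {S : PolynomialLeaf N} {ζ : Fin N → ℂ} {x : ℂ}
    (h : ‖x‖ₑ = S.rhoStar ζ) (y : ℂ) : y ∈ S.analyticDisk ζ ↔ ‖y‖ < ‖x‖ := by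
  rw [analyticDisk, mem_ofPred_eq, ← h, ← ofReal_norm, ← ofReal_norm,
    ENNReal.ofReal_lt_ofReal_iff_of_nonneg (norm_nonneg _)]

theorem isOpen_analyticDisk {N : ℕ} (S : PolynomialLeaf N) (ζ : Fin N → ℂ) :
    IsOpen (S.analyticDisk ζ) := isOpen_eball _

theorem zero_mem_analyticDisk {N : ℕ} (S : PolynomialLeaf N) (ζ : Fin N → ℂ) :
    (0 : ℂ) ∈ S.analyticDisk ζ := by
  show ‖(0 : ℂ)‖ₑ < _
  simpa using S.rhoStar_pos ζ

theorem ne_zero_of_enorm_eq_rhoStar {N : ℕ} {S : PolynomialLeaf N} {ζ : Fin N → ℂ} {x : ℂ}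
    (h : ‖x‖ₑ = S.rhoStar ζ) : x ≠ 0 := by
  rintro rfl
  have := S.rhoStar_pos ζ
  rw [← h] at this
  simp at this

theorem rhoStar_ne_top_of_enorm_eq {N : ℕ} {S : PolynomialLeaf N} {ζ : Fin N → ℂ} {x : ℂ}
    (h : ‖x‖ₑ = S.rhoStar ζ) : S.rhoStar ζ ≠ ⊤ := h ▸ enorm_ne_top

theorem rhoStar_toReal_eq_norm {N : ℕ} {S : PolynomialLeaf N} {ζ : Fin N → ℂ} {x : ℂ}
    (h : ‖x‖ₑ = S.rhoStar ζ) : (S.rhoStar ζ).toReal = ‖x‖ := by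
  rw [← h, toReal_enorm]

theorem analyticOnNhd_taylorBranch {N : ℕ} (S : PolynomialLeaf N) (ζ : Fin N → ℂ) :
    AnalyticOnNhd ℂ (S.taylorBranch ζ) (S.analyticDisk ζ) :=
  (S.taylorBranch_spec ζ).1.analyticOnNhd (S.isOpen_analyticDisk ζ)

/-- The equation `F(U(x), x) = 0` holds on the whole disk. -/
theorem invF_taylorBranch {N : ℕ} (S : PolynomialLeaf N) (ζ : Fin N → ℂ) {x : ℂ}
    (hx : x ∈ S.analyticDisk ζ) : S.invF ζ (S.taylorBranch ζ x) x = 0 := by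
  have hd := (S.taylorBranch_spec ζ).1
  have hF : DifferentiableOn ℂ (fun x => S.invF ζ (S.taylorBranch ζ x) x) (S.analyticDisk ζ) := by
    unfold invF
    fun_prop
  exact (hF.analyticOnNhd (S.isOpen_analyticDisk ζ)).eqOn_of_preconnected_of_eventuallyEq
    (g := fun _ => (0 : ℂ)) analyticOnNhd_const
    (convex_eball _).isPreconnected (S.zero_mem_analyticDisk ζ) (S.taylorBranch_spec ζ).2.2 hx

/-- The Taylor branch at `ζ` is `W((y / x) ^ s)`, where `W` has a square-root singularity. -/
structure HasStolzContinuation {N : ℕ} (S : PolynomialLeaf N) (ζ : Fin N → ℂ) (x lam κ : ℂ)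
    (W : ℂ → ℂ) (c ε M C : ℝ) : Prop where
  enorm_eq : ‖x‖ₑ = S.rhoStar ζ
  stolz : IsStolzSqrt W lam (((Real.sqrt S.symIndex : ℝ) : ℂ)⁻¹ * κ) c ε M C
  eq_taylorBranch : ∀ y, ‖y‖ < ‖x‖ → S.taylorBranch ζ y = W ((y / x) ^ S.symIndex)

/-- In the variable `u = z / ξ` the disks fit into the domain of continuation: `|ξ| (1 + 2c) ≤ |ξ| +
4c ≤ |ξ| + η/4` because `|ξ| ≤ 2`, and the sector estimate handles the angle. -/
theorem mul_mem_indentedDisk {ξ u v : ℂ} {c φ η : ℝ} (hξ : ξ ≠ 0) (hξ2 : ‖ξ‖ ≤ 2) (hφ0 : 0 ≤ φ)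
    (hφ : φ < Real.pi / 2) (hη : 0 < η) (hu : ‖u‖ < 1) (hc0 : 0 ≤ c) (hc : c ≤ Real.cos φ / 4)
    (hcη : c ≤ η / 16) (hv : v ∈ Metric.closedBall u (c * ‖1 - u‖)) :
    ξ * v ∈ indentedDisk ξ φ η := by
  have h1 := norm_le_of_mem_stolz hu hc0 hv
  have h2 := ne_one_and_lt_abs_arg_of_stolz hφ0 hφ hu hc0 hc (mem_closedBall_iff_norm.1 hv)
  have h3 : ‖ξ * v‖ < ‖ξ‖ + η / 2 := by
    rw [norm_mul]
    have h4 : ‖ξ‖ * ‖v‖ ≤ ‖ξ‖ * (1 + 2 * c) := by gcongr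
    have h5 : ‖ξ‖ * (2 * c) ≤ 2 * (2 * c) := by gcongr
    linarith
  refine ⟨by simpa using h3, by linarith, fun h => h2.1 ?_, ?_⟩
  · exact mul_left_cancel₀ hξ (by rw [h, mul_one])
  · rw [mul_div_cancel_left₀ _ hξ]; exact h2.2

/-- The maximum principle carries the boundary bound `M` inside, and the identity theorem extends
the agreement of germs to the whole disk. For `|1 - v| < 1` the terms of order `1`, `3/2` and `2`
are each at most `C₀ |1 - v|`, whence `3 C₀`. -/
theorem hasStolzContinuation_of_continuation {N : ℕ} {S : PolynomialLeaf N} {ζ : Fin N → ℂ}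
    {x lam κ c d : ℂ} {V : ℂ → ℂ} {φ η M C₀ : ℝ} (hφ0 : 0 < φ) (hφ : φ < Real.pi / 2)
    (hη : 0 < η) (hx : ‖x‖ₑ = S.rhoStar ζ) (hx2 : ‖x ^ S.symIndex‖ ≤ 2)
    (hV : DiffContOnCl ℂ V (indentedDisk (x ^ S.symIndex) φ η))
    (hgerm : ∀ᶠ y in 𝓝 (0 : ℂ), V (y ^ S.symIndex) = S.taylorBranch ζ y)
    (hM : ∀ z ∈ frontier (indentedDisk (x ^ S.symIndex) φ η), ‖V z‖ ≤ M)
    (hC : ‖lam‖ + ‖κ‖ + ‖c‖ + ‖d‖ ≤ C₀)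
    (hexp : ∀ z ∈ indentedDisk (x ^ S.symIndex) φ η, ‖1 - z / x ^ S.symIndex‖ < η →
        ‖V z - (lam
            + ((Real.sqrt S.symIndex)⁻¹ : ℂ) * κ * (1 - z / x ^ S.symIndex) ^ (1 / 2 : ℂ)
            + c * (1 - z / x ^ S.symIndex)
            + d * (1 - z / x ^ S.symIndex) ^ (3 / 2 : ℂ))‖
          ≤ C₀ * ‖1 - z / x ^ S.symIndex‖ ^ 2) :
    S.HasStolzContinuation ζ x lam κ (fun u => V (x ^ S.symIndex * u))
      (min (Real.cos φ / 4) (η / 16)) (min η 1) M (3 * C₀) := by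
  have hx0 : x ≠ 0 := ne_zero_of_enorm_eq_rhoStar hx
  have hs : 0 < S.symIndex := S.symIndex_pos (rhoStar_ne_top_of_enorm_eq hx)
  set ξ := x ^ S.symIndex with hξ
  have hξ0 : ξ ≠ 0 := pow_ne_zero _ hx0
  set a := min (Real.cos φ / 4) (η / 16) with ha
  have hcos : 0 < Real.cos φ := Real.cos_pos_of_mem_Ioo ⟨by linarith [Real.pi_pos], hφ⟩
  have ha0 : 0 < a := by positivity
  have hmem : ∀ u : ℂ, ‖u‖ < 1 → ∀ v ∈ Metric.closedBall u (a * ‖1 - u‖),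
      ξ * v ∈ indentedDisk ξ φ η := fun u hu v hv =>
    mul_mem_indentedDisk hξ0 hx2 hφ0.le hφ hη hu ha0.le (min_le_left _ _) (min_le_right _ _) hv
  have hmem' : ∀ u : ℂ, ‖u‖ < 1 → ξ * u ∈ indentedDisk ξ φ η := fun u hu =>
    hmem u hu u (Metric.mem_closedBall_self (by positivity))
  have hC0 : 0 ≤ C₀ := le_trans (by positivity) hC
  have hlam : ‖lam‖ ≤ C₀ := by linarith [norm_nonneg κ, norm_nonneg c, norm_nonneg d]
  have hκ : ‖κ‖ ≤ C₀ := by linarith [norm_nonneg lam, norm_nonneg c, norm_nonneg d]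
  have hc : ‖c‖ ≤ C₀ := by linarith [norm_nonneg κ, norm_nonneg lam, norm_nonneg d]
  have hd : ‖d‖ ≤ C₀ := by linarith [norm_nonneg κ, norm_nonneg c, norm_nonneg lam]
  have hbdd : Bornology.IsBounded (indentedDisk ξ φ η) :=
    Metric.isBounded_ball.subset inter_subset_left
  have hsqrt1 : (1 : ℝ) ≤ Real.sqrt S.symIndex := Real.one_le_sqrt.2 (by exact_mod_cast hs)
  refine ⟨hx, ⟨fun u hu => ?_, fun u hu v hv => ?_, fun u hu v hv hvε => ?_, by linarith, ?_⟩, ?_⟩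
  · exact hV.differentiableOn.comp (by fun_prop) fun v hv => hmem u hu v hv
  · exact Complex.norm_le_of_forall_mem_frontier_norm_le hbdd hV hM (subset_closure (hmem u hu v hv))
  · have h1 := hexp _ (hmem u hu v hv)
    rw [mul_div_cancel_left₀ _ hξ0] at h1
    have h2 := h1 (hvε.trans_le (min_le_left _ _))
    have h3 : ‖1 - v‖ < 1 := hvε.trans_le (min_le_right _ _)
    have hn0 := norm_nonneg (1 - v)
    have h32 : ‖(1 - v) ^ (3 / 2 : ℂ)‖ ≤ ‖1 - v‖ := by
      by_cases h0 : 1 - v = 0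
      · rw [h0, Complex.zero_cpow (by norm_num)]
      · have h4 : (1 - v) ^ (3 / 2 : ℂ) = (1 - v) * (1 - v) ^ (1 / 2 : ℂ) := by
          rw [show (3 / 2 : ℂ) = 1 + 1 / 2 by norm_num, Complex.cpow_add _ _ h0, Complex.cpow_one]
        rw [h4, norm_mul, norm_cpow_half]
        have : √‖1 - v‖ ≤ 1 := Real.sqrt_le_one.2 h3.le
        nlinarith
    have h5 : V (ξ * v) - lam - ((Real.sqrt S.symIndex : ℝ) : ℂ)⁻¹ * κ * (1 - v) ^ (1 / 2 : ℂ) =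
        (V (ξ * v) - (lam + ((Real.sqrt S.symIndex : ℝ) : ℂ)⁻¹ * κ * (1 - v) ^ (1 / 2 : ℂ)
            + c * (1 - v) + d * (1 - v) ^ (3 / 2 : ℂ))) + (c * (1 - v) +
              d * (1 - v) ^ (3 / 2 : ℂ)) := by ring
    rw [h5]
    refine (norm_add_le _ _).trans ?_
    have h6 : ‖c * (1 - v) + d * (1 - v) ^ (3 / 2 : ℂ)‖ ≤ C₀ * ‖1 - v‖ + C₀ * ‖1 - v‖ := by
      refine (norm_add_le _ _).trans ?_
      rw [norm_mul, norm_mul]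
      gcongr
    have h7 : C₀ * ‖1 - v‖ ^ 2 ≤ C₀ * ‖1 - v‖ := by gcongr; nlinarith
    linarith
  · rw [norm_mul, norm_inv, Complex.norm_real, Real.norm_of_nonneg (by positivity)]
    have : (Real.sqrt S.symIndex)⁻¹ ≤ 1 := inv_le_one_of_one_le₀ hsqrt1
    nlinarith [norm_nonneg κ]
  · have hpow : ∀ y : ℂ, ‖y‖ < ‖x‖ → ‖(y / x) ^ S.symIndex‖ < 1 := fun y hy => by
      rw [norm_pow, norm_div]
      exact pow_lt_one₀ (by positivity) ((div_lt_one (norm_pos_iff.2 hx0)).2 hy) hs.ne'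
    have heq : ∀ y : ℂ, ξ * (y / x) ^ S.symIndex = y ^ S.symIndex := fun y => by
      rw [hξ, ← mul_pow, mul_div_cancel₀ _ hx0]
    have hd : DifferentiableOn ℂ (fun y => V (y ^ S.symIndex)) (S.analyticDisk ζ) :=
      hV.differentiableOn.comp (by fun_prop) fun y hy => by
        rw [← heq]; exact hmem' _ (hpow y ((mem_analyticDisk_iff hx y).1 hy))
    intro y hy
    show S.taylorBranch ζ y = V _
    rw [heq]
    exact ((S.analyticOnNhd_taylorBranch ζ).eqOn_of_preconnected_of_eventuallyEq
      (hd.analyticOnNhd (S.isOpen_analyticDisk ζ)) (convex_eball _).isPreconnected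
      (S.zero_mem_analyticDisk ζ) (hgerm.mono fun _ h => h.symm)) ((mem_analyticDisk_iff hx y).2 hy)

/-! ### Bounds and coefficients read off from the continued branch. -/

namespace HasStolzContinuation

variable {N : ℕ} {S : PolynomialLeaf N} {ζ : Fin N → ℂ} {x lam κ : ℂ} {W : ℂ → ℂ} {c ε M C : ℝ}

theorem ne_zero (h : S.HasStolzContinuation ζ x lam κ W c ε M C) : x ≠ 0 :=
  ne_zero_of_enorm_eq_rhoStar h.enorm_eq

theorem symIndex_pos (h : S.HasStolzContinuation ζ x lam κ W c ε M C) : 0 < S.symIndex :=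
  S.symIndex_pos (rhoStar_ne_top_of_enorm_eq h.enorm_eq)

theorem norm_div_pow_lt (h : S.HasStolzContinuation ζ x lam κ W c ε M C) {y : ℂ}
    (hy : ‖y‖ < ‖x‖) : ‖(y / x) ^ S.symIndex‖ < 1 := by
  rw [norm_pow, norm_div]
  exact pow_lt_one₀ (by positivity) ((div_lt_one (norm_pos_iff.2 h.ne_zero)).2 hy) h.symIndex_pos.ne'

theorem norm_taylorBranch_le (h : S.HasStolzContinuation ζ x lam κ W c ε M C) (hc : 0 ≤ c) {y : ℂ}
    (hy : ‖y‖ < ‖x‖) : ‖S.taylorBranch ζ y‖ ≤ M := by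
  rw [h.eq_taylorBranch y hy]
  exact h.stolz.norm_le _ (h.norm_div_pow_lt hy) _ (Metric.mem_closedBall_self (by positivity))

theorem expansion (h : S.HasStolzContinuation ζ x lam κ W c ε M C) (hc : 0 ≤ c) {y : ℂ}
    (hy : ‖y‖ < ‖x‖) (hyε : ‖1 - (y / x) ^ S.symIndex‖ < ε) :
    ‖S.taylorBranch ζ y - lam - ((Real.sqrt S.symIndex : ℝ) : ℂ)⁻¹ * κ *
      (1 - (y / x) ^ S.symIndex) ^ (1 / 2 : ℂ)‖ ≤ C * ‖1 - (y / x) ^ S.symIndex‖ := by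
  rw [h.eq_taylorBranch y hy]
  exact h.stolz.expansion _ (h.norm_div_pow_lt hy) _
    (Metric.mem_closedBall_self (by positivity)) hyε

theorem analyticAt_zero (h : S.HasStolzContinuation ζ x lam κ W c ε M C) (hc : 0 < c) :
    AnalyticAt ℂ W 0 := by
  refine (h.stolz.differentiableOn 0 (by simp)).analyticAt (Metric.closedBall_mem_nhds _ ?_)
  simpa using hc

theorem raney_eq (h : S.HasStolzContinuation ζ x lam κ W c ε M C) (hc : 0 < c) (p m : ℕ) :
    S.raney ζ p m = ((x ^ S.symIndex)⁻¹) ^ m * taylorCoeff (fun u => W u ^ p) m := by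
  have hW : AnalyticAt ℂ (fun u => W u ^ p) 0 := (h.analyticAt_zero hc).pow p
  have hW' : AnalyticAt ℂ (fun u => W ((x ^ S.symIndex)⁻¹ * u) ^ p) 0 := by
    have h1 : AnalyticAt ℂ W ((x ^ S.symIndex)⁻¹ * 0) := by
      rw [mul_zero]; exact h.analyticAt_zero hc
    exact (h1.comp (f := fun u : ℂ => (x ^ S.symIndex)⁻¹ * u) (by fun_prop)).pow p
  rw [← taylorCoeff_comp_mul hW]
  refine taylorCoeff_comp_pow (g := fun u => W ((x ^ S.symIndex)⁻¹ * u) ^ p) hW' h.symIndex_pos ?_ m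
  filter_upwards [(S.isOpen_analyticDisk ζ).mem_nhds (S.zero_mem_analyticDisk ζ)] with y hy
  rw [h.eq_taylorBranch y ((mem_analyticDisk_iff h.enorm_eq y).1 hy), div_pow, div_eq_inv_mul]

/-- An `s`-th root of `u` gives a point `y` inside the midpoint circle with `W u = U(y)`. The
maximum principle then applies on that disk. -/
theorem norm_le_of_norm_midRadius_le (h : S.HasStolzContinuation ζ x lam κ W c ε M C)
    (h1 : 1 < ‖x‖) {M₀ : ℝ}
    (hM₀ : ∀ y : ℂ, ‖y‖ = S.midRadius ζ → ‖S.taylorBranch ζ y‖ ≤ M₀) {u : ℂ}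
    (hu : ‖u‖ ≤ (S.midRadius ζ / ‖x‖) ^ S.symIndex) : ‖W u‖ ≤ M₀ := by
  have hmid : S.midRadius ζ = (1 + ‖x‖) / 2 := by
    rw [midRadius, rhoStar_toReal_eq_norm h.enorm_eq]
  have hx0 : 0 < ‖x‖ := by linarith
  have hs := h.symIndex_pos
  obtain ⟨t, ht⟩ : ∃ t : ℂ, t ^ S.symIndex = u :=
    ⟨_, Complex.cpow_nat_inv_pow u hs.ne'⟩
  have htn : ‖t‖ ≤ S.midRadius ζ / ‖x‖ := by
    rw [← ht, norm_pow] at hu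
    exact le_of_pow_le_pow_left₀ hs.ne' (by rw [hmid]; positivity) hu
  have hy : ‖x * t‖ ≤ S.midRadius ζ := by
    rw [norm_mul]; rw [le_div_iff₀ hx0] at htn; linarith
  have hy2 : ‖x * t‖ < ‖x‖ := by rw [hmid] at hy; linarith
  have h2 := h.eq_taylorBranch _ hy2
  rw [mul_div_cancel_left₀ _ h.ne_zero, ht] at h2
  rw [← h2]
  have hmid0 : S.midRadius ζ ≠ 0 := by rw [hmid]; positivity
  refine Complex.norm_le_of_forall_mem_frontier_norm_le (U := Metric.ball 0 (S.midRadius ζ))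
    Metric.isBounded_ball (DifferentiableOn.diffContOnCl_ball
      ((S.taylorBranch_spec ζ).1.mono fun z hz => ?_) subset_rfl) (fun z hz => ?_) ?_
  · rw [mem_analyticDisk_iff h.enorm_eq]
    rw [mem_closedBall_zero_iff, hmid] at hz
    linarith
  · rw [frontier_ball _ hmid0] at hz
    exact hM₀ z (by simpa using hz)
  · rw [closure_ball _ hmid0]; simpa using hy

end HasStolzContinuation

end PolynomialLeaf

/-! ### Square-root expansions at a boundary point -/

theorem re_cpow_half_nonneg (z : ℂ) : 0 ≤ (z ^ (1 / 2 : ℂ)).re := by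
  by_cases hz : z = 0
  · rw [hz, Complex.zero_cpow (by norm_num)]; simp
  · rw [Complex.cpow_def_of_ne_zero hz, Complex.exp_re]
    have h1 : (Complex.log z * (1 / 2 : ℂ)).im = z.arg / 2 := by
      have : Complex.log z * (1 / 2 : ℂ) = Complex.log z * ((1 / 2 : ℝ) : ℂ) := by norm_num
      rw [this, Complex.im_mul_ofReal, Complex.log_im]; ring
    rw [h1]
    have h2 := Complex.neg_pi_lt_arg z
    have h3 := Complex.arg_le_pi z
    exact mul_nonneg (Real.exp_nonneg _) (Real.cos_nonneg_of_mem_Icc ⟨by linarith, by linarith⟩)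

/-- The root has argument at most `π/4` in modulus. This prevents cancellation in a sum of two such
roots. -/
theorem norm_cpow_half_le_two_mul_re {z : ℂ} (hz : 0 ≤ z.re) :
    ‖z ^ (1 / 2 : ℂ)‖ ≤ 2 * (z ^ (1 / 2 : ℂ)).re := by
  have h0 := re_cpow_half_nonneg z
  have hsq := cpow_half_sq z
  set r := z ^ (1 / 2 : ℂ)
  have h1 : r.re ^ 2 - r.im ^ 2 = z.re := by
    rw [← hsq, sq r, Complex.mul_re]; ring
  have h2 : ‖r‖ ^ 2 = r.re ^ 2 + r.im ^ 2 := by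
    rw [← Complex.normSq_eq_norm_sq, Complex.normSq_apply]; ring
  refine le_of_sq_le_sq ?_ (by linarith)
  nlinarith

/-- Comparison of the square-root singularities in the variables `y` and `y ^ s`. -/
theorem norm_sqrt_one_sub_pow_sub_le {e : ℂ} (s : ℕ) (hs : 0 < s) (he : 0 < e.re) (he1 : ‖e‖ ≤ 1) :
    ‖(1 - (1 - e) ^ s) ^ (1 / 2 : ℂ) - (√(s : ℝ) : ℂ) * e ^ (1 / 2 : ℂ)‖ ≤
      (s : ℝ) ^ 2 * 2 ^ s * ‖e‖ := by
  set δ : ℂ := 1 - (1 - e) ^ s with hδ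
  set A := δ ^ (1 / 2 : ℂ) with hA
  set r := e ^ (1 / 2 : ℂ) with hr
  have hs1 : 1 ≤ √(s : ℝ) := Real.one_le_sqrt.2 (by exact_mod_cast hs)
  have hr1 : ‖r‖ ≤ 2 * r.re := norm_cpow_half_le_two_mul_re he.le
  have hA0 : 0 ≤ A.re := re_cpow_half_nonneg δ
  have hr2 : ‖r‖ ^ 2 = ‖e‖ := norm_cpow_half_sq e
  have he0 : 0 < ‖e‖ := he.trans_le (Complex.re_le_norm e)
  have hr0 : 0 < ‖r‖ := by
    rcases (norm_nonneg r).eq_or_lt with h | h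
    · rw [← h] at hr2; simp at hr2; linarith
    · exact h
  -- The difference of roots is rationalized: `(A - √s r)(A + √s r) = δ - s e = O(|e|²)`, and the
  -- second factor is at least of order `|e|^{1/2}`.
  have hsum : ‖r‖ / 2 ≤ ‖A + (√(s : ℝ) : ℂ) * r‖ := by
    refine le_trans ?_ (Complex.re_le_norm _)
    rw [Complex.add_re, Complex.re_ofReal_mul]
    nlinarith
  have hprod : (A - (√(s : ℝ) : ℂ) * r) * (A + (√(s : ℝ) : ℂ) * r) = δ - s * e := by
    have h1 : (√(s : ℝ) : ℂ) ^ 2 = s := by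
      rw [← Complex.ofReal_pow, Real.sq_sqrt (Nat.cast_nonneg s)]; simp
    have h2 : A ^ 2 = δ := cpow_half_sq δ
    have h3 : r ^ 2 = e := cpow_half_sq e
    rw [← h2, ← h3, ← h1]; ring
  have hlin := norm_pow_sub_linear_le (a := 1 - e) (b := 1) (A := 2)
    (by linarith [norm_sub_le (1 : ℂ) e, norm_one (α := ℂ)]) (by simp) s
  have h5 : (1 - e) ^ s - 1 ^ s - s * 1 ^ (s - 1) * (1 - e - 1) = -(δ - s * e) := by
    rw [hδ]; simp; ring
  rw [h5, norm_neg, ← hprod, norm_mul] at hlin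
  have h6 : ‖(1 : ℂ) - e - 1‖ = ‖e‖ := by rw [sub_sub_cancel_left, norm_neg]
  rw [h6] at hlin
  set X := ‖A - (√(s : ℝ) : ℂ) * r‖ with hX
  have hX0 : 0 ≤ X := norm_nonneg _
  have h7 : X * (‖r‖ / 2) * 2 ^ 2 ≤ (s : ℝ) ^ 2 * 2 ^ s * ‖e‖ ^ 2 :=
    le_trans (by gcongr) hlin
  have hr3 : ‖e‖ ≤ ‖r‖ := by
    have : ‖r‖ ≤ 1 := by
      by_contra! h
      nlinarith
    nlinarith
  have h8 : X * ‖e‖ ≤ (s : ℝ) ^ 2 * 2 ^ s * ‖e‖ * ‖e‖ := by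
    have h9 : X * ‖e‖ ≤ X * ‖r‖ := by gcongr
    nlinarith
  exact le_of_mul_le_mul_right h8 he0

/-- Second-order expansion of a monomial with continuous remainder. -/
theorem exists_pow_expansion (t : ℂ) (m : ℕ) : ∃ q : ℂ → ℂ, Continuous q ∧ ∀ v : ℂ,
    (t + v) ^ (m + 2) = t ^ (m + 2) + (m + 2 : ℂ) * t ^ (m + 1) * v +
      (m + 2 : ℂ) * (m + 1) / 2 * t ^ m * v ^ 2 + v ^ 3 * q v := by
  induction m with
  | zero => exact ⟨0, continuous_const, fun v => by simp; ring⟩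
  | succ m ih =>
    obtain ⟨q, hq, h⟩ := ih
    refine ⟨fun v => (m + 2 : ℂ) * (m + 1) / 2 * t ^ m + (t + v) * q v, by fun_prop, fun v => ?_⟩
    rw [show m + 1 + 2 = (m + 2) + 1 by ring, pow_succ, h]
    push_cast
    ring

/-! ### The polynomial `Φ`, the derivatives of `F`, and the passage from the root in `x^s` to the
root in `x`. -/

namespace PolynomialLeaf

variable {N : ℕ} {S : PolynomialLeaf N} {ζ : Fin N → ℂ}

/-- The sum `∑ₙ c(sₙ) ζₙ σ ^ (sₙ / s)`. -/
noncomputable def exponentSum (S : PolynomialLeaf N) (c : ℕ → ℂ) (ζ : Fin N → ℂ) (σ : ℂ) : ℂ :=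
  ∑ n, c (S.exponent n) * ζ n * σ ^ (S.exponent n / S.symIndex)

theorem exponentSum_pow (c : ℕ → ℂ) (t : ℂ) :
    S.exponentSum c ζ (t ^ S.symIndex) = ∑ n, c (S.exponent n) * ζ n * t ^ S.exponent n := by
  refine Finset.sum_congr rfl fun n _ => ?_
  rw [← pow_mul, Nat.mul_div_cancel' (S.symIndex_dvd n)]

/-- The first-order coefficient `Φ'(t)` of `Φ(t) = 1 + ∑ₙ ζₙ t ^ sₙ`. -/
noncomputable def phiDeriv (S : PolynomialLeaf N) (ζ : Fin N → ℂ) (t : ℂ) : ℂ :=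
  ∑ n, ζ n * ((S.exponent n : ℂ) * t ^ (S.exponent n - 1))

/-- The second-order coefficient `Φ''(t) / 2` of `Φ(t) = 1 + ∑ₙ ζₙ t ^ sₙ`. -/
noncomputable def phiSecond (S : PolynomialLeaf N) (ζ : Fin N → ℂ) (t : ℂ) : ℂ :=
  ∑ n, ζ n * ((S.exponent n : ℂ) * (S.exponent n - 1) / 2 * t ^ (S.exponent n - 2))

theorem exists_phi_expansion (S : PolynomialLeaf N) (ζ : Fin N → ℂ) (t : ℂ) :
    ∃ q : ℂ → ℂ, Continuous q ∧ ∀ v : ℂ,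
      ∑ n, ζ n * (t + v) ^ S.exponent n = ∑ n, ζ n * t ^ S.exponent n + S.phiDeriv ζ t * v +
        S.phiSecond ζ t * v ^ 2 + v ^ 3 * q v := by
  have h : ∀ n, ∃ q : ℂ → ℂ, Continuous q ∧ ∀ v : ℂ,
      (t + v) ^ S.exponent n = t ^ S.exponent n + (S.exponent n : ℂ) * t ^ (S.exponent n - 1) * v +
      (S.exponent n : ℂ) * (S.exponent n - 1) / 2 * t ^ (S.exponent n - 2) * v ^ 2 + v ^ 3 * q v := by
    intro n
    obtain ⟨q, hq, h⟩ := exists_pow_expansion t (S.exponent n - 2)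
    refine ⟨q, hq, fun v => ?_⟩
    obtain ⟨m, hm⟩ : ∃ m, S.exponent n = m + 2 := ⟨S.exponent n - 2, by have := S.two_le n; omega⟩
    rw [hm] at h ⊢
    simp only [Nat.add_sub_cancel, show m + 2 - 1 = m + 1 by omega] at h ⊢
    rw [h]
    push_cast
    ring
  choose q hq hqv using h
  refine ⟨fun v => ∑ n, ζ n * q n v, by fun_prop, fun v => ?_⟩
  simp only [hqv, phiDeriv, phiSecond, Finset.sum_mul, Finset.mul_sum, ← Finset.sum_add_distrib]
  exact Finset.sum_congr rfl fun n _ => by ring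

theorem invF_eq_sum (S : PolynomialLeaf N) (ζ : Fin N → ℂ) (y x : ℂ) :
    S.invF ζ y x = y - 1 - ∑ n, ζ n * (x * y) ^ S.exponent n := by
  simp only [invF, mul_pow, mul_assoc]

theorem hasDerivAt_invF (S : PolynomialLeaf N) (ζ : Fin N → ℂ) (y x : ℂ) :
    HasDerivAt (fun y => S.invF ζ y x) (1 - x * S.phiDeriv ζ (x * y)) y := by
  have h1 : HasDerivAt (fun y => ∑ n, ζ n * (x * y) ^ S.exponent n)
      (∑ n, ζ n * ((S.exponent n : ℂ) * (x * y) ^ (S.exponent n - 1) * x)) y := by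
    refine HasDerivAt.fun_sum fun n _ => HasDerivAt.const_mul _ ?_
    have := ((hasDerivAt_id y).const_mul x).fun_pow (S.exponent n)
    simpa using this
  have h2 := ((hasDerivAt_id y).sub_const 1).sub h1
  have h3 : (fun y => S.invF ζ y x) = fun y => id y - 1 - ∑ n, ζ n * (x * y) ^ S.exponent n := by
    ext y; rw [invF_eq_sum]; rfl
  have h4 : x * S.phiDeriv ζ (x * y) =
      ∑ n, ζ n * ((S.exponent n : ℂ) * (x * y) ^ (S.exponent n - 1) * x) := by
    rw [phiDeriv, Finset.mul_sum]
    exact Finset.sum_congr rfl fun n _ => by ring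
  rw [h3, h4]
  exact h2

theorem iteratedDeriv_two_invF (S : PolynomialLeaf N) (ζ : Fin N → ℂ) (y x : ℂ) :
    iteratedDeriv 2 (fun y => S.invF ζ y x) y = -(2 * x ^ 2 * S.phiSecond ζ (x * y)) := by
  rw [iteratedDeriv_succ, iteratedDeriv_one]
  have h0 : deriv (fun y => S.invF ζ y x) = fun y => 1 - x * S.phiDeriv ζ (x * y) :=
    funext fun y => (S.hasDerivAt_invF ζ y x).deriv
  rw [h0]
  have h1 : HasDerivAt (fun y => S.phiDeriv ζ (x * y))
      (∑ n, ζ n * ((S.exponent n : ℂ) * (((S.exponent n - 1 : ℕ) : ℂ) *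
        (x * y) ^ (S.exponent n - 1 - 1) * x))) y := by
    unfold phiDeriv
    refine HasDerivAt.fun_sum fun n _ => HasDerivAt.const_mul _ (HasDerivAt.const_mul _ ?_)
    have := ((hasDerivAt_id y).const_mul x).fun_pow (S.exponent n - 1)
    simpa using this
  rw [((h1.const_mul x).const_sub 1).deriv]
  simp only [phiSecond, Finset.mul_sum]
  congr 1
  refine Finset.sum_congr rfl fun n _ => ?_
  have := S.two_le n
  rw [Nat.cast_sub (by omega), Nat.sub_sub]
  push_cast
  ring

/-- The branch `U` has the expansion `lam + s^{-1/2} κ √δ + O(δ)`, `δ = 1 - (y / x) ^ s`, with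
explicit constants. -/
structure HasSqrtExpansion (S : PolynomialLeaf N) (ζ : Fin N → ℂ) (x lam κ : ℂ) (ε C : ℝ) :
    Prop where
  enorm_eq : ‖x‖ₑ = S.rhoStar ζ
  expansion : ∀ y, ‖y‖ < ‖x‖ → ‖1 - (y / x) ^ S.symIndex‖ < ε →
    ‖S.taylorBranch ζ y - lam - ((Real.sqrt S.symIndex : ℝ) : ℂ)⁻¹ * κ *
      (1 - (y / x) ^ S.symIndex) ^ (1 / 2 : ℂ)‖ ≤ C * ‖1 - (y / x) ^ S.symIndex‖

/-- To leading order `1 - (y/x)^s` is `s (1 - y/x)`, so the factor `s^{-1/2}` in the expansion is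
exactly cancelled. -/
theorem HasSqrtExpansion.hasSqrtCoefficient {x lam κ : ℂ} {ε C : ℝ} (hε : 0 < ε) (hC : 0 ≤ C)
    (h : S.HasSqrtExpansion ζ x lam κ ε C) : S.HasSqrtCoefficient ζ x lam κ := by
  have hx0 : x ≠ 0 := ne_zero_of_enorm_eq_rhoStar h.enorm_eq
  have hs : 0 < S.symIndex := S.symIndex_pos (rhoStar_ne_top_of_enorm_eq h.enorm_eq)
  set s := S.symIndex with hsdef
  have hs1 : (1 : ℝ) ≤ √(s : ℝ) := Real.one_le_sqrt.2 (by exact_mod_cast hs)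
  have hsne : (√(s : ℝ) : ℂ) ≠ 0 := by
    rw [Ne, Complex.ofReal_eq_zero]; linarith
  set K : ℝ := (s : ℝ) ^ 2 * 2 ^ s with hK
  refine IsBigO.of_bound (C * (‖(s : ℂ)‖ + K) + ‖κ‖ * K) ?_
  have hcont1 : Tendsto (fun y : ℂ => ‖1 - y / x‖) (𝓝[S.analyticDisk ζ] x) (𝓝 0) := by
    have : ContinuousAt (fun y : ℂ => ‖1 - y / x‖) x := by fun_prop
    have h2 := this.tendsto
    rw [div_self hx0, sub_self, norm_zero] at h2
    exact h2.mono_left nhdsWithin_le_nhds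
  have hcont2 : Tendsto (fun y : ℂ => ‖1 - (y / x) ^ s‖) (𝓝[S.analyticDisk ζ] x) (𝓝 0) := by
    have : ContinuousAt (fun y : ℂ => ‖1 - (y / x) ^ s‖) x := by fun_prop
    have h2 := this.tendsto
    rw [div_self hx0, one_pow, sub_self, norm_zero] at h2
    exact h2.mono_left nhdsWithin_le_nhds
  filter_upwards [hcont1.eventually_lt_const zero_lt_one, hcont2.eventually_lt_const hε,
    self_mem_nhdsWithin] with y hy1 hy2 hy3
  have hy : ‖y‖ < ‖x‖ := (mem_analyticDisk_iff h.enorm_eq y).1 hy3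
  set e : ℂ := 1 - y / x with he
  have hye : y / x = 1 - e := by rw [he]; ring
  have hre : 0 < e.re := by
    refine re_one_sub_pos ?_
    rw [norm_div]; exact (div_lt_one (norm_pos_iff.2 hx0)).2 hy
  have h1 := h.expansion y hy hy2
  have h2 := norm_sqrt_one_sub_pow_sub_le s hs hre hy1.le
  rw [hye] at h1
  rw [← hK] at h2
  set A := (1 - (1 - e) ^ s) ^ (1 / 2 : ℂ)
  have h3 : S.taylorBranch ζ y - lam - κ * e ^ (1 / 2 : ℂ) =
      (S.taylorBranch ζ y - lam - (√(s : ℝ) : ℂ)⁻¹ * κ * A) +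
        (√(s : ℝ) : ℂ)⁻¹ * κ * (A - (√(s : ℝ) : ℂ) * e ^ (1 / 2 : ℂ)) := by
    field_simp
    ring
  have hlin := norm_pow_sub_linear_le (a := 1 - e) (b := 1) (A := 2)
    (by linarith [norm_sub_le (1 : ℂ) e, norm_one (α := ℂ)]) (by simp) s
  have h4 : ‖1 - (1 - e) ^ s‖ ≤ (‖(s : ℂ)‖ + K) * ‖e‖ := by
    have h5 : 1 - (1 - e) ^ s = s * e - ((1 - e) ^ s - 1 ^ s - s * 1 ^ (s - 1) * (1 - e - 1)) := by
      simp
    have h6 : ‖(1 : ℂ) - e - 1‖ = ‖e‖ := by rw [sub_sub_cancel_left, norm_neg]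
    rw [h6, ← hK] at hlin
    have h7 : K * ‖e‖ ^ 2 ≤ K * ‖e‖ := by
      have : 0 ≤ K := by positivity
      gcongr
      nlinarith [norm_nonneg e]
    rw [h5]
    refine (norm_sub_le _ _).trans ?_
    rw [norm_mul]
    linarith [norm_nonneg ((1 - e) ^ s - 1 ^ s - s * 1 ^ (s - 1) * (1 - e - 1))]
  rw [h3]
  refine (norm_add_le _ _).trans ?_
  rw [norm_mul, norm_mul, norm_inv, Complex.norm_real, Real.norm_of_nonneg (by positivity)]
  have h8 : (√(s : ℝ))⁻¹ ≤ 1 := inv_le_one_of_one_le₀ hs1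
  calc _ ≤ C * ((‖(s : ℂ)‖ + K) * ‖e‖) + 1 * ‖κ‖ * (K * ‖e‖) := by
        gcongr
        exact h1.trans (by gcongr)
    _ = _ := by ring

/-! ### What a square-root expansion at a boundary point forces. -/

section BoundaryPoint

variable {x lam κ : ℂ}

theorem HasSqrtCoefficient.isBranchValue (hx : ‖x‖ₑ = S.rhoStar ζ)
    (h : S.HasSqrtCoefficient ζ x lam κ) : S.IsBranchValue ζ x lam := by
  have hx0 : x ≠ 0 := ne_zero_of_enorm_eq_rhoStar hx
  have h1 : Tendsto (fun y : ℂ => 1 - y / x) (𝓝[S.analyticDisk ζ] x) (𝓝 0) := by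
    have : ContinuousAt (fun y : ℂ => 1 - y / x) x := by fun_prop
    have h2 := this.tendsto
    rw [div_self hx0, sub_self] at h2
    exact h2.mono_left nhdsWithin_le_nhds
  have h2 : Tendsto (fun y : ℂ => (1 - y / x) ^ (1 / 2 : ℂ)) (𝓝[S.analyticDisk ζ] x) (𝓝 0) := by
    rw [tendsto_zero_iff_norm_tendsto_zero]
    simp only [norm_cpow_half]
    have h3 := (Real.continuous_sqrt.tendsto 0).comp (tendsto_zero_iff_norm_tendsto_zero.1 h1)
    rwa [Real.sqrt_zero] at h3
  have h3 := h.trans_tendsto h1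
  have h4 := (h3.add (h2.const_mul κ)).add_const lam
  simp only [mul_zero, add_zero, zero_add] at h4
  exact h4.congr fun y => by ring

/-- With `y = x (1 - τ²)` the square root is exactly `τ`, so expansions become ordinary ones in `τ`.
-/
theorem tendsto_radial (hx : ‖x‖ₑ = S.rhoStar ζ) :
    Tendsto (fun τ : ℝ => x * (1 - (τ : ℂ) ^ 2)) (𝓝[>] 0) (𝓝[S.analyticDisk ζ] x) := by
  have hx0 : x ≠ 0 := ne_zero_of_enorm_eq_rhoStar hx
  refine tendsto_nhdsWithin_iff.2 ⟨?_, ?_⟩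
  · have : Continuous (fun τ : ℝ => x * (1 - (τ : ℂ) ^ 2)) := by fun_prop
    have h2 := this.tendsto 0
    simp only [Complex.ofReal_zero, ne_eq, OfNat.ofNat_ne_zero, not_false_eq_true, zero_pow,
      sub_zero, mul_one] at h2
    exact h2.mono_left nhdsWithin_le_nhds
  · filter_upwards [Ioo_mem_nhdsGT zero_lt_one] with τ hτ
    rw [mem_analyticDisk_iff hx, norm_mul]
    have h1 : ‖(1 : ℂ) - (τ : ℂ) ^ 2‖ < 1 := by
      have : (1 : ℂ) - (τ : ℂ) ^ 2 = ((1 - τ ^ 2 : ℝ) : ℂ) := by push_cast; ring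
      rw [this, Complex.norm_real, Real.norm_of_nonneg (by nlinarith [hτ.1, hτ.2])]
      nlinarith [hτ.1]
    have := norm_pos_iff.2 hx0
    nlinarith

/-- Along the radius `y = x (1 - τ²)` the branch is `lam + κ τ + O(τ²)`. -/
theorem HasSqrtCoefficient.isBigO_radial (hx : ‖x‖ₑ = S.rhoStar ζ)
    (h : S.HasSqrtCoefficient ζ x lam κ) :
    (fun τ : ℝ => S.taylorBranch ζ (x * (1 - (τ : ℂ) ^ 2)) - lam - κ * τ) =O[𝓝[>] 0]
      fun τ : ℝ => (τ : ℂ) ^ 2 := by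
  have hx0 : x ≠ 0 := ne_zero_of_enorm_eq_rhoStar hx
  refine (h.comp_tendsto (tendsto_radial hx)).congr' ?_ ?_
  · filter_upwards [self_mem_nhdsWithin] with τ hτ
    have hτ0 : (0 : ℝ) < τ := hτ
    have h1 : 1 - x * (1 - (τ : ℂ) ^ 2) / x = (τ : ℂ) ^ 2 := by field_simp; ring
    have h2 : ((τ : ℂ) ^ 2) ^ (1 / 2 : ℂ) = τ := by
      rw [← Complex.ofReal_pow, show (1 / 2 : ℂ) = ((1 / 2 : ℝ) : ℂ) by norm_num,
        ← Complex.ofReal_cpow (by positivity), ← Real.sqrt_eq_rpow, Real.sqrt_sq hτ0.le]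
    simp only [Function.comp_apply, h1, h2]
  · refine Eventually.of_forall fun τ => ?_
    simp only [Function.comp_apply]
    field_simp
    ring

theorem HasSqrtCoefficient.tendsto_radial_div (hx : ‖x‖ₑ = S.rhoStar ζ)
    (h : S.HasSqrtCoefficient ζ x lam κ) :
    Tendsto (fun τ : ℝ => (S.taylorBranch ζ (x * (1 - (τ : ℂ) ^ 2)) - lam) / τ) (𝓝[>] 0) (𝓝 κ) := by
  have h1 := h.isBigO_radial hx
  have h2 : Tendsto (fun τ : ℝ => (S.taylorBranch ζ (x * (1 - (τ : ℂ) ^ 2)) - lam - κ * τ) / τ)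
      (𝓝[>] 0) (𝓝 0) := by
    have h3 : (fun τ : ℝ => (S.taylorBranch ζ (x * (1 - (τ : ℂ) ^ 2)) - lam - κ * τ) / τ) =O[𝓝[>] 0]
        fun τ : ℝ => (τ : ℂ) ^ 2 / τ := by
      simp only [div_eq_mul_inv]
      exact h1.mul (isBigO_refl _ _)
    refine h3.trans_tendsto ?_
    have h4 : Tendsto (fun τ : ℝ => (τ : ℂ)) (𝓝[>] 0) (𝓝 0) := by
      have := Complex.continuous_ofReal.tendsto 0
      simpa using this.mono_left nhdsWithin_le_nhds
    refine h4.congr' ?_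
    filter_upwards [self_mem_nhdsWithin] with τ hτ
    have : (τ : ℂ) ≠ 0 := Complex.ofReal_ne_zero.2 (ne_of_gt hτ)
    field_simp
  have h5 := h2.add_const κ
  rw [zero_add] at h5
  refine h5.congr' ?_
  filter_upwards [self_mem_nhdsWithin] with τ hτ
  have : (τ : ℂ) ≠ 0 := Complex.ofReal_ne_zero.2 (ne_of_gt hτ)
  field_simp
  ring

/-- An analytic continuation would change by `O(τ²)` along `y = x (1 - τ²)`, so its slope in `τ`
would be `0`. The slope is `κ ≠ 0`. -/
theorem HasSqrtCoefficient.isBoundarySingularity (hx : ‖x‖ₑ = S.rhoStar ζ)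
    (h : S.HasSqrtCoefficient ζ x lam κ) (hκ : κ ≠ 0) : S.IsBoundarySingularity ζ x := by
  refine ⟨hx, ?_⟩
  rintro ⟨g, hg, hgU⟩
  have hdiff := hg.differentiableAt.isBigO_sub
  have hrad := tendsto_radial hx
  have hgU' : ∀ᶠ τ : ℝ in 𝓝[>] 0,
      g (x * (1 - (τ : ℂ) ^ 2)) = S.taylorBranch ζ (x * (1 - (τ : ℂ) ^ 2)) := hrad.eventually hgU
  have hlam : g x = lam := by
    have h1 := (h.isBranchValue hx).comp hrad
    have h2 : Tendsto (fun τ : ℝ => g (x * (1 - (τ : ℂ) ^ 2))) (𝓝[>] 0) (𝓝 (g x)) :=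
      hg.continuousAt.tendsto.comp (hrad.mono_right nhdsWithin_le_nhds)
    exact tendsto_nhds_unique (h2.congr' hgU') h1
  have h1 := hdiff.comp_tendsto (hrad.mono_right nhdsWithin_le_nhds)
  have h2 : Tendsto (fun τ : ℝ => (S.taylorBranch ζ (x * (1 - (τ : ℂ) ^ 2)) - lam) / τ) (𝓝[>] 0)
      (𝓝 0) := by
    have h3 : (fun τ : ℝ => (S.taylorBranch ζ (x * (1 - (τ : ℂ) ^ 2)) - lam) / τ) =O[𝓝[>] 0]
        fun τ : ℝ => (x * (1 - (τ : ℂ) ^ 2) - x) / τ := by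
      simp only [div_eq_mul_inv]
      refine IsBigO.mul (h1.congr' ?_ EventuallyEq.rfl) (isBigO_refl _ _)
      filter_upwards [hgU'] with τ hτ
      simp only [Function.comp_apply, hτ, hlam]
    refine h3.trans_tendsto ?_
    have h4 : Tendsto (fun τ : ℝ => -x * (τ : ℂ)) (𝓝[>] 0) (𝓝 0) := by
      have : Continuous fun τ : ℝ => -x * (τ : ℂ) := by fun_prop
      have := this.tendsto 0
      simp only [Complex.ofReal_zero, mul_zero] at this
      exact this.mono_left nhdsWithin_le_nhds
    refine h4.congr' ?_
    filter_upwards [self_mem_nhdsWithin] with τ hτ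
    have : (τ : ℂ) ≠ 0 := Complex.ofReal_ne_zero.2 (ne_of_gt hτ)
    field_simp
    ring
  exact hκ (tendsto_nhds_unique (h.tendsto_radial_div hx) h2)

/-- The equations of a simple branch point, and the amplitude. -/
theorem HasSqrtCoefficient.branch_equations (hx : ‖x‖ₑ = S.rhoStar ζ)
    (h : S.HasSqrtCoefficient ζ x lam κ) (hκ : κ ≠ 0) :
    lam = 1 + ∑ n, ζ n * (x * lam) ^ S.exponent n ∧ x * S.phiDeriv ζ (x * lam) = 1 ∧
      lam = S.phiSecond ζ (x * lam) * x ^ 2 * κ ^ 2 := by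
  obtain ⟨q, hq, hΦ⟩ := S.exists_phi_expansion ζ (x * lam)
  set A := S.phiDeriv ζ (x * lam) with hA
  set B := S.phiSecond ζ (x * lam) with hB
  set Φ₀ := ∑ n, ζ n * (x * lam) ^ S.exponent n with hΦ₀
  set U : ℝ → ℂ := fun τ => S.taylorBranch ζ (x * (1 - (τ : ℂ) ^ 2)) with hU
  set v : ℝ → ℂ := fun τ => x * (U τ - lam - (τ : ℂ) ^ 2 * U τ) with hv
  have hτ0 : Tendsto (fun τ : ℝ => (τ : ℂ)) (𝓝[>] 0) (𝓝 0) := by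
    have := Complex.continuous_ofReal.tendsto 0
    simpa using this.mono_left nhdsWithin_le_nhds
  have hne : ∀ᶠ τ : ℝ in 𝓝[>] 0, (τ : ℂ) ≠ 0 := by
    filter_upwards [self_mem_nhdsWithin] with τ hτ using Complex.ofReal_ne_zero.2 (ne_of_gt hτ)
  have hU0 : Tendsto U (𝓝[>] 0) (𝓝 lam) := (h.isBranchValue hx).comp (tendsto_radial hx)
  have hh : Tendsto (fun τ => (U τ - lam) / τ) (𝓝[>] 0) (𝓝 κ) := h.tendsto_radial_div hx
  have hvτ : Tendsto (fun τ => v τ / τ) (𝓝[>] 0) (𝓝 (x * κ)) := by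
    have h1 : Tendsto (fun τ : ℝ => x * ((U τ - lam) / τ - τ * U τ)) (𝓝[>] 0)
        (𝓝 (x * (κ - 0 * lam))) := (hh.sub (hτ0.mul hU0)).const_mul x
    rw [zero_mul, sub_zero] at h1
    refine h1.congr' ?_
    filter_upwards [hne] with τ hτ
    simp only [hv]
    field_simp
  have hv0 : Tendsto v (𝓝[>] 0) (𝓝 0) := by
    have h1 := hvτ.mul hτ0
    rw [mul_zero] at h1
    refine h1.congr' ?_
    filter_upwards [hne] with τ hτ
    field_simp
  have hqv : Tendsto (fun τ => q (v τ)) (𝓝[>] 0) (𝓝 (q 0)) := (hq.tendsto 0).comp hv0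
  -- The equation `U = Φ(yU)` is expanded at `x lam` with increment `v`, and the orders `1`, `τ`,
  -- `τ²` give the three conclusions.
  have heq : ∀ᶠ τ : ℝ in 𝓝[>] 0,
      U τ = 1 + (Φ₀ + A * v τ + B * v τ ^ 2 + v τ ^ 3 * q (v τ)) := by
    filter_upwards [(tendsto_nhdsWithin_iff.1 (tendsto_radial hx)).2] with τ hτ
    have h1 := S.invF_taylorBranch ζ hτ
    rw [invF_eq_sum] at h1
    have h2 : x * (1 - (τ : ℂ) ^ 2) * S.taylorBranch ζ (x * (1 - (τ : ℂ) ^ 2)) = x * lam + v τ := by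
      simp only [hv, hU]; ring
    rw [h2, hΦ] at h1
    simp only [hU]
    linear_combination h1
  have e0 : lam = 1 + Φ₀ := by
    have h1 : Tendsto (fun τ => 1 + (Φ₀ + A * v τ + B * v τ ^ 2 + v τ ^ 3 * q (v τ))) (𝓝[>] 0)
        (𝓝 (1 + (Φ₀ + A * 0 + B * 0 ^ 2 + 0 ^ 3 * q 0))) :=
      ((((hv0.const_mul A).const_add Φ₀).add ((hv0.pow 2).const_mul B)).add
        ((hv0.pow 3).mul hqv)).const_add 1
    have h2 := tendsto_nhds_unique hU0 (h1.congr' (heq.mono fun τ h => h.symm))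
    simpa using h2
  have e1 : x * A = 1 := by
    have h1 : Tendsto (fun τ => A * (v τ / τ) + B * v τ * (v τ / τ) +
        v τ ^ 2 * (v τ / τ) * q (v τ)) (𝓝[>] 0)
        (𝓝 (A * (x * κ) + B * 0 * (x * κ) + 0 ^ 2 * (x * κ) * q 0)) :=
      (((hvτ.const_mul A).add ((hv0.const_mul B).mul hvτ))).add (((hv0.pow 2).mul hvτ).mul hqv)
    have h2 := tendsto_nhds_unique hh (h1.congr' ?_)
    · have h3 : (x * A - 1) * κ = 0 := by
        simp only [mul_zero, zero_mul, add_zero, ne_eq, OfNat.ofNat_ne_zero, not_false_eq_true,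
          zero_pow] at h2
        linear_combination -h2
      rcases mul_eq_zero.1 h3 with h4 | h4
      · exact sub_eq_zero.1 h4
      · exact absurd h4 hκ
    · filter_upwards [heq, hne] with τ h3 h4
      rw [eq_div_iff h4]
      have h5 : U τ - lam = A * v τ + B * v τ ^ 2 + v τ ^ 3 * q (v τ) := by rw [h3, e0]; ring
      rw [h5]
      field_simp
  have e2 : lam = B * (x * κ) ^ 2 := by
    have h1 : Tendsto (fun τ => B * (v τ / τ) ^ 2 + (v τ / τ) ^ 2 * v τ * q (v τ)) (𝓝[>] 0)
        (𝓝 (B * (x * κ) ^ 2 + (x * κ) ^ 2 * 0 * q 0)) :=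
      ((hvτ.pow 2).const_mul B).add (((hvτ.pow 2).mul hv0).mul hqv)
    have h2 := tendsto_nhds_unique hU0 (h1.congr' ?_)
    · simpa using h2
    · filter_upwards [heq, hne] with τ h3 h4
      -- Because `x A = 1`, the linear term `A v` cancels `U - lam`, and what survives is of order
      -- `τ²`.
      have h5 : (τ : ℂ) ^ 2 * U τ = B * v τ ^ 2 + v τ ^ 3 * q (v τ) := by
        have h6 : A * v τ = U τ - lam - (τ : ℂ) ^ 2 * U τ := by
          simp only [hv]
          linear_combination (U τ - lam - (τ : ℂ) ^ 2 * U τ) * e1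
        rw [h6, e0] at h3
        linear_combination h3
      have h7 : U τ = ((τ : ℂ) ^ 2 * U τ) / (τ : ℂ) ^ 2 := by field_simp
      rw [h7, h5]
      field_simp
  exact ⟨e0, e1, by rw [e2]; ring⟩

/-- Nondegeneracy is read from the third equation: if the second-order coefficient vanished, so
would `lam`. -/
theorem HasSqrtCoefficient.isSimpleDominantPoint (hdom : S.IsDominantPoint ζ x)
    (h : S.HasSqrtCoefficient ζ x lam κ) (hκ : κ ≠ 0) (hlam : lam ≠ 0) :
    S.IsSimpleDominantPoint ζ x lam := by
  obtain ⟨e0, e1, e2⟩ := h.branch_equations hdom.2 hκ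
  refine ⟨hdom, h.isBranchValue hdom.2, ?_, ?_, ?_⟩
  · rw [invF_eq_sum]; linear_combination e0
  · rw [(S.hasDerivAt_invF ζ lam x).deriv, e1, sub_self]
  · rw [iteratedDeriv_two_invF, neg_ne_zero]
    intro h0
    apply hlam
    rw [e2]
    linear_combination κ ^ 2 / 2 * h0

/-- The branch equations in the invariant variable `σ = (x lam) ^ s`. -/
theorem HasSqrtCoefficient.exponentSum_equations (hx : ‖x‖ₑ = S.rhoStar ζ)
    (h : S.HasSqrtCoefficient ζ x lam κ) (hκ : κ ≠ 0) :
    1 + S.exponentSum (fun _ => 1) ζ ((x * lam) ^ S.symIndex) = lam ∧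
      S.exponentSum (fun n => n) ζ ((x * lam) ^ S.symIndex) = lam ∧
      S.exponentSum (fun n => n * (n - 1)) ζ ((x * lam) ^ S.symIndex) * κ ^ 2 = 2 * lam ^ 3 := by
  obtain ⟨e0, e1, e2⟩ := h.branch_equations hx hκ
  simp only [exponentSum_pow]
  have h1 : ∑ n, (S.exponent n : ℂ) * ζ n * (x * lam) ^ S.exponent n =
      (x * lam) * S.phiDeriv ζ (x * lam) := by
    rw [phiDeriv, Finset.mul_sum]
    refine Finset.sum_congr rfl fun n _ => ?_
    obtain ⟨m, hm⟩ : ∃ m, S.exponent n = m + 1 := ⟨S.exponent n - 1, by have := S.two_le n; omega⟩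
    rw [hm, Nat.add_sub_cancel, pow_succ]; ring
  have h2 : ∑ n, (S.exponent n : ℂ) * (S.exponent n - 1) * ζ n * (x * lam) ^ S.exponent n =
      2 * (x * lam) ^ 2 * S.phiSecond ζ (x * lam) := by
    rw [phiSecond, Finset.mul_sum]
    refine Finset.sum_congr rfl fun n _ => ?_
    obtain ⟨m, hm⟩ : ∃ m, S.exponent n = m + 2 := ⟨S.exponent n - 2, by have := S.two_le n; omega⟩
    rw [hm, Nat.add_sub_cancel, pow_add]; ring
  refine ⟨?_, ?_, ?_⟩
  · simp only [one_mul]; exact e0.symm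
  · rw [h1]; linear_combination lam * e1
  · rw [h2]
    linear_combination (-2 * lam ^ 2) * e2

end BoundaryPoint

end PolynomialLeaf

/-! ### Continuity of the Taylor branch in the parameters -/

namespace PolynomialLeaf

variable {N : ℕ} {S : PolynomialLeaf N}

theorem mem_analyticDisk_of_norm_lt_one {ζ : Fin N → ℂ} (h : 1 ≤ S.rhoStar ζ) {y : ℂ}
    (hy : ‖y‖ < 1) : y ∈ S.analyticDisk ζ := by
  show ‖y‖ₑ < _
  refine lt_of_lt_of_le ?_ h
  rw [← ofReal_norm]
  exact ENNReal.ofReal_lt_one.2 hy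

theorem ball_subset_analyticDisk {ζ : Fin N → ℂ} (h : 1 ≤ S.rhoStar ζ) :
    Metric.ball (0 : ℂ) 1 ⊆ S.analyticDisk ζ := fun y hy =>
  mem_analyticDisk_of_norm_lt_one h (by simpa using hy)

/-- Near the origin two branches with bounds differ by at most the difference of the parameters. -/
theorem exists_local_lipschitz (S : PolynomialLeaf N) (ζc : Fin N → ℂ) (hc : 1 ≤ S.rhoStar ζc)
    (M : ℝ) : ∃ r : ℝ, 0 < r ∧ r < 1 ∧ ∀ ζ : Fin N → ℂ, 1 ≤ S.rhoStar ζ →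
      (∀ y : ℂ, ‖y‖ < 1 → ‖S.taylorBranch ζ y‖ ≤ M) → ∀ y : ℂ, ‖y‖ ≤ r →
        ‖S.taylorBranch ζ y - S.taylorBranch ζc y‖ ≤ 2 * ∑ n, ‖ζ n - ζc n‖ := by
  obtain ⟨K, t, ht, hK⟩ := ((S.contDiff_phi ζc).contDiffAt (x := 0)).exists_lipschitzOnWith
  obtain ⟨r₀, hr₀, hball⟩ := Metric.mem_nhds_iff.1 ht
  obtain ⟨B, hB⟩ := (isCompact_closedBall (0 : ℂ) (1 / 2)).exists_bound_of_continuousOn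
    ((S.taylorBranch_spec ζc).1.continuousOn.mono fun y hy => mem_analyticDisk_of_norm_lt_one hc (by
      have : ‖y‖ ≤ 1 / 2 := by simpa using hy
      linarith))
  set M' := max (max M B) 1 with hM'
  have hM'1 : 1 ≤ M' := le_max_right _ _
  have hM'0 : 0 < M' := by linarith
  -- For `|y| ≤ r` the products `y u`, `y w` lie in the Lipschitz neighbourhood and in the unit
  -- disk, and `K |y| ≤ 1/2` lets the term in `u - w` be absorbed.
  set r := min (1 / 2) (min (min r₀ 1 / (2 * M')) (1 / (2 * (K + 1)))) with hr
  have hK0 : (0 : ℝ) ≤ K := K.2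
  have hr0 : 0 < r := by positivity
  have hr1 : r ≤ 1 / 2 := min_le_left _ _
  have hr2 : r ≤ min r₀ 1 / (2 * M') := (min_le_right _ _).trans (min_le_left _ _)
  have hr3 : r ≤ 1 / (2 * (K + 1)) := (min_le_right _ _).trans (min_le_right _ _)
  refine ⟨r, hr0, by linarith, fun ζ hζ hζM y hy => ?_⟩
  have hyd : ‖y‖ < 1 := by linarith
  set u := S.taylorBranch ζ y with hu
  set w := S.taylorBranch ζc y with hw
  have h1 := S.invF_taylorBranch ζ (mem_analyticDisk_of_norm_lt_one hζ hyd)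
  have h2 := S.invF_taylorBranch ζc (mem_analyticDisk_of_norm_lt_one hc hyd)
  rw [invF_eq, sub_eq_zero, ← hu] at h1
  rw [invF_eq, sub_eq_zero, ← hw] at h2
  have huM : ‖u‖ ≤ M' := (hζM y hyd).trans ((le_max_left _ _).trans (le_max_left _ _))
  have hwM : ‖w‖ ≤ M' := (hB y (by simpa using hy.trans hr1)).trans
    ((le_max_right _ _).trans (le_max_left _ _))
  have hrM : r * M' ≤ min r₀ 1 / 2 := by
    rw [le_div_iff₀ (by positivity)] at hr2; linarith
  have hmin0 : 0 < min r₀ 1 := by positivity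
  have hyu : ‖y * u‖ < min r₀ 1 := by
    rw [norm_mul]
    have : ‖y‖ * ‖u‖ ≤ r * M' := by gcongr
    linarith
  have hyw : ‖y * w‖ < min r₀ 1 := by
    rw [norm_mul]
    have : ‖y‖ * ‖w‖ ≤ r * M' := by gcongr
    linarith
  have h3 := hK.dist_le_mul (y * u) (hball (by simpa using hyu.trans_le (min_le_left _ _))) (y * w)
    (hball (by simpa using hyw.trans_le (min_le_left _ _)))
  rw [dist_eq_norm, dist_eq_norm, ← mul_sub, norm_mul, ← h2] at h3
  have h4 : u - w = (1 + ∑ n, ζc n * (y * u) ^ S.exponent n - w) +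
      ∑ n, (ζ n - ζc n) * (y * u) ^ S.exponent n := by
    have h5 : ∑ n, (ζ n - ζc n) * (y * u) ^ S.exponent n =
        ∑ n, ζ n * (y * u) ^ S.exponent n - ∑ n, ζc n * (y * u) ^ S.exponent n := by
      rw [← Finset.sum_sub_distrib]
      exact Finset.sum_congr rfl fun n _ => by ring
    rw [h5]
    linear_combination h1
  have h6 : ‖∑ n, (ζ n - ζc n) * (y * u) ^ S.exponent n‖ ≤ ∑ n, ‖ζ n - ζc n‖ := by
    refine norm_sum_le_of_le _ fun n _ => ?_
    rw [norm_mul, norm_pow]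
    refine mul_le_of_le_one_right (norm_nonneg _) (pow_le_one₀ (norm_nonneg _) ?_)
    exact hyu.le.trans (min_le_right _ _)
  have h7 : (K : ℝ) * (‖y‖ * ‖u - w‖) ≤ ‖u - w‖ / 2 := by
    have h8 : (K : ℝ) * ‖y‖ ≤ 1 / 2 := by
      have h9 : ‖y‖ * (2 * (K + 1)) ≤ 1 := by
        have := hy.trans hr3
        rwa [le_div_iff₀ (by positivity)] at this
      nlinarith [norm_nonneg y]
    nlinarith [norm_nonneg (u - w)]
  have h8 : ‖u - w‖ ≤ ‖u - w‖ / 2 + ∑ n, ‖ζ n - ζc n‖ := by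
    conv_lhs => rw [h4]
    exact (norm_add_le _ _).trans (add_le_add (h3.trans h7) h6)
  linarith

/-- The local estimate makes each Taylor coefficient of the difference tend to `0`. The uniform
bound on the unit disk gives a geometric majorant by Cauchy's estimate, so dominated convergence
extends the limit to all `|y| < 1`. -/
theorem tendsto_taylorBranch {ι : Type*} {l : Filter ι} {Z : ι → Fin N → ℂ} {ζc : Fin N → ℂ}
    (hZ : Tendsto Z l (𝓝 ζc)) (hc : 1 ≤ S.rhoStar ζc) {M : ℝ}
    (hM : ∀ᶠ i in l, 1 ≤ S.rhoStar (Z i) ∧ ∀ y : ℂ, ‖y‖ < 1 → ‖S.taylorBranch (Z i) y‖ ≤ M)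
    {y : ℂ} (hy : ‖y‖ < 1) :
    Tendsto (fun i => S.taylorBranch (Z i) y) l (𝓝 (S.taylorBranch ζc y)) := by
  obtain ⟨r, hr0, hr1, hlip⟩ := S.exists_local_lipschitz ζc hc M
  obtain ⟨R, hyR, hR1⟩ := exists_between hy
  have hR0 : 0 < R := (norm_nonneg y).trans_lt hyR
  obtain ⟨B, hB⟩ := (isCompact_closedBall (0 : ℂ) R).exists_bound_of_continuousOn
    ((S.taylorBranch_spec ζc).1.continuousOn.mono
      ((Metric.closedBall_subset_ball hR1).trans (ball_subset_analyticDisk hc)))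
  set D : ι → ℂ → ℂ := fun i y => S.taylorBranch (Z i) y - S.taylorBranch ζc y with hD
  have hDd : ∀ᶠ i in l, DifferentiableOn ℂ (D i) (Metric.ball 0 1) := hM.mono fun i hi =>
    ((S.taylorBranch_spec (Z i)).1.mono (ball_subset_analyticDisk hi.1)).sub
      ((S.taylorBranch_spec ζc).1.mono (ball_subset_analyticDisk hc))
  have hsum0 : Tendsto (fun i => 2 * ∑ n, ‖Z i n - ζc n‖) l (𝓝 0) := by
    have h1 : ∀ n, Tendsto (fun i => ‖Z i n - ζc n‖) l (𝓝 0) := fun n => by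
      rw [← tendsto_iff_norm_sub_tendsto_zero]
      exact (tendsto_pi_nhds.1 hZ) n
    have := (tendsto_finsetSum Finset.univ fun n _ => h1 n).const_mul 2
    simpa using this
  have hderiv : ∀ (k : ℕ) (ρ b : ℝ), 0 < ρ → ρ < 1 → ∀ i, DifferentiableOn ℂ (D i) (Metric.ball 0 1) →
      (∀ z, ‖z‖ = ρ → ‖D i z‖ ≤ b) →
      ‖(k.factorial : ℂ)⁻¹ • (y - 0) ^ k • iteratedDeriv k (D i) 0‖ ≤ b * (‖y‖ / ρ) ^ k := by
    intro k ρ b hρ0 hρ1 i hi hb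
    have h1 := Complex.norm_iteratedDeriv_le_of_forall_mem_sphere_norm_le k hρ0
      (DifferentiableOn.diffContOnCl_ball hi (Metric.closedBall_subset_ball hρ1))
      fun z hz => hb z (by simpa using hz)
    have hk : (0 : ℝ) < k.factorial := by exact_mod_cast k.factorial_pos
    rw [norm_smul, norm_smul, norm_inv, norm_pow, sub_zero, Complex.norm_natCast]
    calc (k.factorial : ℝ)⁻¹ * (‖y‖ ^ k * ‖iteratedDeriv k (D i) 0‖)
        ≤ (k.factorial : ℝ)⁻¹ * (‖y‖ ^ k * (k.factorial * b / ρ ^ k)) := by gcongr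
      _ = b * (‖y‖ / ρ) ^ k := by rw [div_pow]; field_simp
  have hmain : Tendsto (fun i => ∑' k : ℕ, (k.factorial : ℂ)⁻¹ • (y - 0) ^ k •
      iteratedDeriv k (D i) 0) l (𝓝 (∑' _ : ℕ, (0 : ℂ))) := by
    refine tendsto_tsum_of_dominated_convergence (bound := fun k => (M + B) * (‖y‖ / R) ^ k)
      ((summable_geometric_of_lt_one (by positivity) ((div_lt_one hR0).2 hyR)).mul_left _)
      (fun k => ?_) ?_
    · refine squeeze_zero_norm' (a := fun i => (2 * ∑ n, ‖Z i n - ζc n‖) * (‖y‖ / r) ^ k) ?_ ?_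
      · filter_upwards [hM, hDd] with i hi hi2
        exact hderiv k r _ hr0 hr1 i hi2 fun z hz => hlip (Z i) hi.1 hi.2 z hz.le
      · simpa using hsum0.mul_const ((‖y‖ / r) ^ k)
    · filter_upwards [hM, hDd] with i hi hi2 k
      refine hderiv k R _ hR0 hR1 i hi2 fun z hz => (norm_sub_le _ _).trans (add_le_add ?_ ?_)
      · exact hi.2 z (by rw [hz]; exact hR1)
      · exact hB z (by simp [hz])
  rw [tsum_zero] at hmain
  have h1 : Tendsto (fun i => D i y) l (𝓝 0) := by
    refine hmain.congr' ?_
    filter_upwards [hDd] with i hi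
    exact (Complex.hasSum_taylorSeries_on_ball hi (by simpa using hy)).tsum_eq
  have h2 := h1.add_const (S.taylorBranch ζc y)
  rw [zero_add] at h2
  exact h2.congr fun i => by simp [hD]

/-- Expansions with uniform constants pass to the limit. -/
theorem HasSqrtExpansion.of_tendsto {ι : Type*} {l : Filter ι} [l.NeBot] {Z : ι → Fin N → ℂ}
    {ζc : Fin N → ℂ} (hZ : Tendsto Z l (𝓝 ζc)) (hc : S.rhoStar ζc = 1) {M : ℝ}
    (hM : ∀ᶠ i in l, 1 ≤ S.rhoStar (Z i) ∧ ∀ y : ℂ, ‖y‖ < 1 → ‖S.taylorBranch (Z i) y‖ ≤ M)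
    {x lam κ : ι → ℂ} {x' lam' κ' : ℂ} {ε C : ℝ} (hx : Tendsto x l (𝓝 x'))
    (hlam : Tendsto lam l (𝓝 lam')) (hκ : Tendsto κ l (𝓝 κ')) (hx' : ‖x'‖ = 1)
    (h : ∀ᶠ i in l, S.HasSqrtExpansion (Z i) (x i) (lam i) (κ i) ε C) :
    S.HasSqrtExpansion ζc x' lam' κ' ε C := by
  have hx'e : ‖x'‖ₑ = S.rhoStar ζc := by rw [hc, ← ofReal_norm, hx']; simp
  have hx'0 : x' ≠ 0 := ne_zero_of_enorm_eq_rhoStar hx'e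
  have hs : 0 < S.symIndex := S.symIndex_pos (rhoStar_ne_top_of_enorm_eq hx'e)
  refine ⟨hx'e, fun y hy hyε => ?_⟩
  rw [hx'] at hy
  have hδ : Tendsto (fun i => 1 - (y / x i) ^ S.symIndex) l (𝓝 (1 - (y / x') ^ S.symIndex)) :=
    ((tendsto_const_nhds.div hx hx'0).pow _).const_sub 1
  have hre : 0 < (1 - (y / x') ^ S.symIndex).re := by
    refine re_one_sub_pos ?_
    rw [norm_pow, norm_div, hx', div_one]
    exact pow_lt_one₀ (norm_nonneg _) hy hs.ne'
  have hsqrt : Tendsto (fun i => (1 - (y / x i) ^ S.symIndex) ^ (1 / 2 : ℂ)) l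
      (𝓝 ((1 - (y / x') ^ S.symIndex) ^ (1 / 2 : ℂ))) :=
    hδ.cpow tendsto_const_nhds (Or.inl hre)
  have hU := tendsto_taylorBranch hZ hc.ge hM hy
  refine le_of_tendsto_of_tendsto
    (((hU.sub hlam).sub ((hκ.const_mul _).mul hsqrt)).norm) (hδ.norm.const_mul C) ?_
  filter_upwards [h, hM, hδ.norm.eventually_lt_const hyε] with i hi hi2 hi3
  refine hi.expansion y ?_ hi3
  have h1 := mem_analyticDisk_of_norm_lt_one hi2.1 hy
  exact (mem_analyticDisk_iff hi.enorm_eq y).1 h1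

/-! ### Rotations -/

theorem orbit_eq {s : ℕ} (hs : 0 < s) {x : ℂ} (hx : x ≠ 0) :
    {y : ℂ | ∃ j : ℕ, j < s ∧ y = Complex.exp (2 * Real.pi * Complex.I * j / s) * x} =
      {y : ℂ | y ^ s = x ^ s} := by
  have hexp : ∀ j : ℕ, Complex.exp (2 * Real.pi * Complex.I * j / s) =
      Complex.exp (2 * Real.pi * Complex.I / s) ^ j := fun j => by
    rw [← Complex.exp_nat_mul]; congr 1; ring
  have hprim := Complex.isPrimitiveRoot_exp s hs.ne'
  ext y
  simp only [mem_ofPred_eq, hexp]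
  constructor
  · rintro ⟨j, -, rfl⟩
    rw [mul_pow, ← pow_mul, mul_comm j s, pow_mul, hprim.pow_eq_one, one_pow, one_mul]
  · intro h
    have h1 : (y / x) ^ s = 1 := by rw [div_pow, h, div_self (pow_ne_zero _ hx)]
    have : NeZero s := ⟨hs.ne'⟩
    obtain ⟨j, hj, hj2⟩ := hprim.eq_pow_of_pow_eq_one h1
    exact ⟨j, hj, by rw [hj2, div_mul_cancel₀ _ hx]⟩

theorem IsDominantPoint.singularity_iff {ζ : Fin N → ℂ} {x : ℂ} (h : S.IsDominantPoint ζ x) (y : ℂ) :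
    S.IsBoundarySingularity ζ y ↔ y ^ S.symIndex = x ^ S.symIndex := by
  have h1 := h.1
  rw [orbit_eq (S.symIndex_pos (rhoStar_ne_top_of_enorm_eq h.2)) (ne_zero_of_enorm_eq_rhoStar h.2)]
    at h1
  exact Set.ext_iff.1 h1 y

theorem IsDominantPoint.of_singularity {ζ : Fin N → ℂ} {x y : ℂ} (h : S.IsDominantPoint ζ x)
    (hy : S.IsBoundarySingularity ζ y) : S.IsDominantPoint ζ y := by
  have h1 := (h.singularity_iff y).1 hy
  refine ⟨?_, hy.1⟩
  rw [orbit_eq (S.symIndex_pos (rhoStar_ne_top_of_enorm_eq h.2)) (ne_zero_of_enorm_eq_rhoStar hy.1)]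
  ext z
  rw [mem_ofPred_eq, mem_ofPred_eq, h.singularity_iff z, h1]

/-- The exponents are multiples of `s`, so the rotated branch solves the same equation, and the germ
at `0` is unique. -/
theorem taylorBranch_rotate (S : PolynomialLeaf N) (ζ : Fin N → ℂ) {w : ℂ}
    (hw : w ^ S.symIndex = 1) (hw1 : ‖w‖ = 1) {y : ℂ} (hy : y ∈ S.analyticDisk ζ) :
    S.taylorBranch ζ (w * y) = S.taylorBranch ζ y := by
  have hmem : ∀ z ∈ S.analyticDisk ζ, w * z ∈ S.analyticDisk ζ := fun z hz => by
    show ‖w * z‖ₑ < _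
    rw [enorm_mul, ← ofReal_norm w, hw1]
    simpa using (show ‖z‖ₑ < S.rhoStar ζ from hz)
  have hd : DifferentiableOn ℂ (fun z => S.taylorBranch ζ (w * z)) (S.analyticDisk ζ) :=
    (S.taylorBranch_spec ζ).1.comp (by fun_prop) hmem
  have hcont : ∀ V : ℂ → ℂ, DifferentiableOn ℂ V (S.analyticDisk ζ) → ContinuousAt V 0 := fun V hV =>
    (hV.differentiableAt ((S.isOpen_analyticDisk ζ).mem_nhds (S.zero_mem_analyticDisk ζ))).continuousAt
  have hgerm := S.germ_unique ζ (fun z => S.taylorBranch ζ (w * z)) (S.taylorBranch ζ)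
    (hcont _ hd) (hcont _ (S.taylorBranch_spec ζ).1) (by
      filter_upwards [(S.isOpen_analyticDisk ζ).mem_nhds (S.zero_mem_analyticDisk ζ)] with z hz
      have h1 := S.invF_taylorBranch ζ (hmem z hz)
      have h2 : ∀ n, (w * z) ^ S.exponent n = z ^ S.exponent n := fun n => by
        obtain ⟨k, hk⟩ := S.symIndex_dvd n
        rw [mul_pow, hk, pow_mul, hw, one_pow, one_mul]
      simpa only [invF, h2] using h1) (S.taylorBranch_spec ζ).2.2
  exact (hd.analyticOnNhd (S.isOpen_analyticDisk ζ)).eqOn_of_preconnected_of_eventuallyEq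
    (S.analyticOnNhd_taylorBranch ζ) (convex_eball _).isPreconnected (S.zero_mem_analyticDisk ζ)
    hgerm hy

theorem branchValue_unique {ζ : Fin N → ℂ} {x x' lam lam' : ℂ} (hx : ‖x‖ₑ = S.rhoStar ζ)
    (hx' : ‖x'‖ₑ = S.rhoStar ζ) (hs : x' ^ S.symIndex = x ^ S.symIndex)
    (h : S.IsBranchValue ζ x lam) (h' : S.IsBranchValue ζ x' lam') : lam' = lam := by
  have hx0 : x ≠ 0 := ne_zero_of_enorm_eq_rhoStar hx
  have hn : ‖x'‖ = ‖x‖ := by rw [← rhoStar_toReal_eq_norm hx', ← rhoStar_toReal_eq_norm hx]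
  have h1 := h.comp (tendsto_radial hx)
  have h2 := h'.comp (tendsto_radial hx')
  refine tendsto_nhds_unique h2 (h1.congr' ?_)
  filter_upwards [(tendsto_nhdsWithin_iff.1 (tendsto_radial hx)).2] with τ hτ
  simp only [Function.comp_apply]
  rw [← S.taylorBranch_rotate ζ (w := x' / x) ?_ ?_ hτ]
  · congr 1; field_simp
  · rw [div_pow, hs, div_self (pow_ne_zero _ hx0)]
  · rw [norm_div, hn, div_self (norm_ne_zero_iff.2 hx0)]

/-- The critical limit of uniform expansions. -/
theorem exists_critical_limit {ι : Type*} {l : Filter ι} [l.NeBot] {Z : ι → Fin N → ℂ}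
    {ζc : Fin N → ℂ} (hZ : Tendsto Z l (𝓝 ζc)) (hc : S.rhoStar ζc = 1) {M : ℝ}
    (hM : ∀ᶠ i in l, 1 ≤ S.rhoStar (Z i) ∧ ∀ y : ℂ, ‖y‖ < 1 → ‖S.taylorBranch (Z i) y‖ ≤ M)
    {x lam κ : ι → ℂ} {ε C c₀ : ℝ} (hε : 0 < ε) (hC : 0 ≤ C) (hc₀ : 0 < c₀)
    (hx : Tendsto (fun i => ‖x i‖) l (𝓝 1))
    (hlam : ∀ᶠ i in l, ‖lam i‖ ≤ C ∧ ‖κ i‖ ≤ C ∧ c₀ ≤ ‖lam i‖ ∧ c₀ ≤ ‖κ i‖)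
    (h : ∀ᶠ i in l, S.HasSqrtExpansion (Z i) (x i) (lam i) (κ i) ε C)
    {x₀ : ℂ} (hx₀ : S.IsDominantPoint ζc x₀) :
    ∃ xc lamc κc : ℂ, S.IsSimpleDominantPoint ζc xc lamc ∧ S.HasSqrtCoefficient ζc xc lamc κc ∧
      lamc ≠ 0 ∧ κc ≠ 0 ∧ Tendsto (fun i => x i ^ S.symIndex) l (𝓝 (xc ^ S.symIndex)) ∧
      Tendsto lam l (𝓝 lamc) := by
  -- Along an ultrafilter the bounded data converge, and the lower bound `c₀` keeps the limits
  -- nonzero. The limiting expansion makes `x'` singular for the critical branch, so `x'` lies on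
  -- the given dominant orbit. Hence `x' ^ s`, and by rotation `lam'`, do not depend on the
  -- ultrafilter, which upgrades to convergence along `l`.
  have key : ∀ U : Ultrafilter ι, (U : Filter ι) ≤ l → ∃ xc lamc κc : ℂ,
      S.IsDominantPoint ζc xc ∧ S.HasSqrtCoefficient ζc xc lamc κc ∧ lamc ≠ 0 ∧ κc ≠ 0 ∧
      Tendsto x U (𝓝 xc) ∧ Tendsto lam U (𝓝 lamc) := by
    intro U hU
    have hcomp : IsCompact (Metric.closedBall (0 : ℂ) 2 ×ˢ
        (Metric.closedBall (0 : ℂ) C ×ˢ Metric.closedBall (0 : ℂ) C)) :=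
      (isCompact_closedBall _ _).prod ((isCompact_closedBall _ _).prod (isCompact_closedBall _ _))
    obtain ⟨⟨x', lam', κ'⟩, -, hP⟩ := hcomp.ultrafilter_le_nhds
      (U.map fun i => (x i, lam i, κ i)) (by
        rw [Ultrafilter.coe_map, le_principal_iff, mem_map]
        refine hU ?_
        filter_upwards [hlam, hx.eventually_lt_const one_lt_two] with i hi hi2
        simp only [mem_preimage, mem_prod, mem_closedBall_zero_iff]
        exact ⟨hi2.le, hi.1, hi.2.1⟩)
    rw [Ultrafilter.coe_map] at hP
    have hP' : Tendsto (fun i => (x i, lam i, κ i)) U (𝓝 (x', lam', κ')) := hP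
    have hx' : Tendsto x U (𝓝 x') := (continuous_fst.tendsto _).comp hP'
    have hlam' : Tendsto lam U (𝓝 lam') :=
      ((continuous_fst.comp continuous_snd).tendsto _).comp hP'
    have hκ' : Tendsto κ U (𝓝 κ') :=
      ((continuous_snd.comp continuous_snd).tendsto _).comp hP'
    have hx'1 : ‖x'‖ = 1 := tendsto_nhds_unique hx'.norm (hx.mono_left hU)
    have hl0 : lam' ≠ 0 := norm_pos_iff.1 (hc₀.trans_le
      (ge_of_tendsto hlam'.norm (hU (hlam.mono fun i hi => hi.2.2.1))))
    have hk0 : κ' ≠ 0 := norm_pos_iff.1 (hc₀.trans_le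
      (ge_of_tendsto hκ'.norm (hU (hlam.mono fun i hi => hi.2.2.2))))
    have hexp := HasSqrtExpansion.of_tendsto (hZ.mono_left hU) hc (hU hM) hx' hlam' hκ' hx'1 (hU h)
    have hco := hexp.hasSqrtCoefficient hε hC
    exact ⟨x', lam', κ', hx₀.of_singularity (hco.isBoundarySingularity hexp.enorm_eq hk0), hco, hl0,
      hk0, hx', hlam'⟩
  obtain ⟨xc, lamc, κc, hdom, hco, hl0, hk0, -, -⟩ := key (Ultrafilter.of l) (Ultrafilter.of_le l)
  refine ⟨xc, lamc, κc, hco.isSimpleDominantPoint hdom hk0 hl0, hco, hl0, hk0, ?_, ?_⟩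
  · rw [tendsto_iff_ultrafilter]
    intro U hU
    obtain ⟨x', lam', κ', hdom', hco', -, hk0', hx', -⟩ := key U hU
    have h1 : x' ^ S.symIndex = xc ^ S.symIndex :=
      (hdom.singularity_iff x').1 (hco'.isBoundarySingularity hdom'.2 hk0')
    rw [← h1]
    exact hx'.pow _
  · rw [tendsto_iff_ultrafilter]
    intro U hU
    obtain ⟨x', lam', κ', hdom', hco', -, hk0', -, hlam'⟩ := key U hU
    have h1 : x' ^ S.symIndex = xc ^ S.symIndex :=
      (hdom.singularity_iff x').1 (hco'.isBoundarySingularity hdom'.2 hk0')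
    rw [← branchValue_unique hdom.2 hdom'.2 h1 (hco.isBranchValue hdom.2)
      (hco'.isBranchValue hdom'.2)]
    exact hlam'

end PolynomialLeaf

/-! ### Rates of convergence of the branch data -/

namespace PolynomialLeaf

variable {N : ℕ} {S : PolynomialLeaf N}

theorem exponentSum_sub (c : ℕ → ℂ) (ζ ζ' : Fin N → ℂ) (σ : ℂ) :
    S.exponentSum c (ζ - ζ') σ = S.exponentSum c ζ σ - S.exponentSum c ζ' σ := by
  simp only [exponentSum, Pi.sub_apply, ← Finset.sum_sub_distrib]
  exact Finset.sum_congr rfl fun n _ => by ring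

theorem hasDerivAt_exponentSum (S : PolynomialLeaf N) (c : ℕ → ℂ) (ζ : Fin N → ℂ) (σ : ℂ) :
    HasDerivAt (S.exponentSum c ζ)
      (∑ n, c (S.exponent n) * ζ n * (((S.exponent n / S.symIndex : ℕ) : ℂ) *
        σ ^ (S.exponent n / S.symIndex - 1))) σ := by
  unfold exponentSum
  exact HasDerivAt.fun_sum fun n _ => (hasDerivAt_pow _ σ).const_mul _

theorem isBigO_exponentSum {ι : Type*} {l : Filter ι} {Z : ι → Fin N → ℂ} {ζc : Fin N → ℂ}
    {e : ι → ℝ} (hZ : (fun i => Z i - ζc) =O[l] e) {σ : ι → ℂ} {σc : ℂ}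
    (hσ : Tendsto σ l (𝓝 σc)) (c : ℕ → ℂ) :
    (fun i => S.exponentSum c (Z i) (σ i) - S.exponentSum c ζc (σ i)) =O[l] e := by
  simp only [← exponentSum_sub]
  unfold exponentSum
  refine IsBigO.fun_sum fun n _ => ?_
  have h1 : (fun i => (Z i - ζc) n) =O[l] e := isBigO_pi.1 hZ n
  have h2 : (fun i => σ i ^ (S.exponent n / S.symIndex)) =O[l] fun _ => (1 : ℝ) :=
    (hσ.pow _).isBigO_one ℝ
  have h3 := (h1.const_mul_left (c (S.exponent n))).mul h2
  simpa using h3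

/-- Eliminating `lam` from the first two branch equations leaves `∑ (1 - sₙ) ζₙ σ^{sₙ/s} = -1`. Its
derivative in `σ` is a nonzero multiple of `D`, which does not vanish because `D κ² = 2 lam³`. So
`σ` moves at the rate of `ζ`, and `lam` and `κ²` follow from the equations. -/
theorem isBigO_branch_data {ι : Type*} {l : Filter ι} {Z : ι → Fin N → ℂ} {ζc : Fin N → ℂ}
    {e : ι → ℝ} (hZ : (fun i => Z i - ζc) =O[l] e) {x lam κ : ι → ℂ} {xc lamc κc : ℂ} {C : ℝ}
    (h : ∀ᶠ i in l, ‖x i‖ₑ = S.rhoStar (Z i) ∧ S.HasSqrtCoefficient (Z i) (x i) (lam i) (κ i) ∧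
      κ i ≠ 0 ∧ ‖κ i‖ ≤ C)
    (hxc : ‖xc‖ₑ = S.rhoStar ζc) (hco : S.HasSqrtCoefficient ζc xc lamc κc) (hκc : κc ≠ 0)
    (hlamc : lamc ≠ 0) (hx : Tendsto (fun i => x i ^ S.symIndex) l (𝓝 (xc ^ S.symIndex)))
    (hlam : Tendsto lam l (𝓝 lamc)) :
    (fun i => lam i - lamc) =O[l] e ∧ (fun i => ‖κ i‖ - ‖κc‖) =O[l] e := by
  have hxc0 : xc ≠ 0 := ne_zero_of_enorm_eq_rhoStar hxc
  have hs : 0 < S.symIndex := S.symIndex_pos (rhoStar_ne_top_of_enorm_eq hxc)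
  set σ : ι → ℂ := fun i => (x i * lam i) ^ S.symIndex with hσ
  set σc : ℂ := (xc * lamc) ^ S.symIndex with hσc
  have hσc0 : σc ≠ 0 := pow_ne_zero _ (mul_ne_zero hxc0 hlamc)
  have hσt : Tendsto σ l (𝓝 σc) := by
    have := hx.mul (hlam.pow S.symIndex)
    simpa only [hσ, hσc, mul_pow] using this
  obtain ⟨c0, c1, c2⟩ := hco.exponentSum_equations hxc hκc
  have heq : ∀ᶠ i in l, 1 + S.exponentSum (fun _ => 1) (Z i) (σ i) = lam i ∧
      S.exponentSum (fun n => n) (Z i) (σ i) = lam i ∧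
      S.exponentSum (fun n => n * (n - 1)) (Z i) (σ i) * κ i ^ 2 = 2 * lam i ^ 3 :=
    h.mono fun i hi => hi.2.1.exponentSum_equations hi.1 hi.2.2.1
  rw [← hσc] at c0 c1 c2
  set D : ι → ℂ := fun i => S.exponentSum (fun n => n * (n - 1)) (Z i) (σ i) with hD
  set Dc : ℂ := S.exponentSum (fun n => n * (n - 1)) ζc σc with hDc
  have hDc0 : Dc ≠ 0 := fun h0 => by
    rw [h0, zero_mul] at c2
    exact hlamc (pow_eq_zero_iff (n := 3) (by norm_num) |>.1 (by linear_combination -(1 / 2) * c2))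
  have hσO : (fun i => σ i - σc) =O[l] e := by
    have hder := S.hasDerivAt_exponentSum (fun n => 1 - n) ζc σc
    have hder0 : (∑ n, (fun n : ℕ => (1 : ℂ) - n) (S.exponent n) * ζc n *
        (((S.exponent n / S.symIndex : ℕ) : ℂ) * σc ^ (S.exponent n / S.symIndex - 1))) ≠ 0 := by
      intro h0
      apply hDc0
      have h1 : Dc = -(S.symIndex * σc) * (∑ n, (fun n : ℕ => (1 : ℂ) - n) (S.exponent n) * ζc n *
        (((S.exponent n / S.symIndex : ℕ) : ℂ) * σc ^ (S.exponent n / S.symIndex - 1))) := by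
        rw [hDc, exponentSum, Finset.mul_sum]
        refine Finset.sum_congr rfl fun n _ => ?_
        obtain ⟨k, hk⟩ := S.symIndex_dvd n
        have hk0 : k ≠ 0 := by
          rintro rfl
          have := S.two_le n
          omega
        obtain ⟨j, rfl⟩ := Nat.exists_eq_succ_of_ne_zero hk0
        rw [hk, Nat.mul_div_cancel_left _ hs, Nat.succ_sub_one, pow_succ]
        push_cast
        ring
      rw [h1, h0, mul_zero]
    -- A nonzero derivative bounds `σ - σc` by the increment of the sum; both parameters give the
    -- value `-1`, so this increment is the effect of changing `ζ` alone.
    have h1 := (hder.isTheta_sub hder0).2.comp_tendsto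
      (hσt.prodMk (tendsto_pure.2 (Eventually.of_forall fun _ => rfl)) :
        Tendsto (fun i => (σ i, σc)) l (𝓝 σc ×ˢ pure σc))
    refine h1.trans ?_
    have h2 := isBigO_exponentSum (S := S) hZ hσt (fun n => 1 - n)
    have hlin : ∀ (ζ : Fin N → ℂ) (σ : ℂ), S.exponentSum (fun n => 1 - n) ζ σ =
        S.exponentSum (fun _ => 1) ζ σ - S.exponentSum (fun n => n) ζ σ := fun ζ σ => by
      simp only [exponentSum, ← Finset.sum_sub_distrib]
      exact Finset.sum_congr rfl fun n _ => by ring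
    refine h2.neg_left.congr' ?_ EventuallyEq.rfl
    filter_upwards [heq] with i hi
    simp only [Function.comp_apply, hlin]
    linear_combination c0 - c1 - hi.1 + hi.2.1
  have hEO : ∀ c : ℕ → ℂ,
      (fun i => S.exponentSum c (Z i) (σ i) - S.exponentSum c ζc σc) =O[l] e := fun c => by
    have h1 := isBigO_exponentSum (S := S) hZ hσt c
    have h2 := ((S.hasDerivAt_exponentSum c ζc σc).isBigO_sub.comp_tendsto hσt).trans hσO
    exact (h1.add h2).congr_left fun i => by simp
  have hlamO : (fun i => lam i - lamc) =O[l] e := by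
    refine (hEO fun _ => 1).congr' ?_ EventuallyEq.rfl
    filter_upwards [heq] with i hi
    linear_combination hi.1 - c0
  refine ⟨hlamO, ?_⟩
  have hlam3 : (fun i => lam i ^ 3 - lamc ^ 3) =O[l] e :=
    ((hasDerivAt_pow 3 lamc).isBigO_sub.comp_tendsto hlam).trans hlamO
  have hκ1 : (fun i => κ i ^ 2) =O[l] fun _ => (1 : ℝ) := by
    refine IsBigO.of_bound (C ^ 2) ?_
    filter_upwards [h] with i hi
    rw [norm_pow, norm_one, mul_one]
    have := hi.2.2.2
    gcongr
  have hκ2 : (fun i => κ i ^ 2 - κc ^ 2) =O[l] e := by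
    have h1 : (fun i => Dc⁻¹ * (2 * (lam i ^ 3 - lamc ^ 3) - κ i ^ 2 * (D i - Dc))) =O[l] e := by
      refine IsBigO.const_mul_left (IsBigO.sub (hlam3.const_mul_left 2) ?_) _
      simpa using hκ1.mul (hEO fun n => n * (n - 1))
    refine h1.congr' ?_ EventuallyEq.rfl
    filter_upwards [heq] with i hi
    have h2 := hi.2.2
    change D i * κ i ^ 2 = _ at h2
    field_simp
    linear_combination c2 - h2
  -- Knowing `κ²` leaves the sign open, and only `|κ|` is needed. Dividing by `|κ| + |κc| ≥ |κc|`
  -- keeps the rate.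
  have hκc0 : 0 < ‖κc‖ := norm_pos_iff.2 hκc
  refine IsBigO.trans (IsBigO.of_bound ‖κc‖⁻¹ (Eventually.of_forall fun i => ?_)) hκ2
  rw [inv_mul_eq_div, le_div_iff₀ hκc0, Real.norm_eq_abs]
  have h1 : |‖κ i ^ 2‖ - ‖κc ^ 2‖| ≤ ‖κ i ^ 2 - κc ^ 2‖ := abs_norm_sub_norm_le _ _
  rw [norm_pow, norm_pow] at h1
  have h2 : ‖κ i‖ ^ 2 - ‖κc‖ ^ 2 = (‖κ i‖ - ‖κc‖) * (‖κ i‖ + ‖κc‖) := by ring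
  rw [h2, abs_mul, abs_of_nonneg (by positivity : 0 ≤ ‖κ i‖ + ‖κc‖)] at h1
  have h3 : |‖κ i‖ - ‖κc‖| * ‖κc‖ ≤ |‖κ i‖ - ‖κc‖| * (‖κ i‖ + ‖κc‖) := by
    gcongr
    linarith [norm_nonneg (κ i)]
  exact h3.trans h1

end PolynomialLeaf

/-! ### Rank-one spikes in matrices on `ℓ²` -/

theorem summable_inv_succ_sq : Summable fun j : ℕ => ((j + 1 : ℝ) ^ 2)⁻¹ := by
  have := (summable_nat_add_iff 1).2 (Real.summable_nat_pow_inv (p := 2) |>.2 one_lt_two)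
  simpa using this

theorem summable_inv_succ_mul_sqrt : Summable fun j : ℕ => ((j + 1 : ℝ) * √(j + 1))⁻¹ := by
  have h := (summable_nat_add_iff 1).2
    (Real.summable_nat_rpow_inv (p := 3 / 2) |>.2 (by norm_num))
  refine h.congr fun j => ?_
  push_cast
  have h0 : (0 : ℝ) < j + 1 := by positivity
  rw [show (3 / 2 : ℝ) = 1 + 1 / 2 by norm_num, Real.rpow_add h0, Real.rpow_one, ← Real.sqrt_eq_rpow]

theorem memlp_two_of_summable_sq {f : ℕ → ℂ} (h : Summable fun j => ‖f j‖ ^ 2) : Memℓp f 2 := by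
  refine memℓp_gen ?_
  simpa using h

theorem norm_ellTwo_le_of_sq_le {f : EllTwo} {c : ℝ} (hc : 0 ≤ c) (g : ℕ → ℝ) (hg : Summable g)
    (hf : ∀ j, ‖f j‖ ^ 2 ≤ g j) (hgc : ∑' j, g j ≤ c ^ 2) : ‖f‖ ≤ c := by
  refine le_of_sq_le_sq ?_ hc
  rw [ellTwo_norm_sq]
  refine le_trans (Summable.tsum_le_tsum hf ?_ hg) hgc
  exact Summable.of_nonneg_of_le (fun j => by positivity) hf hg

theorem norm_ellTwo_le_tsum {f : EllTwo} {g : ℕ → ℝ} (hg : Summable g) (hf : ∀ j, ‖f j‖ ≤ g j) :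
    ‖f‖ ≤ ∑' j, g j := by
  have hs := lp.hasSum_single (p := 2) (by norm_num) f
  rw [← hs.tsum_eq]
  refine tsum_of_norm_bounded hg.hasSum fun j => ?_
  rw [lp.norm_single (by norm_num)]
  exact hf j

/-- A matrix which is a rank-one matrix `b_j conj(d_k)` up to `O(m_k / (j + 1))` defines a bounded
operator which is a rank-one operator up to a bounded one. -/
theorem exists_spike_decomposition : ∃ c : ℝ, 0 < c ∧ ∀ (v : ℕ → ℕ → ℂ) (b₀ d₀ : ℕ → ℂ) (m : ℕ → ℝ),
    Summable m → (∀ j, ‖b₀ j‖ ≤ (√(j + 1 : ℝ))⁻¹) → (Summable fun j => ‖b₀ j‖ ^ 2) →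
    (∀ k, ‖d₀ k‖ ≤ m k) →
    (∀ j k, ‖v j k - b₀ j * (starRingEnd ℂ) (d₀ k)‖ ≤ m k * (j + 1 : ℝ)⁻¹) →
    ∃ (V B : EllTwo →L[ℂ] EllTwo) (b d : EllTwo),
      (∀ k j : ℕ, (V (lp.single 2 k (1 : ℂ))) j = v j k) ∧ (∀ j, b j = b₀ j) ∧ (∀ k, d k = d₀ k) ∧
      (∀ u, V u = B u + inner ℂ d u • b) ∧ ‖B‖ ≤ c * ∑' k, m k ∧
      (∀ u, ‖inner ℂ b (B u)‖ ≤ (c * ∑' k, m k) * ‖u‖) ∧ ‖d‖ ≤ c * ∑' k, m k := by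
  set c₁ := ∑' j : ℕ, ((j + 1 : ℝ) ^ 2)⁻¹ with hc₁
  set c₂ := ∑' j : ℕ, ((j + 1 : ℝ) * √(j + 1))⁻¹ with hc₂
  have hc₁0 : 0 ≤ c₁ := tsum_nonneg fun j => by positivity
  have hc₂0 : 0 ≤ c₂ := tsum_nonneg fun j => by positivity
  refine ⟨c₁ + c₂ + 1, by positivity, fun v b₀ d₀ m hm hb hbs hd hv => ?_⟩
  have hm0 : ∀ k, 0 ≤ m k := fun k => (norm_nonneg _).trans (hd k)
  have hM0 : 0 ≤ ∑' k, m k := tsum_nonneg hm0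
  have hcolsq : ∀ k j, ‖v j k - b₀ j * (starRingEnd ℂ) (d₀ k)‖ ^ 2 ≤
      m k ^ 2 * ((j + 1 : ℝ) ^ 2)⁻¹ := fun k j => by
    calc _ ≤ (m k * (j + 1 : ℝ)⁻¹) ^ 2 := by gcongr; exact hv j k
      _ = _ := by rw [mul_pow, inv_pow]
  have hcolmem : ∀ k, Memℓp (fun j => v j k - b₀ j * (starRingEnd ℂ) (d₀ k)) 2 := fun k =>
    memlp_two_of_summable_sq (Summable.of_nonneg_of_le (fun j => by positivity) (hcolsq k)
      (summable_inv_succ_sq.mul_left _))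
  set col : ℕ → EllTwo := fun k => ⟨fun j => v j k - b₀ j * (starRingEnd ℂ) (d₀ k), hcolmem k⟩ with hcol
  have hcolj : ∀ k j, col k j = v j k - b₀ j * (starRingEnd ℂ) (d₀ k) := fun k j => rfl
  set b : EllTwo := ⟨b₀, memlp_two_of_summable_sq hbs⟩ with hbdef
  have hbj : ∀ j, b j = b₀ j := fun j => rfl
  have hdmem : Memℓp d₀ 2 := by
    refine memlp_two_of_summable_sq (Summable.of_nonneg_of_le (fun j => by positivity) (fun k => ?_)
      (hm.mul_left (∑' k, m k)))
    have h1 : m k ≤ ∑' k, m k := hm.le_tsum k fun j _ => hm0 j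
    calc ‖d₀ k‖ ^ 2 ≤ m k * m k := by rw [← sq]; gcongr; exact hd k
      _ ≤ _ := by gcongr; exact hm0 k
  set d : EllTwo := ⟨d₀, hdmem⟩ with hddef
  have hdj : ∀ j, d j = d₀ j := fun j => rfl
  have hcoln : ∀ k, ‖col k‖ ≤ (c₁ + 1) * m k := fun k => by
    refine norm_ellTwo_le_of_sq_le (mul_nonneg (by positivity) (hm0 k)) _
      (summable_inv_succ_sq.mul_left (m k ^ 2)) (fun j => hcolsq k j) ?_
    rw [tsum_mul_left, ← hc₁, mul_pow, mul_comm]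
    gcongr
    nlinarith
  -- The pairing is dominated by `∑ (j+1)^{-1/2} (j+1)^{-1}`, whatever the norm of `b`.
  have hinner : ∀ k, ‖inner ℂ b (col k)‖ ≤ c₂ * m k := fun k => by
    rw [lp.inner_eq_tsum]
    refine tsum_of_norm_bounded (g := fun j : ℕ => ((j + 1 : ℝ) * √(j + 1))⁻¹ * m k) ?_ fun j => ?_
    · exact summable_inv_succ_mul_sqrt.hasSum.mul_right _
    · refine (norm_inner_le_norm _ _).trans ?_
      rw [hbj, hcolj]
      calc _ ≤ (√(j + 1 : ℝ))⁻¹ * (m k * (j + 1 : ℝ)⁻¹) := by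
            gcongr
            · exact hb j
            · exact hv j k
        _ = _ := by rw [mul_inv]; ring
  obtain ⟨B, hB1, hB2, hB3⟩ := exists_clm_of_columns col _ (hm.mul_left (c₁ + 1)) hcoln
  refine ⟨B + (innerSL ℂ d).smulRight b, B, b, d, fun k j => ?_, hbj, hdj, fun u => ?_, ?_, ?_, ?_⟩
  · rw [add_apply, hB1, ContinuousLinearMap.smulRight_apply, innerSL_apply_apply]
    have h1 : inner ℂ d (lp.single 2 k (1 : ℂ) : EllTwo) = (starRingEnd ℂ) (d₀ k) := by
      rw [lp.inner_single_right, hdj]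
      simp
    rw [h1]
    show col k j + (starRingEnd ℂ) (d₀ k) * b j = _
    rw [hcolj, hbj]; ring
  · rfl
  · rw [tsum_mul_left] at hB2
    refine hB2.trans ?_
    gcongr
    linarith
  · intro u
    refine (hB3 b u _ (hm.mul_left c₂) hinner).trans ?_
    rw [tsum_mul_left]
    gcongr
    linarith
  · refine (norm_ellTwo_le_tsum hm fun k => by rw [hdj]; exact hd k).trans ?_
    nlinarith

theorem hasSum_inv_pow_div_succ {r : ℝ} (h0 : 0 < r) (h1 : r < 1) :
    HasSum (fun j : ℕ => r ^ j * (j + 1 : ℝ)⁻¹) (-Real.log (1 - r) / r) := by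
  have h := (Real.hasSum_pow_div_log_of_abs_lt_one (x := r) (by rwa [abs_of_pos h0])).div_const r
  refine h.congr_fun fun j => ?_
  rw [pow_succ]
  field_simp

/-! ### The columns of the renormalized synthesis map -/

/-- Here `J = j + 1` and `μ = j - k + 1`. Replacing `p_j / μ^{3/2}` by `s / √J` separates the
variables `j` and `k`; the loss is polynomial in `k`, which the weights absorb. -/
theorem abs_div_mul_sqrt_sub_le {p s μ J k : ℝ} (hs : 0 ≤ s) (hμ : 1 ≤ μ) (hk : 0 ≤ k)
    (hJ : J = μ + k) (hp1 : s * (J - 1) ≤ p) (hp2 : p ≤ s * J) :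
    |p / (μ * √μ) - s / √J| ≤ 3 * s * (k + 1) ^ 2 / J := by
  have hJ1 : 1 ≤ J := by linarith
  set a := √μ with ha
  set b := √J with hb
  have ha2 : μ = a ^ 2 := (Real.sq_sqrt (by linarith)).symm
  have hb2 : J = b ^ 2 := (Real.sq_sqrt (by linarith)).symm
  have ha1 : 1 ≤ a := Real.one_le_sqrt.2 hμ
  have hab : a ≤ b := Real.sqrt_le_sqrt (by linarith)
  have hb1 : 1 ≤ b := ha1.trans hab
  have ha0 : 0 < a := by linarith
  have hb0 : 0 < b := by linarith
  have hk2 : k = b ^ 2 - a ^ 2 := by linarith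
  have hbk : b ^ 2 ≤ a ^ 2 * (k + 1) := by nlinarith
  rw [abs_le]
  constructor
  · have h1 : s * (J - 1) / (b ^ 2 * b) ≤ p / (μ * a) := by
      rw [ha2]
      have : 0 ≤ p := le_trans (mul_nonneg hs (by linarith)) hp1
      gcongr
    have h2 : s / b - s * (J - 1) / (b ^ 2 * b) = s / (J * b) := by
      rw [hb2]; field_simp; ring
    have h3 : s / (J * b) ≤ s / J := by
      gcongr
      nlinarith
    have h4 : s / J ≤ 3 * s * (k + 1) ^ 2 / J := by
      gcongr
      nlinarith [mul_nonneg hs (show 0 ≤ 3 * (k + 1) ^ 2 - 1 by nlinarith)]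
    linarith
  · have h1 : p / (μ * a) ≤ s * b ^ 2 / (a ^ 2 * a) := by
      rw [ha2, ← hb2]; gcongr
    have h2 : s * b ^ 2 / (a ^ 2 * a) - s / b ≤ 3 * s * k / a ^ 2 := by
      rw [div_sub_div _ _ (by positivity) (by positivity), div_le_div_iff₀ (by positivity) (by positivity)]
      have h5 : b ^ 3 - a ^ 3 ≤ 3 * b * k := by rw [hk2]; nlinarith [mul_nonneg (sub_nonneg.2 hab) (sq_nonneg b), mul_nonneg (sub_nonneg.2 hab) (mul_nonneg ha0.le (sub_nonneg.2 hab)), mul_nonneg (sub_nonneg.2 hab) (mul_nonneg ha0.le hb0.le)]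
      have h6 : 3 * b * k ≤ 3 * b * k * a := by
        have : 0 ≤ 3 * b * k := by positivity
        nlinarith
      have h7 : s * a ^ 2 * (b ^ 3 - a ^ 3) ≤ s * a ^ 2 * (3 * b * k * a) := by
        gcongr
        linarith
      nlinarith
    have h3 : 3 * s * k / a ^ 2 ≤ 3 * s * (k + 1) ^ 2 / J := by
      rw [div_le_div_iff₀ (by positivity) (by linarith), hb2]
      calc 3 * s * k * b ^ 2 ≤ 3 * s * (k + 1) * (a ^ 2 * (k + 1)) := by gcongr; linarith
        _ = _ := by ring
    linarith

/-! ### Weights, spike profiles, and the rank-one approximation of the columns. -/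

namespace PolynomialLeaf

theorem one_le_blockIndex {N : ℕ} (S : PolynomialLeaf N) {q : ℕ} (hq : 1 ≤ q) (k : ℕ) :
    1 ≤ S.blockIndex q k := hq.trans (Nat.le_add_right _ _)

theorem mul_le_blockIndex {N : ℕ} (S : PolynomialLeaf N) (q k : ℕ) :
    S.symIndex * k ≤ S.blockIndex q k := by
  rw [blockIndex, mul_comm]; exact Nat.le_add_left _ _

theorem blockIndex_le {N : ℕ} (S : PolynomialLeaf N) {q : ℕ} (hq : q ≤ S.symIndex) (k : ℕ) :
    (S.blockIndex q k : ℝ) ≤ S.symIndex * (k + 1) := by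
  rw [blockIndex]; push_cast
  have : (q : ℝ) ≤ S.symIndex := by exact_mod_cast hq
  linarith

theorem pow_blockIndex_le_weight {N : ℕ} (S : PolynomialLeaf N) {α β : ℝ} (hα : 0 < α)
    (hβ : 0 < β) {q : ℕ} (hq : 1 ≤ q) (k : ℕ) : α ^ S.blockIndex q k ≤ S.weight α β q k := by
  have h1 : (1 : ℝ) ≤ (S.blockIndex q k : ℝ) ^ (3 / 2 + β) :=
    Real.one_le_rpow (by exact_mod_cast S.one_le_blockIndex hq k) (by linarith)
  rw [weight]
  exact le_mul_of_one_le_left (by positivity) h1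

theorem weight_pos {N : ℕ} (S : PolynomialLeaf N) {α β : ℝ} (hα : 0 < α)
    (hβ : 0 < β) {q : ℕ} (hq : 1 ≤ q) (k : ℕ) : 0 < S.weight α β q k :=
  lt_of_lt_of_le (by positivity) (S.pow_blockIndex_le_weight hα hβ hq k)

/-- The geometric decay of the columns. -/
theorem pow_mul_pow_div_weight_le {N : ℕ} (S : PolynomialLeaf N) {α β A R θ : ℝ} (hA : 0 < A)
    (hAα : A ≤ α) (hβ : 0 < β) {q : ℕ} (hq : 1 ≤ q) (hR : 0 ≤ R)
    (hθ : R * (A / α) ^ S.symIndex ≤ θ) (k : ℕ) :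
    R ^ k * (A ^ S.blockIndex q k / S.weight α β q k) ≤ θ ^ k := by
  have hα : 0 < α := hA.trans_le hAα
  have h1 : A ^ S.blockIndex q k / S.weight α β q k ≤ ((A / α) ^ S.symIndex) ^ k := by
    calc _ ≤ A ^ S.blockIndex q k / α ^ S.blockIndex q k := by
          gcongr; exact S.pow_blockIndex_le_weight hα hβ hq k
      _ = (A / α) ^ S.blockIndex q k := by rw [div_pow]
      _ ≤ (A / α) ^ (S.symIndex * k) :=
          pow_le_pow_of_le_one (by positivity) ((div_le_one hα).2 hAα) (S.mul_le_blockIndex q k)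
      _ = _ := pow_mul _ _ _
  calc _ ≤ R ^ k * ((A / α) ^ S.symIndex) ^ k := by gcongr
    _ = (R * (A / α) ^ S.symIndex) ^ k := (mul_pow _ _ _).symm
    _ ≤ _ := by gcongr

/-- The spike profile at a dominant point `x` that need not lie on the unit circle. -/
noncomputable def spike {N : ℕ} (S : PolynomialLeaf N) (α β : ℝ) (q : ℕ) (x lam κ : ℂ) (k : ℕ) : ℂ :=
  (starRingEnd ℂ) ((S.symIndex : ℂ) * S.criticalAmplitude lam κ (S.blockIndex q k) *
    (x ^ S.symIndex) ^ k / ((Real.sqrt (S.blockIndex q k) : ℂ) * (S.weight α β q k : ℂ)))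

/-- The modulus of the spike profile, without the factors depending on the branch data. -/
noncomputable def spikeWeight {N : ℕ} (S : PolynomialLeaf N) (α β : ℝ) (q k : ℕ) : ℝ :=
  S.symIndex * ((Real.sqrt S.symIndex)⁻¹ / (2 * Real.sqrt Real.pi)) * S.blockIndex q k /
    (Real.sqrt (S.blockIndex q k) * S.weight α β q k)

theorem norm_criticalAmplitude {N : ℕ} (S : PolynomialLeaf N) (lam κ : ℂ) (p : ℕ) :
    ‖S.criticalAmplitude lam κ p‖ =
      (Real.sqrt S.symIndex)⁻¹ / (2 * Real.sqrt Real.pi) * p * ‖κ‖ * ‖lam‖ ^ (p - 1) := by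
  have h : (0 : ℝ) ≤ (Real.sqrt S.symIndex)⁻¹ / (2 * Real.sqrt Real.pi) := by positivity
  rw [criticalAmplitude, norm_mul, norm_mul, norm_mul, norm_neg, Complex.norm_real,
    Real.norm_of_nonneg h, norm_pow, Complex.norm_natCast]

theorem norm_spike {N : ℕ} (S : PolynomialLeaf N) {α β : ℝ} (hα : 0 < α)
    (hβ : 0 < β) {q : ℕ} (hq : 1 ≤ q) (x lam κ : ℂ) (k : ℕ) :
    ‖S.spike α β q x lam κ k‖ = S.spikeWeight α β q k *
      (‖κ‖ * ‖x ^ S.symIndex‖ ^ k * ‖lam‖ ^ (S.blockIndex q k - 1)) := by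
  have hw := S.weight_pos hα hβ hq k
  rw [spike, RCLike.norm_conj, norm_div, norm_mul, norm_mul, norm_mul, norm_criticalAmplitude,
    spikeWeight, Complex.norm_natCast, norm_pow, Complex.norm_real, Complex.norm_real,
    Real.norm_of_nonneg (Real.sqrt_nonneg _), Real.norm_of_nonneg hw.le]
  ring

theorem norm_criticalSpike {N : ℕ} (S : PolynomialLeaf N) {α β : ℝ} (hα : 0 < α)
    (hβ : 0 < β) {q : ℕ} (hq : 1 ≤ q) (x lam κ : ℂ) (k : ℕ) :
    ‖S.criticalSpike α β q x lam κ k‖ = S.spikeWeight α β q k *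
      (‖κ‖ * ‖lam‖ ^ (S.blockIndex q k - 1)) := by
  have hw := S.weight_pos hα hβ hq k
  have he : ‖Complex.exp (-(Complex.I * k * Complex.arg (x ^ S.symIndex)))‖ = 1 := by
    rw [Complex.norm_exp]; simp
  rw [criticalSpike, norm_div, norm_mul, norm_mul, he, RCLike.norm_conj, norm_div,
    norm_criticalAmplitude, spikeWeight, Complex.norm_natCast, Complex.norm_real, Complex.norm_real,
    Real.norm_of_nonneg (Real.sqrt_nonneg _), Real.norm_of_nonneg hw.le]
  field_simp

theorem spikeWeight_nonneg {N : ℕ} (S : PolynomialLeaf N) {α β : ℝ} (hα : 0 < α)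
    (hβ : 0 < β) {q : ℕ} (hq : 1 ≤ q) (k : ℕ) : 0 ≤ S.spikeWeight α β q k := by
  have hw := S.weight_pos hα hβ hq k
  rw [spikeWeight]; positivity

theorem spikeWeight_pos {N : ℕ} (S : PolynomialLeaf N) {α β : ℝ} (hα : 0 < α)
    (hβ : 0 < β) {q : ℕ} (hq : 1 ≤ q) (hqs : q ≤ S.symIndex) (k : ℕ) :
    0 < S.spikeWeight α β q k := by
  have hw := S.weight_pos hα hβ hq k
  have hs : 0 < S.symIndex := by omega
  have hP := S.one_le_blockIndex hq k
  rw [spikeWeight]; positivity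

theorem half_inv_sqrt_pi_le : (1 : ℝ) / (2 * Real.sqrt Real.pi) ≤ 1 := by
  have : (1 : ℝ) ≤ Real.sqrt Real.pi := Real.one_le_sqrt.2 (by linarith [Real.pi_gt_three])
  rw [div_le_one (by positivity)]; linarith

theorem spikeWeight_mul_le {N : ℕ} (S : PolynomialLeaf N) {α β A R θ : ℝ} (hA : 0 < A)
    (hAα : A ≤ α) (hβ : 0 < β) {q : ℕ} (hq : 1 ≤ q) (hqs : q ≤ S.symIndex) (hR : 0 ≤ R)
    (hθ : R * (A / α) ^ S.symIndex ≤ θ) (k : ℕ) :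
    S.spikeWeight α β q k * (A ^ (S.blockIndex q k - 1) * R ^ k) ≤
      S.symIndex ^ 2 * A⁻¹ * ((k + 1 : ℝ) * θ ^ k) := by
  have hα : 0 < α := hA.trans_le hAα
  have hw := S.weight_pos hα hβ hq k
  have hP := S.one_le_blockIndex hq k
  have hP' : (1 : ℝ) ≤ S.blockIndex q k := by exact_mod_cast hP
  have hs : (1 : ℝ) ≤ S.symIndex := by exact_mod_cast hq.trans hqs
  have h1 : (Real.sqrt S.symIndex)⁻¹ / (2 * Real.sqrt Real.pi) ≤ 1 := by
    rw [div_eq_mul_one_div]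
    exact mul_le_one₀ (inv_le_one_of_one_le₀ (Real.one_le_sqrt.2 hs)) (by positivity)
      half_inv_sqrt_pi_le
  have h2 : S.spikeWeight α β q k ≤ S.symIndex * (S.symIndex * (k + 1)) / S.weight α β q k := by
    rw [spikeWeight, ← div_div]
    gcongr
    rw [div_le_iff₀ (by positivity)]
    calc _ ≤ S.symIndex * 1 * (S.symIndex * (k + 1 : ℝ)) := by
          gcongr; exact S.blockIndex_le hqs k
      _ ≤ S.symIndex * (S.symIndex * (k + 1 : ℝ)) * 1 := by rw [mul_one, mul_one]
      _ ≤ _ := by gcongr; exact Real.one_le_sqrt.2 hP'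
  have h3 : A ^ (S.blockIndex q k - 1) = A⁻¹ * A ^ S.blockIndex q k := by
    obtain ⟨n, hn⟩ : ∃ n, S.blockIndex q k = n + 1 := ⟨S.blockIndex q k - 1, by omega⟩
    rw [hn, Nat.add_sub_cancel, pow_succ]; field_simp
  calc _ ≤ S.symIndex * (S.symIndex * (k + 1)) / S.weight α β q k *
        (A ^ (S.blockIndex q k - 1) * R ^ k) := by gcongr
    _ = S.symIndex ^ 2 * A⁻¹ * ((k + 1 : ℝ) *
        (R ^ k * (A ^ S.blockIndex q k / S.weight α β q k))) := by rw [h3]; field_simp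
    _ ≤ _ := by gcongr; exact S.pow_mul_pow_div_weight_le hA hAα hβ hq hR hθ k

-- For `j ≥ k` the error splits into the amplitude times the replacement error of `p_j / μ^{3/2}`,
-- and `p_j` times the coefficient error, both `O((k+1)² / (j+1))` in the unit `(p+1)² A^p`. For `j
-- < k` the column vanishes but the rank-one term does not; there `1 ≤ (k+1)² / (j+1)` makes it
-- admissible as an error.
set_option maxHeartbeats 1000000 in
theorem HasStolzContinuation.norm_gramVector_div_sub_le {N : ℕ} {S : PolynomialLeaf N}
    {ζ : Fin N → ℂ} {x lam κ : ℂ} {W : ℂ → ℂ} {c ε M C : ℝ}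
    (h : S.HasStolzContinuation ζ x lam κ W c ε M C) (hc : 0 < c) {A K α β θ : ℝ} (hA : 0 < A)
    (hAα : A ≤ α) (hβ : 0 < β) (hK : 0 ≤ K) (hlam : ‖lam‖ ≤ A) (hx : 1 ≤ ‖x‖) {q : ℕ} (hq : 1 ≤ q)
    (hqs : q ≤ S.symIndex) (hθ : ‖x ^ S.symIndex‖ * (A / α) ^ S.symIndex ≤ θ)
    (hcoeff : ∀ p m : ℕ, ‖taylorCoeff (fun u => W u ^ p) m + p * lam ^ (p - 1) *
      (((Real.sqrt S.symIndex : ℝ) : ℂ)⁻¹ * κ) *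
      ((1 / (2 * √Real.pi * ((m + 1) * √(m + 1))) : ℝ) : ℂ)‖ ≤
        K * ((p + 1 : ℝ) ^ 2 * A ^ p) / (m + 1 : ℝ) ^ 2) (j k : ℕ) :
    ‖S.gramVector ζ q k j / (S.weight α β q k : ℂ) -
      (((x ^ S.symIndex)⁻¹) ^ j * ((√(j + 1 : ℝ) : ℝ) : ℂ)⁻¹) *
        (starRingEnd ℂ) (S.spike α β q x lam κ k)‖ ≤
      S.symIndex * (3 * (C * A⁻¹) + K) * (S.symIndex + 1) ^ 2 * ((k + 1 : ℝ) ^ 4 * θ ^ k) *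
        (j + 1 : ℝ)⁻¹ := by
  have hα : 0 < α := hA.trans_le hAα
  have hw := S.weight_pos hα hβ hq k
  have hP := S.one_le_blockIndex hq k
  have hPle := S.blockIndex_le hqs k
  have hdecay := S.pow_mul_pow_div_weight_le (α := α) (β := β) hA hAα hβ hq
    (norm_nonneg (x ^ S.symIndex)) hθ k
  have hamp : ‖S.criticalAmplitude lam κ (S.blockIndex q k)‖ ≤
      C * A⁻¹ * ((S.blockIndex q k + 1 : ℝ) ^ 2 * A ^ S.blockIndex q k) := by
    have h1 : S.criticalAmplitude lam κ (S.blockIndex q k) =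
        -((((1 : ℝ) / (2 * Real.sqrt Real.pi) : ℝ) : ℂ)) *
          ((((Real.sqrt S.symIndex : ℝ) : ℂ)⁻¹ * κ) *
            ((S.blockIndex q k : ℂ) * lam ^ (S.blockIndex q k - 1))) := by
      rw [criticalAmplitude]; push_cast; ring
    have h2 := natCast_mul_norm_pow_pred_le hA hlam (S.blockIndex q k)
    have hC : 0 ≤ C := (norm_nonneg _).trans h.stolz.norm_k_le
    rw [h1, norm_mul, norm_neg, Complex.norm_real, Real.norm_of_nonneg (by positivity), norm_mul]
    calc _ ≤ 1 * (C * (A⁻¹ * ((S.blockIndex q k + 1 : ℝ) ^ 2 * A ^ S.blockIndex q k))) := by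
          gcongr
          · exact half_inv_sqrt_pi_le
          · exact h.stolz.norm_k_le
      _ = _ := by ring
  have hC : 0 ≤ C := (norm_nonneg _).trans h.stolz.norm_k_le
  set ξ := x ^ S.symIndex with hξ
  have hR : 1 ≤ ‖ξ‖ := by rw [hξ, norm_pow]; exact one_le_pow₀ hx
  have hξ0 : ξ ≠ 0 := by intro h0; rw [h0, norm_zero] at hR; linarith
  set P := S.blockIndex q k with hPdef
  set w := S.weight α β q k with hwdef
  set a := S.criticalAmplitude lam κ P with ha
  set E : ℝ := (P + 1 : ℝ) ^ 2 * A ^ P with hE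
  have hE0 : 0 ≤ E := by positivity
  have hP1 : (1 : ℝ) ≤ P := by exact_mod_cast hP
  have hsqP : 1 ≤ √(P : ℝ) := Real.one_le_sqrt.2 hP1
  have hs : (1 : ℝ) ≤ S.symIndex := by exact_mod_cast hq.trans hqs
  have hθ0 : 0 ≤ θ := le_trans (by positivity) hθ
  have hfin : ‖ξ‖ ^ k * (E / w) ≤ (S.symIndex + 1) ^ 2 * ((k + 1 : ℝ) ^ 2 * θ ^ k) := by
    calc ‖ξ‖ ^ k * (E / w) = (P + 1 : ℝ) ^ 2 * (‖ξ‖ ^ k * (A ^ P / w)) := by rw [hE]; ring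
      _ ≤ ((S.symIndex + 1) * (k + 1 : ℝ)) ^ 2 * θ ^ k := by
          gcongr
          linarith
      _ = _ := by ring
  have hJ : (0 : ℝ) < j + 1 := by positivity
  have hsq : ((√(P : ℝ) : ℝ) : ℂ) ≠ 0 := by
    exact_mod_cast (by linarith : √(P : ℝ) ≠ 0)
  have hwC : (w : ℂ) ≠ 0 := by exact_mod_cast hw.ne'
  have hspike : (starRingEnd ℂ) (S.spike α β q x lam κ k) =
      (S.symIndex : ℂ) * a * ξ ^ k / (((√(P : ℝ) : ℝ) : ℂ) * (w : ℂ)) := by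
    rw [spike, Complex.conj_conj]
  suffices hmain : ‖S.gramVector ζ q k j / (w : ℂ) -
      ((ξ⁻¹) ^ j * ((√(j + 1 : ℝ) : ℝ) : ℂ)⁻¹) * (starRingEnd ℂ) (S.spike α β q x lam κ k)‖ ≤
      S.symIndex * (3 * (C * A⁻¹) + K) * (k + 1 : ℝ) ^ 2 * (‖ξ‖ ^ k * (E / w)) * (j + 1 : ℝ)⁻¹ by
    refine hmain.trans ?_
    calc _ ≤ S.symIndex * (3 * (C * A⁻¹) + K) * (k + 1 : ℝ) ^ 2 *
          ((S.symIndex + 1) ^ 2 * ((k + 1 : ℝ) ^ 2 * θ ^ k)) * (j + 1 : ℝ)⁻¹ := by gcongr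
      _ = _ := by ring
  rw [hspike]
  rcases le_or_gt k j with hkj | hkj
  · obtain ⟨m, rfl⟩ : ∃ m, j = k + m := ⟨j - k, by omega⟩
    have hco := hcoeff P m
    set t := taylorCoeff (fun u => W u ^ P) m with ht
    set μ : ℝ := m + 1 with hμ
    have hμ1 : 1 ≤ μ := by rw [hμ]; linarith [Nat.cast_nonneg (α := ℝ) m]
    set e : ℂ := t - a * ((1 / (μ * √μ) : ℝ) : ℂ) with he
    have hen : ‖e‖ ≤ K * E / μ ^ 2 := by
      refine le_of_eq_of_le ?_ hco
      congr 1
      rw [he, sub_eq_add_neg]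
      congr 1
      rw [ha, criticalAmplitude]
      push_cast
      field_simp
    have hg : S.gramVector ζ q k (k + m) =
        (S.blockIndex q (k + m) : ℂ) / ((√(P : ℝ) : ℝ) : ℂ) * ((ξ⁻¹) ^ m * t) := by
      rw [gramVector, if_pos (Nat.le_add_right _ _), Nat.add_sub_cancel_left, h.raney_eq hc]
    set p := S.blockIndex q (k + m) with hp
    have hpk : p = q + (k + m) * S.symIndex := rfl
    have hJm : ((k + m : ℕ) : ℝ) + 1 = μ + k := by rw [hμ]; push_cast; ring
    have hkey := abs_div_mul_sqrt_sub_le (p := p) (s := S.symIndex) (μ := μ)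
      (J := ((k + m : ℕ) : ℝ) + 1) (k := k) (by linarith) hμ1 (by positivity) hJm
      (by rw [hpk]; push_cast; nlinarith [Nat.cast_nonneg (α := ℝ) q]) (S.blockIndex_le hqs _)
    set J : ℝ := ((k + m : ℕ) : ℝ) + 1 with hJd
    have heq : S.gramVector ζ q k (k + m) / (w : ℂ) -
        ((ξ⁻¹) ^ (k + m) * ((√J : ℝ) : ℂ)⁻¹) *
          ((S.symIndex : ℂ) * a * ξ ^ k / (((√(P : ℝ) : ℝ) : ℂ) * (w : ℂ))) =
        (ξ⁻¹) ^ m * ((√(P : ℝ) : ℝ) : ℂ)⁻¹ * (w : ℂ)⁻¹ *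
          (a * ((p / (μ * √μ) - S.symIndex / √J : ℝ) : ℂ) + (p : ℂ) * e) := by
      rw [hg, he, pow_add]
      have h1 : (ξ⁻¹) ^ k * ξ ^ k = 1 := by rw [← mul_pow, inv_mul_cancel₀ hξ0, one_pow]
      have h2 : (ξ⁻¹) ^ k * (ξ⁻¹) ^ m * ((√J : ℝ) : ℂ)⁻¹ *
          ((S.symIndex : ℂ) * a * ξ ^ k / (((√(P : ℝ) : ℝ) : ℂ) * (w : ℂ))) =
          ((ξ⁻¹) ^ k * ξ ^ k) * ((ξ⁻¹) ^ m * ((√J : ℝ) : ℂ)⁻¹ *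
          ((S.symIndex : ℂ) * a / (((√(P : ℝ) : ℝ) : ℂ) * (w : ℂ)))) := by ring
      rw [h2, h1]
      push_cast
      ring
    rw [heq, norm_mul, norm_mul, norm_mul, norm_inv, norm_inv, Complex.norm_real, Complex.norm_real,
      Real.norm_of_nonneg hw.le, Real.norm_of_nonneg (Real.sqrt_nonneg _), norm_pow, norm_inv]
    have hJμ : J ≤ μ * (k + 1) := by
      have := mul_le_mul_of_nonneg_right hμ1 (Nat.cast_nonneg (α := ℝ) k)
      rw [hJm, mul_add, mul_one]; linarith
    have hb1 : ‖a * ((p / (μ * √μ) - S.symIndex / √J : ℝ) : ℂ) + (p : ℂ) * e‖ ≤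
        S.symIndex * (3 * (C * A⁻¹) + K) * (k + 1 : ℝ) ^ 2 * E * J⁻¹ := by
      have hpe : ‖(p : ℂ) * e‖ ≤ S.symIndex * K * (k + 1 : ℝ) ^ 2 * E * J⁻¹ := by
        rw [norm_mul, Complex.norm_natCast]
        calc (p : ℝ) * ‖e‖ ≤ (S.symIndex * J) * (K * E / μ ^ 2) := by
              gcongr
              exact S.blockIndex_le hqs _
          _ = S.symIndex * K * E * (J / μ ^ 2) := by ring
          _ ≤ S.symIndex * K * E * ((k + 1) ^ 2 * J⁻¹) := by
              gcongr
              rw [← div_eq_mul_inv, div_le_div_iff₀ (by positivity) hJ]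
              calc J * J ≤ (μ * (k + 1)) * (μ * (k + 1)) := by gcongr
                _ = _ := by ring
          _ = _ := by ring
      calc _ ≤ ‖a * ((p / (μ * √μ) - S.symIndex / √J : ℝ) : ℂ)‖ + ‖(p : ℂ) * e‖ := norm_add_le _ _
        _ ≤ C * A⁻¹ * E * (3 * S.symIndex * (k + 1) ^ 2 / J) +
            S.symIndex * K * (k + 1 : ℝ) ^ 2 * E * J⁻¹ := by
            gcongr
            rw [norm_mul, Complex.norm_real]
            gcongr
            exact hkey
        _ = _ := by ring
    have hb2 : (‖ξ‖⁻¹) ^ m ≤ ‖ξ‖ ^ k :=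
      (pow_le_one₀ (by positivity) (inv_le_one_of_one_le₀ hR)).trans (one_le_pow₀ hR)
    have hb3 : (√(P : ℝ))⁻¹ ≤ 1 := inv_le_one_of_one_le₀ hsqP
    calc _ ≤ ‖ξ‖ ^ k * 1 * w⁻¹ *
          (S.symIndex * (3 * (C * A⁻¹) + K) * (k + 1 : ℝ) ^ 2 * E * J⁻¹) := by gcongr
      _ = _ := by ring
  · have hg : S.gramVector ζ q k j = 0 := by rw [gramVector, if_neg (by omega)]
    rw [hg, zero_div, zero_sub, norm_neg, norm_mul, norm_mul, norm_div, norm_mul, norm_mul, norm_mul,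
      norm_pow ξ⁻¹ j, norm_inv, norm_inv, norm_pow ξ k, Complex.norm_real, Complex.norm_real,
      Complex.norm_real, Complex.norm_natCast, Real.norm_of_nonneg hw.le,
      Real.norm_of_nonneg (Real.sqrt_nonneg _), Real.norm_of_nonneg (Real.sqrt_nonneg _)]
    have hjk : (j + 1 : ℝ) ≤ (k + 1 : ℝ) ^ 2 := by
      have : (j : ℝ) ≤ k := by exact_mod_cast hkj.le
      nlinarith [Nat.cast_nonneg (α := ℝ) k]
    have h1 : (‖ξ‖⁻¹) ^ j ≤ 1 := pow_le_one₀ (by positivity) (inv_le_one_of_one_le₀ hR)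
    have h2 : (√(j + 1 : ℝ))⁻¹ ≤ 1 :=
      inv_le_one_of_one_le₀ (Real.one_le_sqrt.2 (by linarith [Nat.cast_nonneg (α := ℝ) j]))
    have h3 : (1 : ℝ) ≤ (k + 1) ^ 2 * (j + 1 : ℝ)⁻¹ := by
      rw [← div_eq_mul_inv, le_div_iff₀ hJ]; linarith
    calc _ ≤ 1 * 1 * (S.symIndex * (C * A⁻¹ * E) * ‖ξ‖ ^ k / (1 * w)) := by gcongr
      _ ≤ (1 * 1 * (S.symIndex * (C * A⁻¹ * E) * ‖ξ‖ ^ k / (1 * w))) *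
          ((k + 1) ^ 2 * (j + 1 : ℝ)⁻¹) := le_mul_of_one_le_right (by positivity) h3
      _ = S.symIndex * (C * A⁻¹) * (k + 1 : ℝ) ^ 2 * (‖ξ‖ ^ k * (E / w)) * (j + 1 : ℝ)⁻¹ := by ring
      _ ≤ _ := by
          gcongr
          linarith [mul_nonneg hC (inv_nonneg.2 hA.le)]

end PolynomialLeaf

/-! ### Uniform level bounds and dependence of the spike on the branch data -/

theorem abs_pow_sub_pow_mul_le {a b A : ℝ} (ha : 0 ≤ a) (hb : 0 ≤ b) (haA : a ≤ A) (hbA : b ≤ A)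
    (n : ℕ) : |a ^ n - b ^ n| * A ≤ n * A ^ n * |a - b| := by
  have hA : 0 ≤ A := ha.trans haA
  have h := abs_pow_sub_pow_le a b n
  rcases n with _ | n
  · simp
  calc |a ^ (n + 1) - b ^ (n + 1)| * A
      ≤ (|a - b| * (n + 1 : ℕ) * max |a| |b| ^ (n + 1 - 1)) * A := by gcongr
    _ ≤ (|a - b| * (n + 1 : ℕ) * A ^ (n + 1 - 1)) * A := by
        gcongr
        exact max_le (by rwa [abs_of_nonneg ha]) (by rwa [abs_of_nonneg hb])
    _ = _ := by rw [Nat.add_sub_cancel, pow_succ]; ring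

theorem abs_mul_pow_mul_pow_sub_le {κ κc R l lc A C : ℝ} (k Q : ℕ) (hκ0 : 0 ≤ κ) (hκ : κ ≤ C)
    (hκc0 : 0 ≤ κc) (hκc : κc ≤ C) (hR : 1 ≤ R) (hl0 : 0 ≤ l) (hl : l ≤ A) (hlc0 : 0 ≤ lc)
    (hlc : lc ≤ A) (hA : 0 < A) :
    |κ * R ^ k * l ^ Q - κc * lc ^ Q| ≤
      A ^ Q * R ^ k * (|κ - κc| + C * k * (R - 1) + C * A⁻¹ * Q * |l - lc|) := by
  have h1 : |l ^ Q - lc ^ Q| ≤ Q * A ^ Q * |l - lc| * A⁻¹ := by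
    rw [← div_eq_mul_inv, le_div_iff₀ hA]
    exact abs_pow_sub_pow_mul_le hl0 hlc0 hl hlc Q
  have h2 : |R ^ k - 1| ≤ k * R ^ k * (R - 1) := by
    have h := abs_pow_sub_pow_mul_le (a := R) (b := 1) (by linarith) zero_le_one le_rfl hR k
    rw [one_pow, abs_of_nonneg (by linarith : (0 : ℝ) ≤ R - 1)] at h
    exact (le_mul_of_one_le_right (abs_nonneg _) hR).trans h
  have hC : 0 ≤ C := hκ0.trans hκ
  have hRk : 1 ≤ R ^ k := one_le_pow₀ hR
  have hlA : l ^ Q ≤ A ^ Q := by gcongr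
  have e : κ * R ^ k * l ^ Q - κc * lc ^ Q =
      (κ - κc) * R ^ k * l ^ Q + κc * (R ^ k - 1) * l ^ Q + κc * (l ^ Q - lc ^ Q) := by ring
  rw [e]
  refine (abs_add_le _ _).trans ((add_le_add_left (abs_add_le _ _) _).trans ?_)
  rw [abs_mul, abs_mul, abs_mul, abs_mul, abs_mul, abs_of_nonneg (by positivity : 0 ≤ R ^ k),
    abs_of_nonneg (by positivity : 0 ≤ l ^ Q), abs_of_nonneg hκc0]
  calc _ ≤ |κ - κc| * R ^ k * A ^ Q + C * (k * R ^ k * (R - 1)) * A ^ Q +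
        C * (Q * A ^ Q * |l - lc| * A⁻¹) * 1 := by
        rw [mul_one]; gcongr
    _ ≤ |κ - κc| * R ^ k * A ^ Q + C * (k * R ^ k * (R - 1)) * A ^ Q +
        C * (Q * A ^ Q * |l - lc| * A⁻¹) * R ^ k := by gcongr
    _ = _ := by ring

theorem summable_succ_pow_mul_pow {θ : ℝ} (h0 : 0 ≤ θ) (h1 : θ < 1) (n : ℕ) :
    Summable (fun k : ℕ => (k + 1 : ℝ) ^ n * θ ^ k) := by
  have h := summable_pow_mul_geometric_of_norm_lt_one n (r := θ) (by rwa [Real.norm_of_nonneg h0])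
  refine Summable.of_nonneg_of_le (fun k => by positivity) (fun k => ?_)
    ((h.mul_left (2 ^ n)).add (summable_geometric_of_lt_one h0 h1))
  rcases k with _ | k
  · simp
  · have : ((k + 1 : ℕ) + 1 : ℝ) ^ n ≤ 2 ^ n * ((k + 1 : ℕ) : ℝ) ^ n := by
      rw [← mul_pow]
      gcongr
      push_cast
      linarith [Nat.cast_nonneg (α := ℝ) k]
    have h2 : 0 ≤ θ ^ (k + 1) := by positivity
    nlinarith

/-! ### Dependence of the spike on the branch data, and uniform level bounds. -/

namespace PolynomialLeaf

theorem spikeWeight_mul_pow_le {N : ℕ} (S : PolynomialLeaf N) {α β A C R θ κ l : ℝ} (hA : 0 < A)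
    (hAα : A ≤ α) (hβ : 0 < β) {q : ℕ} (hq : 1 ≤ q) (hqs : q ≤ S.symIndex) (hR : 0 ≤ R)
    (hθ : R * (A / α) ^ S.symIndex ≤ θ) (hκ0 : 0 ≤ κ) (hκ : κ ≤ C) (hl0 : 0 ≤ l) (hl : l ≤ A)
    (k : ℕ) :
    S.spikeWeight α β q k * (κ * R ^ k * l ^ (S.blockIndex q k - 1)) ≤
      C * S.symIndex ^ 2 * A⁻¹ * ((k + 1 : ℝ) * θ ^ k) := by
  have hα : 0 < α := hA.trans_le hAα
  have h0 := S.spikeWeight_nonneg hα hβ hq k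
  have h := S.spikeWeight_mul_le hA hAα hβ hq hqs hR hθ k
  have hC : 0 ≤ C := hκ0.trans hκ
  calc _ ≤ S.spikeWeight α β q k * (C * R ^ k * A ^ (S.blockIndex q k - 1)) := by gcongr
    _ = C * (S.spikeWeight α β q k * (A ^ (S.blockIndex q k - 1) * R ^ k)) := by ring
    _ ≤ C * (S.symIndex ^ 2 * A⁻¹ * ((k + 1 : ℝ) * θ ^ k)) := by gcongr
    _ = _ := by ring

/-- Varying the amplitude or a base of a power costs at most a factor linear in `k`, and `∑ (k+1)³
θ^k` converges. This transfers the linear rate of the branch data to the squared norm of the spike.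
-/
theorem exists_lipschitz_spikeWeight {N : ℕ} (S : PolynomialLeaf N) {α β A C θ : ℝ} (hA : 0 < A)
    (hAα : A ≤ α) (hβ : 0 < β) {q : ℕ} (hq : 1 ≤ q) (hqs : q ≤ S.symIndex) (hθ1 : θ < 1) :
    ∃ H : ℝ, ∀ κ κc R l lc : ℝ, 0 ≤ κ → κ ≤ C → 0 ≤ κc → κc ≤ C → 1 ≤ R →
      R * (A / α) ^ S.symIndex ≤ θ → 0 ≤ l → l ≤ A → 0 ≤ lc → lc ≤ A →
      Summable (fun k => (S.spikeWeight α β q k *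
        (κc * lc ^ (S.blockIndex q k - 1))) ^ 2) ∧
      |∑' k, (S.spikeWeight α β q k * (κ * R ^ k * l ^ (S.blockIndex q k - 1))) ^ 2 -
        ∑' k, (S.spikeWeight α β q k * (κc * lc ^ (S.blockIndex q k - 1))) ^ 2| ≤
        H * (|κ - κc| + (R - 1) + |l - lc|) := by
  have hα : 0 < α := hA.trans_le hAα
  have hs1 : (1 : ℝ) ≤ S.symIndex := by exact_mod_cast hq.trans hqs
  set D : ℝ := S.symIndex ^ 2 * A⁻¹ with hD
  have hD0 : 0 ≤ D := by positivity
  -- For negative `C` or `θ` the hypotheses on the data are contradictory, so any constant serves.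
  by_cases hC : 0 ≤ C
  swap
  · exact ⟨0, fun κ κc R l lc h0 h1 => absurd (h0.trans h1) hC⟩
  by_cases hθ0 : 0 ≤ θ
  swap
  · exact ⟨0, fun κ κc R l lc h0 h1 _ _ hR h2 =>
      absurd (le_trans (by positivity) h2) hθ0⟩
  set G : ℝ := 2 * C * D ^ 2 * (1 + C + C * A⁻¹ * S.symIndex) with hG
  refine ⟨G * ∑' k : ℕ, (k + 1 : ℝ) ^ 3 * θ ^ k, ?_⟩
  intro κ κc R l lc hκ0 hκ hκc0 hκc hR hθ hl0 hl hlc0 hlc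
  have hR0 : 0 ≤ R := by linarith
  have hθ' : 1 * (A / α) ^ S.symIndex ≤ θ := le_trans (by gcongr) hθ
  have ha := fun k => S.spikeWeight_mul_pow_le (β := β) hA hAα hβ hq hqs hR0 hθ hκ0 hκ hl0 hl k
  have hb := fun k => S.spikeWeight_mul_pow_le (β := β) hA hAα hβ hq hqs zero_le_one hθ'
    hκc0 hκc hlc0 hlc k
  simp only [one_pow, mul_one] at hb
  set a : ℕ → ℝ := fun k => S.spikeWeight α β q k * (κ * R ^ k * l ^ (S.blockIndex q k - 1)) with had
  set b : ℕ → ℝ := fun k => S.spikeWeight α β q k * (κc * lc ^ (S.blockIndex q k - 1)) with hbd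
  have hN := fun k => S.spikeWeight_nonneg hα hβ hq k
  have ha0 : ∀ k, 0 ≤ a k := fun k => mul_nonneg (hN k) (by positivity)
  have hb0 : ∀ k, 0 ≤ b k := fun k => mul_nonneg (hN k) (by positivity)
  have hθk : ∀ k : ℕ, θ ^ k * θ ^ k ≤ θ ^ k := fun k =>
    mul_le_of_le_one_left (by positivity) (pow_le_one₀ hθ0 hθ1.le)
  have hsq : ∀ u : ℕ → ℝ, (∀ k, 0 ≤ u k) →
      (∀ k, u k ≤ C * S.symIndex ^ 2 * A⁻¹ * ((k + 1 : ℝ) * θ ^ k)) →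
      Summable (fun k => u k ^ 2) := fun u hu0 hu => by
    refine Summable.of_nonneg_of_le (fun k => by positivity) (fun k => ?_)
      ((summable_succ_pow_mul_pow hθ0 hθ1 2).mul_left ((C * S.symIndex ^ 2 * A⁻¹) ^ 2))
    calc u k ^ 2 ≤ (C * S.symIndex ^ 2 * A⁻¹ * ((k + 1 : ℝ) * θ ^ k)) ^ 2 := by
          gcongr
          · exact hu0 k
          · exact hu k
      _ = (C * S.symIndex ^ 2 * A⁻¹) ^ 2 * ((k + 1 : ℝ) ^ 2 * (θ ^ k * θ ^ k)) := by ring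
      _ ≤ _ := by gcongr; exact hθk k
  have hsa := hsq a ha0 ha
  have hsb := hsq b hb0 hb
  refine ⟨hsb, ?_⟩
  set Δ := |κ - κc| + (R - 1) + |l - lc| with hΔ
  have hR1 : 0 ≤ R - 1 := by linarith
  have hΔ0 : 0 ≤ Δ := by positivity
  have hsum := (summable_succ_pow_mul_pow hθ0 hθ1 3).mul_left (G * Δ)
  rw [← hsa.tsum_sub hsb]
  have hterm : ∀ k, ‖a k ^ 2 - b k ^ 2‖ ≤ G * Δ * ((k + 1 : ℝ) ^ 3 * θ ^ k) := by
    intro k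
    have h1 : |a k - b k| ≤ D * ((k + 1 : ℝ) * θ ^ k) *
        ((1 + C + C * A⁻¹ * S.symIndex) * (k + 1) * Δ) := by
      have h2 := abs_mul_pow_mul_pow_sub_le k (S.blockIndex q k - 1) hκ0 hκ hκc0 hκc hR hl0 hl
        hlc0 hlc hA
      have h3 := S.spikeWeight_mul_le hA hAα hβ hq hqs hR0 hθ k
      have h4 : ((S.blockIndex q k - 1 : ℕ) : ℝ) ≤ S.symIndex * (k + 1) :=
        le_trans (by exact_mod_cast Nat.sub_le _ _) (S.blockIndex_le hqs k)
      have h5 : |κ - κc| + C * k * (R - 1) + C * A⁻¹ * (S.blockIndex q k - 1 : ℕ) * |l - lc| ≤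
          (1 + C + C * A⁻¹ * S.symIndex) * (k + 1) * Δ := by
        have hk0 : (0 : ℝ) ≤ k := Nat.cast_nonneg k
        have e1 : |κ - κc| ≤ 1 * (k + 1) * Δ := by
          have : |κ - κc| ≤ Δ := by linarith [abs_nonneg (l - lc)]
          nlinarith
        have e2 : C * k * (R - 1) ≤ C * (k + 1) * Δ := by
          gcongr
          · linarith
          · linarith [abs_nonneg (l - lc), abs_nonneg (κ - κc)]
        have e3 : C * A⁻¹ * (S.blockIndex q k - 1 : ℕ) * |l - lc| ≤
            C * A⁻¹ * (S.symIndex * (k + 1)) * Δ := by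
          gcongr
          linarith [abs_nonneg (κ - κc)]
        linarith
      rw [had, hbd]
      simp only
      rw [← mul_sub, abs_mul, abs_of_nonneg (hN k)]
      calc _ ≤ S.spikeWeight α β q k * (A ^ (S.blockIndex q k - 1) * R ^ k *
            (|κ - κc| + C * k * (R - 1) + C * A⁻¹ * (S.blockIndex q k - 1 : ℕ) * |l - lc|)) := by
            gcongr
            exact hN k
        _ = S.spikeWeight α β q k * (A ^ (S.blockIndex q k - 1) * R ^ k) *
            (|κ - κc| + C * k * (R - 1) + C * A⁻¹ * (S.blockIndex q k - 1 : ℕ) * |l - lc|) := by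
            ring
        _ ≤ _ := by
            gcongr
    have h6 : |a k + b k| ≤ 2 * (C * D * ((k + 1 : ℝ) * θ ^ k)) := by
      rw [abs_of_nonneg (add_nonneg (ha0 k) (hb0 k)), two_mul]
      refine add_le_add ((ha k).trans_eq ?_) ((hb k).trans_eq ?_) <;> rw [hD] <;> ring
    rw [Real.norm_eq_abs, sq_sub_sq, abs_mul]
    calc _ ≤ 2 * (C * D * ((k + 1 : ℝ) * θ ^ k)) * (D * ((k + 1 : ℝ) * θ ^ k) *
        ((1 + C + C * A⁻¹ * S.symIndex) * (k + 1) * Δ)) := by gcongr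
      _ = G * Δ * ((k + 1 : ℝ) ^ 3 * (θ ^ k * θ ^ k)) := by rw [hG]; ring
      _ ≤ _ := by gcongr; exact hθk k
  have h := tsum_of_norm_bounded hsum.hasSum hterm
  rw [tsum_mul_left, Real.norm_eq_abs] at h
  calc _ ≤ _ := h
    _ = _ := by ring

/-- Two-sided control of the levels by the spike, uniformly in the parameter. -/
theorem exists_level_bounds {N : ℕ} (S : PolynomialLeaf N) {α β A C K θ : ℝ} (hA : 0 < A)
    (hAα : A ≤ α) (hβ : 0 < β) (hC : 0 ≤ C) (hK : 0 ≤ K) {q : ℕ} (hq : 1 ≤ q)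
    (hqs : q ≤ S.symIndex) (hθ0 : 0 ≤ θ) (hθ1 : θ < 1) :
    ∃ L : ℝ, ∀ (ζ : Fin N → ℂ) (x lam κ : ℂ) (W : ℂ → ℂ) (c ε M : ℝ),
      S.HasStolzContinuation ζ x lam κ W c ε M C → 0 < c → ‖lam‖ ≤ A → ‖κ‖ ≤ C → lam ≠ 0 → κ ≠ 0 →
      1 < ‖x‖ → ‖x ^ S.symIndex‖ * (A / α) ^ S.symIndex ≤ θ →
      (∀ p m : ℕ, ‖taylorCoeff (fun u => W u ^ p) m + p * lam ^ (p - 1) *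
        (((Real.sqrt S.symIndex : ℝ) : ℂ)⁻¹ * κ) *
        ((1 / (2 * √Real.pi * ((m + 1) * √(m + 1))) : ℝ) : ℂ)‖ ≤
          K * ((p + 1 : ℝ) ^ 2 * A ^ p) / (m + 1 : ℝ) ^ 2) →
      (∃ V : EllTwo →L[ℂ] EllTwo, S.IsRenormalizedSynthesis α β q ζ V) ∧
      |variationalLevel (S.renormalizedGram α β q ζ) 1 -
        (∑' k, ‖S.spike α β q x lam κ k‖ ^ 2) *
          (-Real.log (1 - (‖x ^ S.symIndex‖ ^ 2)⁻¹) / (‖x ^ S.symIndex‖ ^ 2)⁻¹)| ≤ L ∧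
      (∀ k, 2 ≤ k → variationalLevel (S.renormalizedGram α β q ζ) k ≤ L) ∧
      ∀ k, variationalLevel (S.renormalizedHessian α β q ζ) k =
        variationalLevel (S.renormalizedGram α β q ζ) k := by
  have hα : 0 < α := hA.trans_le hAα
  obtain ⟨c₀, hc₀, hspike⟩ := exists_spike_decomposition
  set D : ℝ := S.symIndex * (3 * (C * A⁻¹) + K) * (S.symIndex + 1) ^ 2 +
    C * S.symIndex ^ 2 * A⁻¹ with hD
  set m : ℕ → ℝ := fun k => D * ((k + 1 : ℝ) ^ 4 * θ ^ k) with hm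
  have hms : Summable m := (summable_succ_pow_mul_pow hθ0 hθ1 4).mul_left D
  set K' := c₀ * ∑' k, m k with hK'
  have hD0 : 0 ≤ D := by positivity
  refine ⟨3 * K' ^ 2, ?_⟩
  intro ζ x lam κ W c ε M h hc hlam hκ hlam0 hκ0 hx hθ hcoeff
  have hs : S.symIndex ≠ 0 := by omega
  have hR1 : 1 < ‖x ^ S.symIndex‖ := by rw [norm_pow]; exact one_lt_pow₀ hx hs
  set R := ‖x ^ S.symIndex‖ with hR
  have hR0 : 0 < R := by linarith
  set r := (R ^ 2)⁻¹ with hr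
  have hr0 : 0 < r := by positivity
  have hr1 : r < 1 := inv_lt_one_of_one_lt₀ (one_lt_pow₀ hR1 two_ne_zero)
  set b₀ : ℕ → ℂ := fun j => ((x ^ S.symIndex)⁻¹) ^ j * ((√(j + 1 : ℝ) : ℝ) : ℂ)⁻¹ with hb₀
  have hb₀n : ∀ j, ‖b₀ j‖ = (R⁻¹) ^ j * (√(j + 1 : ℝ))⁻¹ := fun j => by
    rw [hb₀]; simp only
    rw [norm_mul, norm_pow, norm_inv, norm_inv, Complex.norm_real,
      Real.norm_of_nonneg (Real.sqrt_nonneg _)]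
  have hb₀sq : ∀ j, ‖b₀ j‖ ^ 2 = r ^ j * (j + 1 : ℝ)⁻¹ := fun j => by
    rw [hb₀n, mul_pow, inv_pow (√_) 2, Real.sq_sqrt (by positivity), ← pow_mul, mul_comm j 2, pow_mul,
      inv_pow R 2]
  have hbsum : HasSum (fun j => ‖b₀ j‖ ^ 2) (-Real.log (1 - r) / r) := by
    simp_rw [hb₀sq]; exact hasSum_inv_pow_div_succ hr0 hr1
  have hpow : ∀ k : ℕ, (k + 1 : ℝ) * θ ^ k ≤ (k + 1 : ℝ) ^ 4 * θ ^ k := fun k => by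
    gcongr
    exact le_self_pow₀ (by linarith [Nat.cast_nonneg (α := ℝ) k]) (by norm_num)
  obtain ⟨V, B, b, d, hVe, hbe, hde, hV, hB, hbB, hd⟩ := hspike
    (fun j k => S.gramVector ζ q k j / (S.weight α β q k : ℂ)) b₀ (S.spike α β q x lam κ) m hms
    (fun j => by
      rw [hb₀n]
      exact mul_le_of_le_one_left (by positivity)
        (pow_le_one₀ (by positivity) (inv_le_one_of_one_le₀ hR1.le)))
    hbsum.summable
    (fun k => by
      rw [S.norm_spike hα hβ hq]
      refine (S.spikeWeight_mul_pow_le hA hAα hβ hq hqs (norm_nonneg _) hθ (norm_nonneg _) hκ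
        (norm_nonneg _) hlam k).trans ?_
      calc _ ≤ D * ((k + 1 : ℝ) * θ ^ k) := by
            gcongr
            rw [hD]
            have : 0 ≤ S.symIndex * (3 * (C * A⁻¹) + K) * ((S.symIndex : ℝ) + 1) ^ 2 := by positivity
            linarith
        _ ≤ _ := by
            rw [hm]; simp only; gcongr D * ?_; exact hpow k)
    (fun j k => by
      refine (h.norm_gramVector_div_sub_le hc hA hAα hβ hK hlam hx.le hq hqs hθ hcoeff j k).trans ?_
      rw [hm]; simp only
      gcongr
      rw [hD]
      have : 0 ≤ C * (S.symIndex : ℝ) ^ 2 * A⁻¹ := by positivity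
      linarith)
  have hVr : S.IsRenormalizedSynthesis α β q ζ V := fun k j => hVe k j
  have hex : ∃ V : EllTwo →L[ℂ] EllTwo, S.IsRenormalizedSynthesis α β q ζ V := ⟨V, hVr⟩
  -- The chosen extension is the constructed operator, since both agree on the unit vectors.
  have hren : S.renormalizedSynthesis α β q ζ = V := by
    rw [renormalizedSynthesis, dif_pos hex]
    exact ellTwo_clm_ext fun k j => by rw [Classical.choose_spec hex k j, hVr k j]
  have hd0 : d ≠ 0 := by
    intro h0
    have h1 : ‖S.spike α β q x lam κ 0‖ = 0 := by rw [← hde, h0]; simp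
    rw [S.norm_spike hα hβ hq] at h1
    have h2 := S.spikeWeight_pos hα hβ hq hqs 0
    have h3 := norm_pos_iff.2 hlam0
    have h4 := norm_pos_iff.2 hκ0
    have : 0 < S.spikeWeight α β q 0 * (‖κ‖ * ‖x ^ S.symIndex‖ ^ 0 *
      ‖lam‖ ^ (S.blockIndex q 0 - 1)) := by positivity
    linarith
  have hlev := variationalLevel_rankOne_perturbation not_finiteDimensional_ellTwo V B b d hV hB hbB
    hd hd0
  have hdn : ‖d‖ ^ 2 = ∑' k, ‖S.spike α β q x lam κ k‖ ^ 2 := by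
    rw [ellTwo_norm_sq]; simp_rw [hde]
  have hbn : ‖b‖ ^ 2 = -Real.log (1 - r) / r := by
    rw [ellTwo_norm_sq]; simp_rw [hbe]; exact hbsum.tsum_eq
  rw [hdn, hbn] at hlev
  refine ⟨hex, ?_, fun k hk => ?_, fun k => ?_⟩
  · rw [renormalizedGram, hren]; exact hlev.1
  · rw [renormalizedGram, hren]
    exact (hlev.2 k hk).trans (by nlinarith [sq_nonneg K'])
  · rw [renormalizedGram, renormalizedHessian, hren]
    exact variationalLevel_comp_adjoint_eq not_finiteDimensional_ellTwo V k

end PolynomialLeaf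

/-! ### The logarithm -/

/-- `-log (1 - r) / r = log (1 / τ) + O(1)` when `1 - r` is comparable to `τ`. -/
theorem isBigO_log_sub {ι : Type*} {l : Filter ι} {r τ : ι → ℝ} {g : ℝ} (hg : 0 < g)
    (hτ : ∀ᶠ i in l, 0 < τ i) (hτ0 : Tendsto τ l (𝓝 0))
    (hr : Tendsto (fun i => (1 - r i) / τ i) l (𝓝 g)) :
    (fun i => -Real.log (1 - r i) / r i - Real.log (1 / τ i)) =O[l] (fun _ => (1 : ℝ)) := by
  have h1r : Tendsto (fun i => 1 - r i) l (𝓝 0) := by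
    have h := hr.mul hτ0
    rw [mul_zero] at h
    refine h.congr' ?_
    filter_upwards [hτ] with i hi
    exact div_mul_cancel₀ _ hi.ne'
  have hlog : Tendsto (fun i => Real.log ((1 - r i) / τ i)) l (𝓝 (Real.log g)) := hr.log hg.ne'
  refine IsBigO.of_bound (|Real.log g| + 1 + 2) ?_
  filter_upwards [hτ, hr.eventually_const_lt hg, h1r.eventually_lt_const (show (0 : ℝ) < 1 / 2 by norm_num),
    hlog.abs.eventually_lt_const (show |Real.log g| < |Real.log g| + 1 by linarith)] with i h1 h2 h3 h4
  have hpos : 0 < 1 - r i := (div_pos_iff_of_pos_right h1).1 h2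
  have hri : 1 / 2 < r i := by linarith
  -- Writing `1/r = 1 + (1 - r)/r` separates the pure logarithm from `(1 - r) log(1 - r) / r`, which
  -- is bounded.
  have e : -Real.log (1 - r i) / r i - Real.log (1 / τ i) =
      -Real.log ((1 - r i) / τ i) - Real.log (1 - r i) * (1 - r i) / r i := by
    rw [Real.log_div hpos.ne' h1.ne', one_div, Real.log_inv]
    field_simp
    ring
  rw [e, norm_one, mul_one]
  refine (norm_sub_le _ _).trans (add_le_add ?_ ?_)
  · rw [norm_neg]; exact h4.le
  · rw [norm_div, Real.norm_eq_abs, Real.norm_of_nonneg (by linarith : 0 ≤ r i),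
      div_le_iff₀ (by linarith)]
    have := Real.abs_log_mul_self_lt (1 - r i) hpos (by linarith)
    linarith

/-- A product of a logarithmically divergent factor and a factor converging at a linear rate. -/
theorem isBigO_mul_log_sub {ι : Type*} {l : Filter ι} {D L τ : ι → ℝ} {G : ℝ}
    (hτ : ∀ᶠ i in l, 0 < τ i) (hτ0 : Tendsto τ l (𝓝 0))
    (hL : (fun i => L i - Real.log (1 / τ i)) =O[l] (fun _ => (1 : ℝ)))
    (hD : (fun i => D i - G) =O[l] τ) :
    (fun i => D i * L i - G * Real.log (1 / τ i)) =O[l] (fun _ => (1 : ℝ)) := by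
  -- A linear rate in `τ` is ample here, as `τ log(1/τ)` is bounded.
  have h1 : (fun i => τ i * Real.log (1 / τ i)) =O[l] (fun _ => (1 : ℝ)) := by
    refine IsBigO.of_bound 1 ?_
    filter_upwards [hτ, hτ0.eventually_lt_const one_pos] with i h2 h3
    have := Real.abs_log_mul_self_lt (τ i) h2 h3.le
    rw [one_div, Real.log_inv, norm_one, mul_one, Real.norm_eq_abs, mul_neg, abs_neg, mul_comm]
    exact this.le
  have hτO : τ =O[l] (fun _ => (1 : ℝ)) := hτ0.isBigO_one ℝ
  have hD1 : D =O[l] (fun _ => (1 : ℝ)) := by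
    have := (hD.trans hτO).add (isBigO_const_const G (one_ne_zero (α := ℝ)) l)
    refine this.congr_left fun i => by ring
  have h2 := (hD1.mul hL).congr_right (g₂ := fun _ => (1 : ℝ)) (fun i => by norm_num)
  have h3 := (hD.mul (isBigO_refl (fun i => Real.log (1 / τ i)) l)).trans h1
  exact (h2.add h3).congr_left fun i => by ring

/-! ### The approach to the critical time -/

theorem tendsto_left_slope {f : ℝ → ℝ} {g a : ℝ} (h : HasDerivWithinAt f (-g) (Iic a) a) :
    Tendsto (fun t => (f t - f a) / (a - t)) (𝓝[<] a) (𝓝 g) := by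
  have h1 := hasDerivWithinAt_iff_tendsto_slope.1 h
  rw [Iic_sdiff_right] at h1
  have h2 := h1.neg
  rw [neg_neg] at h2
  refine h2.congr fun t => ?_
  rw [slope_def_field, ← div_neg, neg_sub]

/-- A nonzero value of `derivWithin` rules out its default `0`, hence gives differentiability. The
sign follows from `ρ > 1` before `a`. -/
theorem exists_hasDerivWithinAt_of_one_lt {ρ : ℝ → ℝ} {a : ℝ} (h0 : ρ a = 1)
    (hd : derivWithin ρ (Iic a) a ≠ 0) (h1 : ∀ᶠ t in 𝓝[<] a, 1 < ρ t) :
    ∃ g : ℝ, 0 < g ∧ HasDerivWithinAt ρ (-g) (Iic a) a := by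
  have hdiff : DifferentiableWithinAt ℝ ρ (Iic a) a := by
    by_contra hn
    exact hd (derivWithin_zero_of_not_differentiableWithinAt hn)
  have hD := hdiff.hasDerivWithinAt
  set g := -derivWithin ρ (Iic a) a with hg
  rw [show derivWithin ρ (Iic a) a = -g by rw [hg, neg_neg]] at hD
  refine ⟨g, lt_of_le_of_ne ?_ (Ne.symm (neg_ne_zero.2 hd)), hD⟩
  refine ge_of_tendsto (tendsto_left_slope hD) ?_
  filter_upwards [h1, self_mem_nhdsWithin] with t ht hta
  have : t < a := hta
  exact div_nonneg (by linarith) (by linarith)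

theorem tendsto_left_slope_inv_pow {ρ : ℝ → ℝ} {a g : ℝ} (h0 : ρ a = 1)
    (h : HasDerivWithinAt ρ (-g) (Iic a) a) (n : ℕ) :
    Tendsto (fun t => (1 - (ρ t ^ n)⁻¹) / (a - t)) (𝓝[<] a) (𝓝 (n * g)) := by
  have h1 := ((h.pow n).inv (by simp [h0])).const_sub 1
  have h2 : HasDerivWithinAt (fun t => 1 - (ρ t ^ n)⁻¹) (-(n * g)) (Iic a) a := by
    refine h1.congr_deriv ?_
    simp [h0]
  refine (tendsto_left_slope h2).congr fun t => ?_
  simp [h0]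

theorem tendsto_left_slope_pow {ρ : ℝ → ℝ} {a g : ℝ} (h0 : ρ a = 1)
    (h : HasDerivWithinAt ρ (-g) (Iic a) a) (n : ℕ) :
    Tendsto (fun t => (ρ t ^ n - 1) / (a - t)) (𝓝[<] a) (𝓝 (n * g)) := by
  have h2 : HasDerivWithinAt (fun t => ρ t ^ n) (-(n * g)) (Iic a) a := by
    refine (h.pow n).congr_deriv ?_
    simp [h0]
  refine (tendsto_left_slope h2).congr fun t => ?_
  simp [h0]

namespace PolynomialLeaf

variable {N : ℕ} {S : PolynomialLeaf N}

theorem UniformContinuation.exists_hasStolzContinuation {ζ : ℝ → Fin N → ℂ} {Tc : ℝ}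
    (h : S.UniformContinuation ζ Tc)
    (hρ : Tendsto (fun T => (S.rhoStar (ζ T)).toReal) (𝓝[<] Tc) (𝓝 1))
    (h1 : ∀ᶠ T in 𝓝[<] Tc, 1 < S.rhoStar (ζ T)) :
    ∃ (xs lam κ : ℝ → ℂ) (W : ℝ → ℂ → ℂ) (c ε M C c₀ : ℝ),
      0 < c ∧ c ≤ 1 / 4 ∧ 0 < ε ∧ 0 ≤ M ∧ 0 < C ∧ 0 < c₀ ∧ ∀ᶠ T in 𝓝[<] Tc,
        1 < ‖xs T‖ ∧ S.IsDominantPoint (ζ T) (xs T) ∧ S.IsBranchValue (ζ T) (xs T) (lam T) ∧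
        S.HasStolzContinuation (ζ T) (xs T) (lam T) (κ T) (W T) c ε M C ∧
        ‖κ T‖ ≤ C ∧ c₀ ≤ ‖lam T‖ ∧ c₀ ≤ ‖κ T‖ := by
  obtain ⟨δ, φ, η₀, M, C₀, c₀, xs, lam, κ, c, d, V, hδ, hφ0, hφ, hη, hC₀, hc₀, hT⟩ := h
  have hcos : 0 < Real.cos φ := Real.cos_pos_of_mem_Ioo ⟨by linarith [Real.pi_pos], hφ⟩
  have hev : ∀ᶠ T in 𝓝[<] Tc, 1 < ‖xs T‖ ∧ S.IsDominantPoint (ζ T) (xs T) ∧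
      S.IsBranchValue (ζ T) (xs T) (lam T) ∧
      S.HasStolzContinuation (ζ T) (xs T) (lam T) (κ T) (fun u => V T (xs T ^ S.symIndex * u))
        (min (Real.cos φ / 4) (η₀ / 16)) (min η₀ 1) M (3 * C₀) ∧
        ‖κ T‖ ≤ 3 * C₀ ∧ c₀ ≤ ‖lam T‖ ∧ c₀ ≤ ‖κ T‖ := by
    have hpow := hρ.pow S.symIndex
    rw [one_pow] at hpow
    filter_upwards [Ioo_mem_nhdsLT (show Tc - δ < Tc by linarith), h1,
      hpow.eventually_lt_const one_lt_two] with T hTI hT1 hT2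
    obtain ⟨hdom, hbr, hV, hgerm, -, hM, hlam, hκ, hsum, hexp⟩ := hT T hTI
    have hn := rhoStar_toReal_eq_norm hdom.2
    rw [hn, ← norm_pow] at hT2
    refine ⟨?_, hdom, hbr, hasStolzContinuation_of_continuation hφ0 hφ hη hdom.2 hT2.le hV hgerm hM
      hsum hexp, ?_, hlam, hκ⟩
    · rw [← hdom.2, ← ofReal_norm, ← ENNReal.ofReal_one,
        ENNReal.ofReal_lt_ofReal_iff_of_nonneg zero_le_one] at hT1
      exact hT1
    · linarith [norm_nonneg (lam T), norm_nonneg (c T), norm_nonneg (d T), norm_nonneg (κ T)]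
  refine ⟨xs, lam, κ, fun T u => V T (xs T ^ S.symIndex * u), _, _, M, 3 * C₀, c₀, by positivity,
    (min_le_left _ _).trans (by linarith [Real.cos_le_one φ]), by positivity, ?_, by positivity, hc₀,
    hev⟩
  obtain ⟨T, hT1, -, -, hst, -⟩ := hev.exists
  exact (norm_nonneg _).trans (hst.norm_taylorBranch_le (by positivity) (y := 0)
    (by rw [norm_zero]; linarith))

theorem branchValue_eq {ζ : Fin N → ℂ} {x x' lam lam' : ℂ} (hx : S.IsDominantPoint ζ x)
    (hx' : S.IsDominantPoint ζ x') (h : S.IsBranchValue ζ x lam) (h' : S.IsBranchValue ζ x' lam') :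
    lam' = lam :=
  branchValue_unique hx.2 hx'.2 ((hx.singularity_iff x').1 ((hx'.singularity_iff x').2 rfl)) h h'

theorem midRadius_eq {ζ : Fin N → ℂ} {x : ℂ} (hx : S.IsDominantPoint ζ x) :
    S.midRadius ζ = (1 + ‖x‖) / 2 := by
  rw [midRadius, rhoStar_toReal_eq_norm hx.2]

/-- All large weights are admissible. -/
theorem isAdmissibleWeight_of_lt {ζ : ℝ → Fin N → ℂ} {Tc : ℝ} {xs lam κ : ℝ → ℂ}
    {W : ℝ → ℂ → ℂ} {c ε M C : ℝ} (hc : 0 < c)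
    (h : ∀ᶠ T in 𝓝[<] Tc, 1 < ‖xs T‖ ∧ S.IsDominantPoint (ζ T) (xs T) ∧
      S.IsBranchValue (ζ T) (xs T) (lam T) ∧
      S.HasStolzContinuation (ζ T) (xs T) (lam T) (κ T) (W T) c ε M C) {α : ℝ} (hα : max M C < α) :
    S.IsAdmissibleWeight ζ Tc α := by
  refine ⟨M, C, hα, ?_⟩
  filter_upwards [h] with T ⟨h1, hdom, hbr, hst⟩
  refine ⟨fun y hy => hst.norm_taylorBranch_le hc.le ?_, fun x lam' hx hl => ?_⟩
  · rw [hy, midRadius_eq hdom]; linarith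
  · rw [branchValue_eq hdom hx hbr hl]
    exact hst.stolz.norm_lam_le

/-- In the rescaled variable the midpoint circle has radius tending to `1`, so it eventually exceeds
`1 - δ`, and the narrow disks inherit the bound `A`. -/
theorem exists_eventually_coeff_bound {ζ : ℝ → Fin N → ℂ} {Tc : ℝ} {xs lam κ : ℝ → ℂ}
    {W : ℝ → ℂ → ℂ} {c ε M C M₀ L₀ A : ℝ} (hc : 0 < c) (hc4 : c ≤ 1 / 4) (hε : 0 < ε) (hM : 0 ≤ M)
    (hC : 0 < C) (hA : 0 < A) (hMA : M₀ < A) (hLA : L₀ < A)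
    (hx : Tendsto (fun T => ‖xs T‖) (𝓝[<] Tc) (𝓝 1))
    (h : ∀ᶠ T in 𝓝[<] Tc, 1 < ‖xs T‖ ∧ S.IsDominantPoint (ζ T) (xs T) ∧
      S.HasStolzContinuation (ζ T) (xs T) (lam T) (κ T) (W T) c ε M C)
    (hM₀ : ∀ᶠ T in 𝓝[<] Tc, ∀ x : ℂ, ‖x‖ = S.midRadius (ζ T) → ‖S.taylorBranch (ζ T) x‖ ≤ M₀)
    (hL₀ : ∀ᶠ T in 𝓝[<] Tc, ‖lam T‖ ≤ L₀) :
    ∃ K : ℝ, 0 < K ∧ ∀ᶠ T in 𝓝[<] Tc, ∀ p m : ℕ,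
      ‖taylorCoeff (fun u => W T u ^ p) m + p * lam T ^ (p - 1) *
        (((Real.sqrt S.symIndex : ℝ) : ℂ)⁻¹ * κ T) *
        ((1 / (2 * √Real.pi * ((m + 1) * √(m + 1))) : ℝ) : ℂ)‖ ≤
          K * ((p + 1 : ℝ) ^ 2 * A ^ p) / (m + 1 : ℝ) ^ 2 := by
  obtain ⟨c', δ, hc'0, hc'c, hδ0, hδ1, hnar⟩ :=
    IsStolzSqrt.exists_narrow_bound hc hε hM hC hMA hLA
  obtain ⟨K, hK, hco⟩ := IsStolzSqrt.exists_coeff_bound (M := M) hε hC hA hc'0 hc'c (hc'c.trans hc4)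
  refine ⟨K, hK, ?_⟩
  have hθ : Tendsto (fun T => (((1 + ‖xs T‖) / 2) / ‖xs T‖) ^ S.symIndex) (𝓝[<] Tc) (𝓝 1) := by
    have h1 := ((((hx.const_add 1).div_const 2).div hx one_ne_zero).pow S.symIndex)
    norm_num at h1
    exact h1
  filter_upwards [h, hM₀, hL₀, hθ.eventually_const_lt (show 1 - δ < 1 by linarith)]
    with T ⟨h1, hdom, hst⟩ h2 h3 h4
  refine hco _ _ _ hst.stolz (h3.trans hLA.le) ?_
  refine hnar _ _ _ _ hst.stolz h4.le h3 fun u hu => ?_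
  refine hst.norm_le_of_norm_midRadius_le h1 h2 ?_
  rwa [midRadius_eq hdom]

theorem exists_critical_spike {ζ : ℝ → Fin N → ℂ} {Tc : ℝ} {xs lam κ : ℝ → ℂ}
    {W : ℝ → ℂ → ℂ} {c ε M C c₀ g : ℝ} (hc : 0 < c) (hc4 : c ≤ 1 / 4) (hε : 0 < ε) (hM : 0 ≤ M)
    (hC : 0 < C) (hc₀ : 0 < c₀)
    (h : ∀ᶠ T in 𝓝[<] Tc, 1 < ‖xs T‖ ∧ S.IsDominantPoint (ζ T) (xs T) ∧
      S.IsBranchValue (ζ T) (xs T) (lam T) ∧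
      S.HasStolzContinuation (ζ T) (xs T) (lam T) (κ T) (W T) c ε M C ∧
      ‖κ T‖ ≤ C ∧ c₀ ≤ ‖lam T‖ ∧ c₀ ≤ ‖κ T‖)
    (hg : 0 < g) (hρ1 : (S.rhoStar (ζ Tc)).toReal = 1)
    (hρ : HasDerivWithinAt (fun T => (S.rhoStar (ζ T)).toReal) (-g) (Iic Tc) Tc)
    {xc lamc κc : ℂ} (hlamc0 : lamc ≠ 0) (hκc0 : κc ≠ 0)
    (hlamc : Tendsto lam (𝓝[<] Tc) (𝓝 lamc))
    (hrate₁ : (fun T => lam T - lamc) =O[𝓝[<] Tc] (fun T => Tc - T))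
    (hrate₂ : (fun T => ‖κ T‖ - ‖κc‖) =O[𝓝[<] Tc] (fun T => Tc - T))
    {α β : ℝ} (hβ : 0 < β) (hadm : S.IsAdmissibleWeight ζ Tc α) {q : ℕ} (hq : 1 ≤ q)
    (hqs : q ≤ S.symIndex) :
    ∃ dc : EllTwo, (∀ j, dc j = S.criticalSpike α β q xc lamc κc j) ∧ 0 < ‖dc‖ ^ 2 ∧
      ∃ δ : ℝ, 0 < δ ∧
        (∀ T ∈ Ioo (Tc - δ) Tc,
          (∃ V : EllTwo →L[ℂ] EllTwo, S.IsRenormalizedSynthesis α β q (ζ T) V) ∧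
          ∀ k : ℕ, 1 ≤ k →
            variationalLevel (S.renormalizedHessian α β q (ζ T)) k =
              variationalLevel (S.renormalizedGram α β q (ζ T)) k) ∧
        Tendsto (fun T => variationalLevel (S.renormalizedGram α β q (ζ T)) 1)
          (𝓝[<] Tc) atTop ∧
        (fun T => variationalLevel (S.renormalizedGram α β q (ζ T)) 1 -
            ‖dc‖ ^ 2 * Real.log (1 / (Tc - T))) =O[𝓝[<] Tc] (fun _ => (1 : ℝ)) ∧
        ∀ k : ℕ, 2 ≤ k →
          BddAbove ((fun T => variationalLevel (S.renormalizedGram α β q (ζ T)) k) ''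
            Ioo (Tc - δ) Tc) := by
  have hs : 0 < S.symIndex := by omega
  obtain ⟨M₀, L₀, hML, hadm⟩ := hadm
  have hL₀ : ∀ᶠ T in 𝓝[<] Tc, ‖lam T‖ ≤ L₀ := by
    filter_upwards [h, hadm] with T h1 h2
    exact h2.2 _ _ h1.2.1 h1.2.2.1
  have hL₀pos : 0 < L₀ := by
    obtain ⟨T, h1, h2⟩ := (h.and hL₀).exists
    linarith [h1.2.2.2.2.2.1]
  -- Room is needed on both sides: `A` must exceed both bounds on the branch, and `A / α < 1` makes
  -- the columns decay.
  set A := (max M₀ L₀ + α) / 2 with hAdef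
  have hMA : M₀ < A := by linarith [le_max_left M₀ L₀]
  have hLA : L₀ < A := by linarith [le_max_right M₀ L₀]
  have hAα : A < α := by linarith
  have hA : 0 < A := hL₀pos.trans hLA
  have hα : 0 < α := hA.trans hAα
  have hxn : ∀ᶠ T in 𝓝[<] Tc, (S.rhoStar (ζ T)).toReal = ‖xs T‖ :=
    h.mono fun T hT => rhoStar_toReal_eq_norm hT.2.1.2
  have hx : Tendsto (fun T => ‖xs T‖) (𝓝[<] Tc) (𝓝 1) := by
    have h1 : Tendsto _ _ _ := hρ.continuousWithinAt
    simp only [hρ1] at h1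
    exact (h1.mono_left (nhdsWithin_mono _ Iio_subset_Iic_self)).congr' hxn
  obtain ⟨K, hK, hcoeff⟩ := exists_eventually_coeff_bound hc hc4 hε hM hC hA hMA hLA hx
    (h.mono fun T hT => ⟨hT.1, hT.2.1, hT.2.2.2.1⟩) (hadm.mono fun T hT => hT.1) hL₀
  have hratio : (A / α) ^ S.symIndex < 1 :=
    pow_lt_one₀ (by positivity) ((div_lt_one hα).2 hAα) hs.ne'
  -- The midpoint to `1` leaves room for the factor `|ξ| > 1`, which tends to `1`.
  set θ := ((A / α) ^ S.symIndex + 1) / 2 with hθdef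
  have hθ0 : 0 ≤ θ := by positivity
  have hθ1 : θ < 1 := by linarith
  have hθA : (A / α) ^ S.symIndex < θ := by linarith
  obtain ⟨L, hL⟩ := S.exists_level_bounds hA hAα.le hβ hC.le hK.le hq hqs hθ0 hθ1
  obtain ⟨H, hH⟩ := S.exists_lipschitz_spikeWeight (C := max C ‖κc‖) hA hAα.le hβ hq hqs hθ1
  have hlamcA : ‖lamc‖ ≤ A := (le_of_tendsto hlamc.norm hL₀).trans hLA.le
  have hθT : ∀ᶠ T in 𝓝[<] Tc, ‖xs T ^ S.symIndex‖ * (A / α) ^ S.symIndex ≤ θ := by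
    have h1 := (hx.pow S.symIndex).mul_const ((A / α) ^ S.symIndex)
    rw [one_pow, one_mul] at h1
    filter_upwards [h1.eventually_lt_const hθA] with T hT
    rw [norm_pow]; exact hT.le
  -- the critical spike
  have hsumm := (hH ‖κc‖ ‖κc‖ 1 ‖lamc‖ ‖lamc‖ (norm_nonneg _) (le_max_right _ _) (norm_nonneg _)
    (le_max_right _ _) le_rfl (by rw [one_mul]; exact hθA.le) (norm_nonneg _) hlamcA (norm_nonneg _)
    hlamcA).1
  have hcrit := S.norm_criticalSpike hα hβ hq xc lamc κc
  set dc : EllTwo := ⟨S.criticalSpike α β q xc lamc κc,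
    memlp_two_of_summable_sq (by simp_rw [hcrit]; exact hsumm)⟩ with hdc
  have hdcj : ∀ j, dc j = S.criticalSpike α β q xc lamc κc j := fun j => rfl
  have hdcn : ‖dc‖ ^ 2 = ∑' k, (S.spikeWeight α β q k *
      (‖κc‖ * ‖lamc‖ ^ (S.blockIndex q k - 1))) ^ 2 := by
    rw [ellTwo_norm_sq]; simp_rw [hdcj, hcrit]
  have hdc0 : 0 < ‖dc‖ ^ 2 := by
    have h1 : dc ≠ 0 := by
      intro h0
      have h2 : ‖S.criticalSpike α β q xc lamc κc 0‖ = 0 := by rw [← hdcj, h0]; simp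
      rw [hcrit] at h2
      have h3 := S.spikeWeight_pos hα hβ hq hqs 0
      have h4 := norm_pos_iff.2 hlamc0
      have h5 := norm_pos_iff.2 hκc0
      have : 0 < S.spikeWeight α β q 0 * (‖κc‖ * ‖lamc‖ ^ (S.blockIndex q 0 - 1)) := by positivity
      linarith
    have := norm_pos_iff.2 h1
    positivity
  -- the levels
  have hlev : ∀ᶠ T in 𝓝[<] Tc,
      (∃ V : EllTwo →L[ℂ] EllTwo, S.IsRenormalizedSynthesis α β q (ζ T) V) ∧
      |variationalLevel (S.renormalizedGram α β q (ζ T)) 1 -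
        (∑' k, ‖S.spike α β q (xs T) (lam T) (κ T) k‖ ^ 2) *
          (-Real.log (1 - (‖xs T ^ S.symIndex‖ ^ 2)⁻¹) / (‖xs T ^ S.symIndex‖ ^ 2)⁻¹)| ≤ L ∧
      (∀ k, 2 ≤ k → variationalLevel (S.renormalizedGram α β q (ζ T)) k ≤ L) ∧
      ∀ k, variationalLevel (S.renormalizedHessian α β q (ζ T)) k =
        variationalLevel (S.renormalizedGram α β q (ζ T)) k := by
    filter_upwards [h, hcoeff, hL₀, hθT] with T ⟨h1, h2, h3, h4, h5, h6, h7⟩ h8 h9 h10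
    exact hL _ _ _ _ _ _ _ _ h4 hc (h9.trans hLA.le) h5 (norm_pos_iff.1 (hc₀.trans_le h6))
      (norm_pos_iff.1 (hc₀.trans_le h7)) h1 h10 h8
  have hτ : ∀ᶠ T in 𝓝[<] Tc, 0 < Tc - T := by
    filter_upwards [self_mem_nhdsWithin] with T hT
    exact sub_pos.2 hT
  have hτ0 : Tendsto (fun T => Tc - T) (𝓝[<] Tc) (𝓝 0) := by
    have : Tendsto (fun T => Tc - T) (𝓝 Tc) (𝓝 (Tc - Tc)) := (continuous_const.sub continuous_id).tendsto _
    rw [sub_self] at this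
    exact this.mono_left nhdsWithin_le_nhds
  have hlog : (fun T => -Real.log (1 - (‖xs T ^ S.symIndex‖ ^ 2)⁻¹) / (‖xs T ^ S.symIndex‖ ^ 2)⁻¹ -
      Real.log (1 / (Tc - T))) =O[𝓝[<] Tc] (fun _ => (1 : ℝ)) := by
    -- Since `|ξ| = ρ_*^s`, the quantity `1 - |ξ|^{-2}` has slope `2 s g`.
    refine isBigO_log_sub (g := (S.symIndex * 2 : ℕ) * g) (by positivity) hτ hτ0 ?_
    refine (tendsto_left_slope_inv_pow hρ1 hρ (S.symIndex * 2)).congr' ?_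
    filter_upwards [hxn] with T hT
    rw [hT, norm_pow, ← pow_mul]
  have hR : (fun T => ‖xs T ^ S.symIndex‖ - 1) =O[𝓝[<] Tc] (fun T => Tc - T) := by
    refine isBigO_of_div_tendsto_nhds ?_ (S.symIndex * g)
      ((tendsto_left_slope_pow hρ1 hρ S.symIndex).congr' ?_)
    · filter_upwards [hτ] with T hT h0
      exact absurd h0 hT.ne'
    · filter_upwards [hxn] with T hT
      rw [Pi.div_apply, hT, norm_pow]
  have hlamO : (fun T => ‖lam T‖ - ‖lamc‖) =O[𝓝[<] Tc] (fun T => Tc - T) := by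
    refine (IsBigO.of_bound 1 (Eventually.of_forall fun T => ?_)).trans hrate₁
    rw [one_mul]
    exact abs_norm_sub_norm_le _ _
  have hD : (fun T => (∑' k, ‖S.spike α β q (xs T) (lam T) (κ T) k‖ ^ 2) - ‖dc‖ ^ 2)
      =O[𝓝[<] Tc] (fun T => Tc - T) := by
    have hO := (((hrate₂.abs_left).add hR).add hlamO.abs_left).const_mul_left H
    refine (IsBigO.of_bound 1 ?_).trans hO
    filter_upwards [h, hL₀, hθT] with T ⟨h1, _, _, _, h5, _, _⟩ h9 h10
    have h11 := (hH ‖κ T‖ ‖κc‖ ‖xs T ^ S.symIndex‖ ‖lam T‖ ‖lamc‖ (norm_nonneg _)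
      (h5.trans (le_max_left _ _)) (norm_nonneg _) (le_max_right _ _)
      (by rw [norm_pow]; exact one_le_pow₀ h1.le) h10 (norm_nonneg _) (h9.trans hLA.le)
      (norm_nonneg _) hlamcA).2
    simp_rw [S.norm_spike hα hβ hq]
    rw [hdcn, one_mul]
    exact h11.trans (le_abs_self _)
  have hasymp : (fun T => variationalLevel (S.renormalizedGram α β q (ζ T)) 1 -
      ‖dc‖ ^ 2 * Real.log (1 / (Tc - T))) =O[𝓝[<] Tc] (fun _ => (1 : ℝ)) := by
    have h1 := isBigO_mul_log_sub hτ hτ0 hlog hD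
    have h2 : (fun T => variationalLevel (S.renormalizedGram α β q (ζ T)) 1 -
        (∑' k, ‖S.spike α β q (xs T) (lam T) (κ T) k‖ ^ 2) *
          (-Real.log (1 - (‖xs T ^ S.symIndex‖ ^ 2)⁻¹) / (‖xs T ^ S.symIndex‖ ^ 2)⁻¹))
        =O[𝓝[<] Tc] (fun _ => (1 : ℝ)) := by
      refine IsBigO.of_bound L (hlev.mono fun T hT => ?_)
      rw [norm_one, mul_one]
      exact hT.2.1
    exact (h2.add h1).congr_left fun T => by ring
  -- The bound `L` does not depend on `k`, so a single `δ` serves all levels.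
  obtain ⟨a, ha, hsub⟩ := (mem_nhdsLT_iff_exists_Ioo_subset (a := Tc)).1 hlev
  have ha' : a < Tc := ha
  refine ⟨dc, hdcj, hdc0, Tc - a, by linarith, ?_, ?_, hasymp, ?_⟩
  · intro T hT
    rw [sub_sub_cancel] at hT
    exact ⟨(hsub hT).1, fun k _ => (hsub hT).2.2.2 k⟩
  · obtain ⟨B, hB⟩ := hasymp.bound
    have hlogt : Tendsto (fun T => Real.log (1 / (Tc - T))) (𝓝[<] Tc) atTop := by
      refine Real.tendsto_log_atTop.comp ?_
      simp_rw [one_div]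
      exact (tendsto_nhdsWithin_iff.2 ⟨hτ0, hτ⟩).inv_tendsto_nhdsGT_zero
    refine tendsto_atTop_mono' _ ?_ (tendsto_atTop_add_const_right _ (-B) (hlogt.const_mul_atTop hdc0))
    filter_upwards [hB] with T hT
    rw [norm_one, mul_one] at hT
    linarith [(abs_le.1 hT).1]
  · intro k hk
    refine ⟨L, ?_⟩
    rintro _ ⟨T, hT, rfl⟩
    rw [sub_sub_cancel] at hT
    exact (hsub hT).2.2.1 k hk

end PolynomialLeaf

/-! ### Assembly of the theorem. -/

theorem mainTheorem3 {N : ℕ} (S : PolynomialLeaf N)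
    (r : ℝ → ℝ) (a : ℝ → Fin N → ℂ) (ζ : ℝ → Fin N → ℂ) (Tc δ₀ : ℝ)
    (hTc : 0 < Tc)
    (hLG : S.IsLaplacianGrowth r a (Ico 0 Tc))
    (hζ : ∀ T ∈ Ico 0 Tc, ∀ n, ζ T n = a T n / (r T : ℂ))
    (hδ₀ : 0 < δ₀)
    (hanalytic : AnalyticOn ℝ ζ (Ioc (Tc - δ₀) Tc))
    (hsimple : S.IsSimpleCriticalPoint (ζ Tc))
    (htransversal : derivWithin (fun T => (S.rhoStar (ζ T)).toReal) (Iic Tc) Tc ≠ 0)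
    (hdominant : ∀ᶠ T in 𝓝[<] Tc,
      1 < S.rhoStar (ζ T) ∧ ∃ x lam : ℂ, S.IsSimpleDominantPoint (ζ T) x lam)
    (hcontinuation : S.UniformContinuation ζ Tc) :
    (∃ α₀ : ℝ, ∀ α : ℝ, α₀ < α → S.IsAdmissibleWeight ζ Tc α) ∧
    ∃ xc lamc κc : ℂ,
      S.IsSimpleDominantPoint (ζ Tc) xc lamc ∧ S.HasSqrtCoefficient (ζ Tc) xc lamc κc ∧
      ∀ α β : ℝ, 0 < β → S.IsAdmissibleWeight ζ Tc α →
      ∀ q : ℕ, 1 ≤ q → q ≤ S.symIndex →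
      ∃ dc : EllTwo, (∀ j, dc j = S.criticalSpike α β q xc lamc κc j) ∧ 0 < ‖dc‖ ^ 2 ∧
        ∃ δ : ℝ, 0 < δ ∧
          (∀ T ∈ Ioo (Tc - δ) Tc,
            (∃ V : EllTwo →L[ℂ] EllTwo, S.IsRenormalizedSynthesis α β q (ζ T) V) ∧
            ∀ k : ℕ, 1 ≤ k →
              variationalLevel (S.renormalizedHessian α β q (ζ T)) k =
                variationalLevel (S.renormalizedGram α β q (ζ T)) k) ∧
          Tendsto (fun T => variationalLevel (S.renormalizedGram α β q (ζ T)) 1)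
            (𝓝[<] Tc) atTop ∧
          (fun T => variationalLevel (S.renormalizedGram α β q (ζ T)) 1 -
              ‖dc‖ ^ 2 * Real.log (1 / (Tc - T))) =O[𝓝[<] Tc] (fun _ => (1 : ℝ)) ∧
          ∀ k : ℕ, 2 ≤ k →
            BddAbove ((fun T => variationalLevel (S.renormalizedGram α β q (ζ T)) k) ''
              Ioo (Tc - δ) Tc) := by
  have hρc : (S.rhoStar (ζ Tc)).toReal = 1 := by rw [hsimple.1.1]; rfl
  have h1 : ∀ᶠ T in 𝓝[<] Tc, 1 < S.rhoStar (ζ T) := hdominant.mono fun T hT => hT.1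
  have h1' : ∀ᶠ T in 𝓝[<] Tc, 1 < (S.rhoStar (ζ T)).toReal := by
    -- A dominant point has finite modulus `ρ_*`, so `toReal` does not take its default value at
    -- infinity.
    filter_upwards [hdominant] with T ⟨hT, x, lam, hdom, _⟩
    exact (ENNReal.lt_ofReal_iff_toReal_lt ENNReal.one_ne_top).1 (by
      rwa [ENNReal.ofReal_toReal (PolynomialLeaf.rhoStar_ne_top_of_enorm_eq hdom.2)])
  obtain ⟨g, hg, hρ⟩ := exists_hasDerivWithinAt_of_one_lt hρc htransversal h1'
  have hρt : Tendsto (fun T => (S.rhoStar (ζ T)).toReal) (𝓝[<] Tc) (𝓝 1) := by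
    have h2 : Tendsto _ _ _ := hρ.continuousWithinAt
    simp only [hρc] at h2
    exact h2.mono_left (nhdsWithin_mono _ Iio_subset_Iic_self)
  obtain ⟨xs, lam, κ, W, c, ε, M, C, c₀, hc, hc4, hε, hM, hC, hc₀, h⟩ :=
    hcontinuation.exists_hasStolzContinuation hρt h1
  have hle : 𝓝[<] Tc ≤ 𝓝[Ioc (Tc - δ₀) Tc] Tc := nhdsWithin_le_of_mem
    (mem_of_superset (Ioo_mem_nhdsLT (show Tc - δ₀ < Tc by linarith)) Ioo_subset_Ioc_self)
  -- One-sided analyticity up to `Tc` supplies the linear rate of the parameters, the source of all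
  -- later rates for the branch data.
  have hζO : (fun T => ζ T - ζ Tc) =O[𝓝[<] Tc] (fun T => Tc - T) := by
    have h2 := (hanalytic Tc ⟨by linarith, le_rfl⟩).differentiableWithinAt
    refine (h2.hasFDerivWithinAt.isBigO_sub.mono
      (hle.trans (nhdsWithin_mono _ (subset_insert _ _)))).trans (IsBigO.of_bound 1
      (Eventually.of_forall fun T => ?_))
    rw [one_mul, norm_sub_rev]
  have hζt : Tendsto ζ (𝓝[<] Tc) (𝓝 (ζ Tc)) :=
    ((hanalytic Tc ⟨by linarith, le_rfl⟩).continuousWithinAt.tendsto).mono_left hle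
  have hxt : Tendsto (fun T => ‖xs T‖) (𝓝[<] Tc) (𝓝 1) :=
    hρt.congr' (h.mono fun T hT => PolynomialLeaf.rhoStar_toReal_eq_norm hT.2.1.2)
  have hsq : ∀ᶠ T in 𝓝[<] Tc, S.HasSqrtExpansion (ζ T) (xs T) (lam T) (κ T) ε C :=
    h.mono fun T hT => ⟨hT.2.1.2, fun y => hT.2.2.2.1.expansion hc.le⟩
  obtain ⟨x₀, hx₀⟩ := hsimple.1.2
  obtain ⟨xc, lamc, κc, hxc, hco, hlamc, hκc, hxlim, hlamlim⟩ :=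
    PolynomialLeaf.exists_critical_limit hζt hsimple.1.1 (M := M) (by
      filter_upwards [h, h1] with T hT hT1
      exact ⟨hT1.le, fun y hy => hT.2.2.2.1.norm_taylorBranch_le hc.le (hy.trans hT.1)⟩)
    hε hC.le hc₀ hxt
    (h.mono fun T hT => ⟨hT.2.2.2.1.stolz.norm_lam_le, hT.2.2.2.2.1, hT.2.2.2.2.2⟩) hsq hx₀
  obtain ⟨hr₁, hr₂⟩ := PolynomialLeaf.isBigO_branch_data hζO (x := xs) (lam := lam) (κ := κ) (C := C)
    (by
      filter_upwards [h, hsq] with T hT hT2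
      exact ⟨hT.2.1.2, hT2.hasSqrtCoefficient hε hC.le,
        norm_pos_iff.1 (hc₀.trans_le hT.2.2.2.2.2.2), hT.2.2.2.2.1⟩)
    hxc.1.2 hco hκc hlamc hxlim hlamlim
  refine ⟨⟨max M C, fun α hα => PolynomialLeaf.isAdmissibleWeight_of_lt hc
    (h.mono fun T hT => ⟨hT.1, hT.2.1, hT.2.2.1, hT.2.2.2.1⟩) hα⟩, xc, lamc, κc, hxc, hco, ?_⟩
  intro α β hβ hadm q hq hqs
  exact PolynomialLeaf.exists_critical_spike hc hc4 hε hM hC hc₀ h hg hρc hρ hlamc hκc hlamlim hr₁ hr₂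
    hβ hadm hq hqs
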